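/- Let $h\neq 0$ be a real number. For functions of $(n,x)\in\mathbb Z\times\mathbb R$ let $E$ be the shift in $n$, $\Delta=E-1$. Fields $u(n,x)$ are smooth in $x$ and rapidly decreasing, together with all $x$-derivatives, as $|x|\to\infty$ and $n\to-\infty$; on this class $\Delta$ is invertible, $\Delta^{-1}=\sum_{j\ge1}E^{-j}$. Let $\mathcal F$ be the set of maps $f=f(u)$ (so $f(0)=0$) obtained from $u$ by linear combinations, products, multiplication by $n$ and by $x$, shifts $E^{m}$ ($m\in\mathbb Z$), $\partial_x$ and $\Delta^{-1}$; let $f'[g]=\frac{d}{d\varepsilon}f(u+\varepsilon g)|_{\varepsilon=0}$. The inner product $(f,g)=\frac{h^2}{2}\sum_n\int fg\,dx$ is understood as in the formal calculus of variations: a functional is a class of densities (sums of products of two elements of $\mathcal F$) modulo linear combinations of the $\partial_xj$ and $\Delta j$, $j$ a density. An element $\gamma\in\mathcal F$ is a gradient of a functional $H$, $\gamma=\delta H/\delta u=\mathrm{grad}\,H$, if $H'[g]=(\gamma,g)$ for all $g\in\mathcal F$. Adjoints $^*$ are taken with respect to $(\cdot,\cdot)$. An operator $\theta$ on $\mathcal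 F$ is implectic if it is skew-symmetric and satisfies the Jacobi identity $(f,\theta'[\theta g]k)+(k,\theta'[\theta f]g)+(g,\theta'[\theta k]f)=0$. Pseudo-difference operators $\sum_{k\le N}a_k\Delta^k$ are composed by the Leibniz rule $\Delta^s a=\sum_{i\ge0}\binom{s}{i}(\Delta^iE^{s-i}a)\Delta^{s-i}$, $s\in\mathbb Z$; $(\cdot)_+$ is the part with $k\ge0$. Put $A_1=h^{-1}\Delta+u$. **Theorem.** There is exactly one operator $L=h^{-1}\Delta+u+hu_1\Delta^{-1}+h^2u_2\Delta^{-2}+\cdots$ with all $u_j\in\mathcal F$ and $L_x=[A_1,L]$. Put $A_m=(L^m)_+$ and $B_2=hxA_2+(x+hn)A_1+h\Delta^{-1}u$. Then the isospectral D$\Delta$KP flows $K_s=A_{s,x}-[A_1,A_s]$ ($s\ge1$) and the non-isospectral flow $\sigma_2=B_{2,x}-[A_1,B_2]$ are operators of multiplication by elements of $\mathcal F$, denoted by the same letters, and the following hold. 1. $\partial_x$ is a Noether operator of $u_t=\sigma_2$: $\sigma_2'$ has an adjoint with $\sigma_2'\partial_x+\partial_x\sigma_2'^*=0$. 2. Each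 isospectral equation $u_{t_s}=K_s$, $s\ge1$, is Hamiltonian: $\partial_x$ is implectic, there is a unique $\gamma_s=\partial_x^{-1}K_s\in\mathcal F$ with $\partial_x\gamma_s=K_s$, and there is a functional $H_s$ with $$K_s=\partial_x\frac{\delta H_s}{\delta u},\qquad \frac{\delta H_s}{\delta u}=\gamma_s .$$ 3. The gradients satisfy $$\gamma_1=u,\qquad \gamma_s=\frac1h\Bigl(\frac1{s-1}\,\mathrm{grad}(\gamma_{s-1},\sigma_2)-\gamma_{s-1}\Bigr)\quad(s>1),$$ meaning for $s>1$ that $(\gamma_{s-1},\sigma_2)$ has a gradient for which this holds, and the Hamiltonians in 2 can be given by $$H_1=\frac12(u,u),\qquad H_s=\frac1h\Bigl(\frac1{s-1}(\gamma_{s-1},\sigma_2)-H_{s-1}\Bigr)\quad(s>1).$$ -/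

import Mathlib

open scoped ContDiff

namespace DKP

/-- Real functions `φ(n, x)` of a lattice variable `n : ℤ` and a continuous variable `x : ℝ`. -/
abbrev Lat : Type := ℤ → ℝ → ℝ

/-- `φ` is smooth in `x` and, with all its `x`-derivatives, decays faster than any power as
`|x| → ∞` and as `n → -∞`. Every function that is rapidly decreasing in `(n, x)` is of this kind.
Nothing is asked as `n → +∞`, so that the class is stable under the inverse difference below:
a function that is rapidly decreasing in both directions of `n` has in general no rapidly
decreasing antidifference. -/
def IsRapid (φ : Lat) : Prop :=
  (∀ n, ContDiff ℝ ∞ (φ n)) ∧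
    ∀ (N : ℤ) (i j k : ℕ), ∃ C : ℝ, ∀ n ≤ N, ∀ x : ℝ,
      (1 + |(n : ℝ)|) ^ i * (1 + |x|) ^ j * |iteratedDeriv k (φ n) x| ≤ C

/-- Multipliers of the class `IsRapid`: polynomial growth of all `x`-derivatives. -/
def IsModerate (a : Lat) : Prop :=
  (∀ n, ContDiff ℝ ∞ (a n)) ∧
    ∀ (N : ℤ) (k : ℕ), ∃ (C : ℝ) (i j : ℕ), ∀ n ≤ N, ∀ x : ℝ,
      |iteratedDeriv k (a n) x| ≤ C * ((1 + |(n : ℝ)|) ^ i * (1 + |x|) ^ j)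

/-- The shift `E ^ m`. -/
def shift (m : ℤ) (φ : Lat) : Lat := fun n x => φ (n + m) x
/-- The derivative `∂ₓ`. -/
noncomputable def dx (φ : Lat) : Lat := fun n => deriv (φ n)
/-- The difference `Δ = E - 1`. -/
def delta (φ : Lat) : Lat := fun n x => φ (n + 1) x - φ n x
/-- The inverse difference, `(Δ⁻¹ φ)(n) = φ(n-1) + φ(n-2) + ⋯`. -/
noncomputable def deltaInv (φ : Lat) : Lat := fun n x => ∑' j : ℕ, φ (n - 1 - (j : ℤ)) x

theorem IsRapid.moderate {φ : Lat} (h : IsRapid φ) : IsModerate φ := by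
  refine ⟨h.1, fun N k => ?_⟩
  obtain ⟨C, hC⟩ := h.2 N 0 0 k
  exact ⟨C, 0, 0, fun n hn x => by simpa using hC n hn x⟩

theorem IsModerate.mul {a φ : Lat} (ha : IsModerate a) (h : IsRapid φ) : IsRapid (a * φ) := by
  refine ⟨fun n => (ha.1 n).mul (h.1 n), fun N i j k => ?_⟩
  have key : ∀ l : ℕ, ∃ C : ℝ, ∀ n ≤ N, ∀ x : ℝ, (1 + |(n : ℝ)|) ^ i * (1 + |x|) ^ j *
      |(k.choose l : ℝ) * iteratedDeriv l (a n) x * iteratedDeriv (k - l) (φ n) x| ≤ C := by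
    intro l
    obtain ⟨C₁, p, q, h₁⟩ := ha.2 N l
    obtain ⟨C₂, h₂⟩ := h.2 N (i + p) (j + q) (k - l)
    refine ⟨(k.choose l : ℝ) * (|C₁| * C₂), fun n hn x => ?_⟩
    have e₁ := h₁ n hn x
    have e₂ := h₂ n hn x
    have hP : (0 : ℝ) ≤ (1 + |(n : ℝ)|) ^ i * (1 + |x|) ^ j := by positivity
    have hM : (0 : ℝ) ≤ (1 + |(n : ℝ)|) ^ p * (1 + |x|) ^ q := by positivity
    have e₁' : |iteratedDeriv l (a n) x| ≤ |C₁| * ((1 + |(n : ℝ)|) ^ p * (1 + |x|) ^ q) :=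
      e₁.trans (mul_le_mul_of_nonneg_right (le_abs_self _) hM)
    rw [abs_mul, abs_mul, Nat.abs_cast]
    calc (1 + |(n : ℝ)|) ^ i * (1 + |x|) ^ j * ((k.choose l : ℝ) * |iteratedDeriv l (a n) x| *
          |iteratedDeriv (k - l) (φ n) x|)
        ≤ (1 + |(n : ℝ)|) ^ i * (1 + |x|) ^ j * ((k.choose l : ℝ) *
          (|C₁| * ((1 + |(n : ℝ)|) ^ p * (1 + |x|) ^ q)) *
          |iteratedDeriv (k - l) (φ n) x|) := by gcongr
      _ = (k.choose l : ℝ) * (|C₁| * ((1 + |(n : ℝ)|) ^ (i + p) * (1 + |x|) ^ (j + q) *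
          |iteratedDeriv (k - l) (φ n) x|)) := by rw [pow_add, pow_add]; ring
      _ ≤ _ := by gcongr
  choose C hC using key
  refine ⟨∑ l ∈ Finset.range (k + 1), C l, fun n hn x => ?_⟩
  have hd : iteratedDeriv k ((a * φ) n) x = ∑ l ∈ Finset.range (k + 1),
      (k.choose l : ℝ) * iteratedDeriv l (a n) x * iteratedDeriv (k - l) (φ n) x :=
    iteratedDeriv_mul (((ha.1 n).of_le (by exact_mod_cast le_top)).contDiffAt)
      (((h.1 n).of_le (by exact_mod_cast le_top)).contDiffAt)
  rw [hd]
  calc _ ≤ (1 + |(n : ℝ)|) ^ i * (1 + |x|) ^ j * ∑ l ∈ Finset.range (k + 1),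
        |(k.choose l : ℝ) * iteratedDeriv l (a n) x * iteratedDeriv (k - l) (φ n) x| := by
        gcongr; exact Finset.abs_sum_le_sum_abs _ _
    _ ≤ _ := by
        rw [Finset.mul_sum]
        exact Finset.sum_le_sum fun l _ => hC l n hn x

theorem isModerate_coord_n : IsModerate (fun n _ => (n : ℝ)) := by
  refine ⟨fun n => contDiff_const, fun N k => ⟨1, 1, 0, fun n _ x => ?_⟩⟩
  rw [iteratedDeriv_const]
  split_ifs
  · simp
  · simp; positivity

theorem isModerate_coord_x : IsModerate (fun _ x => x) := by
  refine ⟨fun n => contDiff_id, fun N k => ⟨1, 0, 1, fun n _ x => ?_⟩⟩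
  have : iteratedDeriv k (fun x : ℝ => x) x = if k = 0 then x else if k = 1 then 1 else 0 :=
    iteratedDeriv_id
  rw [this]
  split_ifs <;> simp
  positivity

theorem isModerate_const (c : ℝ) : IsModerate (fun _ _ => c) := by
  refine ⟨fun n => contDiff_const, fun N k => ⟨|c|, 0, 0, fun n _ x => ?_⟩⟩
  rw [iteratedDeriv_const]
  split_ifs <;> simp

theorem IsRapid.add {φ ψ : Lat} (h₁ : IsRapid φ) (h₂ : IsRapid ψ) : IsRapid (φ + ψ) := by
  refine ⟨fun n => (h₁.1 n).add (h₂.1 n), fun N i j k => ?_⟩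
  obtain ⟨C₁, e₁⟩ := h₁.2 N i j k
  obtain ⟨C₂, e₂⟩ := h₂.2 N i j k
  refine ⟨C₁ + C₂, fun n hn x => ?_⟩
  have hd : iteratedDeriv k ((φ + ψ) n) x = iteratedDeriv k (φ n) x + iteratedDeriv k (ψ n) x :=
    iteratedDeriv_add (((h₁.1 n).of_le (by exact_mod_cast le_top)).contDiffAt)
      (((h₂.1 n).of_le (by exact_mod_cast le_top)).contDiffAt)
  rw [hd]
  calc _ ≤ (1 + |(n : ℝ)|) ^ i * (1 + |x|) ^ j *
        (|iteratedDeriv k (φ n) x| + |iteratedDeriv k (ψ n) x|) := by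
        gcongr; exact abs_add_le _ _
    _ ≤ _ := by rw [mul_add]; exact add_le_add (e₁ n hn x) (e₂ n hn x)

theorem IsRapid.smul {φ : Lat} (c : ℝ) (h : IsRapid φ) : IsRapid (c • φ) :=
  (isModerate_const c).mul h

theorem IsRapid.dx {φ : Lat} (h : IsRapid φ) : IsRapid (dx φ) := by
  refine ⟨fun n => (h.1 n).deriv' , fun N i j k => ?_⟩
  obtain ⟨C, e⟩ := h.2 N i j (k + 1)
  refine ⟨C, fun n hn x => ?_⟩
  have := e n hn x
  rwa [iteratedDeriv_succ'] at this

theorem IsRapid.shift {φ : Lat} (m : ℤ) (h : IsRapid φ) : IsRapid (shift m φ) := by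
  refine ⟨fun n => h.1 (n + m), fun N i j k => ?_⟩
  obtain ⟨C, e⟩ := h.2 (N + m) i j k
  refine ⟨(1 + |(m : ℝ)|) ^ i * C, fun n hn x => ?_⟩
  have h1 : 1 + |(n : ℝ)| ≤ (1 + |(m : ℝ)|) * (1 + |((n + m : ℤ) : ℝ)|) := by
    have : |(n : ℝ)| ≤ |((n + m : ℤ) : ℝ)| + |(m : ℝ)| := by
      have := abs_sub ((n + m : ℤ) : ℝ) (m : ℝ)
      push_cast at this ⊢
      simpa using this
    nlinarith [abs_nonneg (m : ℝ), abs_nonneg ((n + m : ℤ) : ℝ)]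
  calc (1 + |(n : ℝ)|) ^ i * (1 + |x|) ^ j * |iteratedDeriv k (φ (n + m)) x|
      ≤ ((1 + |(m : ℝ)|) * (1 + |((n + m : ℤ) : ℝ)|)) ^ i * (1 + |x|) ^ j *
        |iteratedDeriv k (φ (n + m)) x| := by gcongr
    _ = (1 + |(m : ℝ)|) ^ i * ((1 + |((n + m : ℤ) : ℝ)|) ^ i * (1 + |x|) ^ j *
        |iteratedDeriv k (φ (n + m)) x|) := by rw [mul_pow]; ring
    _ ≤ _ := by
        gcongr
        exact e (n + m) (by omega) x

theorem IsRapid.deltaInv_aux {φ : Lat} (h : IsRapid φ) (N : ℤ) (i j k : ℕ) :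
    ∃ C : ℝ, ∀ n ≤ N, ∀ x : ℝ, ∀ m : ℕ,
      (1 + |(n : ℝ)|) ^ i * (1 + |x|) ^ j * |iteratedDeriv k (φ (n - 1 - (m : ℤ))) x| ≤
        C * (1 / ((m : ℝ) + 1) ^ 2) := by
  obtain ⟨C, e⟩ := h.2 N (i + 2) j k
  refine ⟨(1 + |(N : ℝ)|) ^ (i + 2) * C, fun n hn x m => ?_⟩
  have hnN : (n : ℝ) ≤ N := by exact_mod_cast hn
  have hm : (0 : ℝ) ≤ m := Nat.cast_nonneg m
  have hp := e (n - 1 - m) (by omega) x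
  set D := |iteratedDeriv k (φ (n - 1 - (m : ℤ))) x|
  have hD : 0 ≤ D := abs_nonneg _
  set q : ℝ := |((n - 1 - (m : ℤ) : ℤ) : ℝ)| with hq
  have hq0 : 0 ≤ q := abs_nonneg _
  have hN0 : 0 ≤ |(N : ℝ)| := abs_nonneg _
  have hq1 : (m : ℝ) + 1 - n ≤ q := by
    have := neg_abs_le ((n - 1 - (m : ℤ) : ℤ) : ℝ)
    rw [← hq] at this
    push_cast at this
    linarith
  have hN1 : (N : ℝ) ≤ |(N : ℝ)| := le_abs_self _
  have b₁ : 1 + |(n : ℝ)| ≤ (1 + |(N : ℝ)|) * (1 + q) := by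
    rcases abs_cases (n : ℝ) with ⟨h1, h2⟩ | ⟨h1, h2⟩ <;> rw [h1] <;> nlinarith
  have b₂ : (m : ℝ) + 1 ≤ (1 + |(N : ℝ)|) * (1 + q) := by nlinarith
  rw [mul_one_div, le_div_iff₀ (by positivity)]
  calc (1 + |(n : ℝ)|) ^ i * (1 + |x|) ^ j * D * ((m : ℝ) + 1) ^ 2
      ≤ ((1 + |(N : ℝ)|) * (1 + q)) ^ i * (1 + |x|) ^ j * D * ((1 + |(N : ℝ)|) * (1 + q)) ^ 2 := by
        gcongr
    _ = (1 + |(N : ℝ)|) ^ (i + 2) * ((1 + q) ^ (i + 2) * (1 + |x|) ^ j * D) := by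
        rw [mul_pow, mul_pow, pow_add, pow_add]; ring
    _ ≤ _ := by gcongr

theorem summable_sq : Summable fun m : ℕ => 1 / ((m : ℝ) + 1) ^ 2 := by
  have := (summable_nat_add_iff 1).mpr (Real.summable_one_div_nat_pow.mpr one_lt_two)
  simpa using this

theorem IsRapid.deltaInv {φ : Lat} (h : IsRapid φ) : IsRapid (deltaInv φ) := by
  have hb : ∀ n : ℤ, ∃ v : ℕ → ℕ → ℝ, (∀ k, Summable (v k)) ∧
      ∀ (k m : ℕ) (x : ℝ), ‖iteratedFDeriv ℝ k (φ (n - 1 - (m : ℤ))) x‖ ≤ v k m := by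
    intro n
    choose C hC using fun k => h.deltaInv_aux n 0 0 k
    refine ⟨fun k m => C k * (1 / ((m : ℝ) + 1) ^ 2), fun k => summable_sq.mul_left _,
      fun k m x => ?_⟩
    rw [norm_iteratedFDeriv_eq_norm_iteratedDeriv, Real.norm_eq_abs]
    simpa using hC k n le_rfl x m
  refine ⟨fun n => ?_, fun N i j k => ?_⟩
  · obtain ⟨v, hv, hv'⟩ := hb n
    exact contDiff_tsum (N := ⊤) (fun m => h.1 _) (fun k _ => hv k) (fun k m x _ => hv' k m x)
  · obtain ⟨C, hC⟩ := h.deltaInv_aux N i j k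
    refine ⟨∑' m : ℕ, C * (1 / ((m : ℝ) + 1) ^ 2), fun n hn x => ?_⟩
    obtain ⟨v, hv, hv'⟩ := hb n
    have hd : iteratedDeriv k (DKP.deltaInv φ n) x =
        ∑' m : ℕ, iteratedDeriv k (φ (n - 1 - (m : ℤ))) x := by
      have hsum : Summable fun m : ℕ => iteratedFDeriv ℝ k (φ (n - 1 - (m : ℤ))) x :=
        Summable.of_norm_bounded (hv k) fun m => hv' k m x
      have := iteratedFDeriv_tsum_apply (N := ⊤) (f := fun (m : ℕ) => φ (n - 1 - (m : ℤ)))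
        (fun m => h.1 _) (fun k _ => hv k) (fun k m x _ => hv' k m x) (k := k) le_top x
      simp only [iteratedDeriv]
      unfold DKP.deltaInv
      rw [this, ContinuousMultilinearMap.tsum_eval hsum]
    have hs : Summable fun m : ℕ => C * (1 / ((m : ℝ) + 1) ^ 2) := summable_sq.mul_left _
    have hs' : Summable fun m : ℕ => (1 + |(n : ℝ)|) ^ i * (1 + |x|) ^ j *
        ‖iteratedDeriv k (φ (n - 1 - (m : ℤ))) x‖ :=
      Summable.of_nonneg_of_le (fun m => by positivity) (fun m => hC n hn x m) hs
    have hpos : (0 : ℝ) < (1 + |(n : ℝ)|) ^ i * (1 + |x|) ^ j := by positivity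
    have hs'' : Summable fun m : ℕ => ‖iteratedDeriv k (φ (n - 1 - (m : ℤ))) x‖ :=
      (summable_mul_left_iff hpos.ne').mp hs'
    rw [hd, ← Real.norm_eq_abs]
    calc _ ≤ (1 + |(n : ℝ)|) ^ i * (1 + |x|) ^ j *
          ∑' m : ℕ, ‖iteratedDeriv k (φ (n - 1 - (m : ℤ))) x‖ := by
          exact mul_le_mul_of_nonneg_left (norm_tsum_le_tsum_norm hs'') hpos.le
      _ = ∑' m : ℕ, (1 + |(n : ℝ)|) ^ i * (1 + |x|) ^ j *
          ‖iteratedDeriv k (φ (n - 1 - (m : ℤ))) x‖ := by rw [tsum_mul_left]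
      _ ≤ _ := hs'.tsum_le_tsum (fun m => hC n hn x m) hs

theorem IsRapid.summable {φ : Lat} (h : IsRapid φ) (n : ℤ) (x : ℝ) :
    Summable fun j : ℕ => φ (n - 1 - (j : ℤ)) x := by
  obtain ⟨C, hC⟩ := h.deltaInv_aux n 0 0 0
  exact Summable.of_norm_bounded (summable_sq.mul_left C) fun m => by
    simpa using hC n le_rfl x m

/-- `Δ Δ⁻¹ = 1`. -/
theorem delta_deltaInv {φ : Lat} (h : IsRapid φ) : delta (deltaInv φ) = φ := by
  funext n x
  have e : deltaInv φ (n + 1) x = φ n x + deltaInv φ n x := by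
    unfold deltaInv
    rw [(h.summable (n + 1) x).tsum_eq_zero_add]
    congr 1
    · simp
    · congr 1
      funext j
      congr 1
      push_cast
      ring
  simp [delta, e]

/-- `Δ⁻¹ Δ = 1`. -/
theorem deltaInv_delta {φ : Lat} (h : IsRapid φ) : deltaInv (delta φ) = φ := by
  funext n x
  have e : deltaInv (shift 1 φ) n x = φ n x + deltaInv φ n x := by
    unfold deltaInv
    rw [((h.shift 1).summable n x).tsum_eq_zero_add]
    congr 1
    · simp [shift]
    · congr 1
      funext j
      simp only [shift]
      congr 1
      push_cast
      ring
  have e' : deltaInv (delta φ) n x = deltaInv (shift 1 φ) n x - deltaInv φ n x :=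
    ((h.shift 1).summable n x).tsum_sub (h.summable n x)
  rw [e', e]
  ring

/-- The space of fields `u = u(n, x)`. -/
def phase : Submodule ℝ Lat where
  carrier := {φ | IsRapid φ}
  add_mem' h₁ h₂ := h₁.add h₂
  zero_mem' := ⟨fun _ => contDiff_const, fun _ _ _ k => ⟨0, fun n _ x => by
    have : iteratedDeriv k ((0 : Lat) n) x = 0 := by
      have := iteratedDeriv_const (n := k) (c := (0 : ℝ)) (x := x)
      rwa [ite_self] at this
    rw [this, abs_zero, mul_zero]⟩⟩
  smul_mem' c _ h := h.smul c

/-- Maps `u ↦ f(u)` from fields to functions of `(n, x)`, with pointwise operations. -/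
abbrev Fn : Type := phase → Lat

/-- Apply an operation on functions of `(n, x)` to the values of a map. -/
def lift (T : Lat → Lat) (f : Fn) : Fn := fun u => T (f u)

/-- The map `u ↦ u`. -/
def field : Fn := fun u => u

/-- The functions `f(u)` with `f(0) = 0` of the calculus: built from `u` by linear combinations,
products, multiplication by `n` and `x`, shifts, `∂ₓ` and `Δ⁻¹`. -/
inductive IsFlowFn : Fn → Prop
  | field : IsFlowFn field
  | add {f g : Fn} : IsFlowFn f → IsFlowFn g → IsFlowFn (f + g)
  | smul (c : ℝ) {f : Fn} : IsFlowFn f → IsFlowFn (c • f)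
  | mul {f g : Fn} : IsFlowFn f → IsFlowFn g → IsFlowFn (f * g)
  | mul_n {f : Fn} : IsFlowFn f → IsFlowFn (fun u n x => (n : ℝ) * f u n x)
  | mul_x {f : Fn} : IsFlowFn f → IsFlowFn (fun u n x => x * f u n x)
  | shift (m : ℤ) {f : Fn} : IsFlowFn f → IsFlowFn (lift (shift m) f)
  | dx {f : Fn} : IsFlowFn f → IsFlowFn (lift dx f)
  | deltaInv {f : Fn} : IsFlowFn f → IsFlowFn (lift deltaInv f)

theorem IsFlowFn.isRapid {f : Fn} (hf : IsFlowFn f) (u : phase) : IsRapid (f u) := by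
  induction hf with
  | field => exact u.2
  | add _ _ h₁ h₂ => exact h₁.add h₂
  | smul c _ h => exact h.smul c
  | mul _ _ h₁ h₂ => exact h₁.moderate.mul h₂
  | mul_n _ h => exact isModerate_coord_n.mul h
  | mul_x _ h => exact isModerate_coord_x.mul h
  | shift m _ h => exact h.shift m
  | dx _ h => exact h.dx
  | deltaInv _ h => exact h.deltaInv

/-- The space `𝓕` of these functions. -/
def flowFn : Submodule ℝ Fn where
  carrier := {f | IsFlowFn f}
  add_mem' h₁ h₂ := h₁.add h₂
  zero_mem' := by
    have := IsFlowFn.smul 0 IsFlowFn.field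
    rwa [zero_smul] at this
  smul_mem' c _ h := h.smul c

/-- The value of `f ∈ 𝓕` at `u`, as a field. -/
def value (f : flowFn) (u : phase) : phase := ⟨f.1 u, f.2.isRapid u⟩

/-- `∂ₓ` on fields. -/
noncomputable def phaseDx : phase →ₗ[ℝ] phase where
  toFun φ := ⟨dx φ.1, IsRapid.dx φ.2⟩
  map_add' φ ψ := by
    ext n x
    exact deriv_add ((φ.2.1 n).differentiable (by simp) x) ((ψ.2.1 n).differentiable (by simp) x)
  map_smul' c φ := by
    ext n x
    exact deriv_const_smul c ((φ.2.1 n).differentiable (by simp) x)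

/-- `∂ₓ` on `𝓕`. -/
noncomputable def flowDx : flowFn →ₗ[ℝ] flowFn where
  toFun f := ⟨lift dx f.1, IsFlowFn.dx f.2⟩
  map_add' f g := by
    ext u n x
    exact congrFun (congrFun (congrArg Subtype.val
      (phaseDx.map_add (value f u) (value g u))) n) x
  map_smul' c f := by
    ext u n x
    exact congrFun (congrFun (congrArg Subtype.val (phaseDx.map_smul c (value f u))) n) x

/-- The Gateaux derivative `f'[g] = d/dε f(u + ε g(u))` at `ε = 0`. -/
noncomputable def gateaux (f : Fn) (g : flowFn) : Fn := fun u n x =>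
  deriv (fun ε : ℝ => f (u + ε • value g u) n x) 0

/-- Densities: sums of products of two elements of `𝓕`. -/
def density : Submodule ℝ Fn :=
  Submodule.span ℝ {k | ∃ f ∈ flowFn, ∃ g ∈ flowFn, k = f * g}

/-- The span of the total derivatives `∂ₓ j` and total differences `Δ j` of densities `j`. -/
def totalDer : Submodule ℝ density :=
  Submodule.span ℝ {k | ∃ j : density, (k : Fn) = lift dx j ∨ (k : Fn) = lift delta j}

/-- Functionals of the formal calculus of variations. The class of a density `k` is the formal
`∑ₙ ∫ k dx`: densities are identified when they differ by total derivatives and differences. -/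
abbrev Functional : Type := density ⧸ totalDer

/-- The inner product `(f, g) = (h² / 2) ∑ₙ ∫ f g dx`. -/
noncomputable def innerProd (h : ℝ) (f g : flowFn) : Functional :=
  Submodule.Quotient.mk
    ((h ^ 2 / 2) • ⟨f.1 * g.1, Submodule.subset_span ⟨f.1, f.2, g.1, g.2, rfl⟩⟩)

/-- `γ` is the gradient `δH/δu`: `H'[g] = (γ, g)` for all `g ∈ 𝓕`, where `H'[g]` is the class of
`k'[g]` for a density `k` of `H`. -/
def HasGradient (h : ℝ) (H : Functional) (γ : flowFn) : Prop :=
  ∀ k : density, Submodule.Quotient.mk k = H → ∀ g : flowFn,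
    ∃ k' : density, (k' : Fn) = gateaux k g ∧ (Submodule.Quotient.mk k' : Functional) = innerProd h γ g

/-- `S` is an adjoint of the operator `T` on `𝓕`. -/
def IsAdjoint (h : ℝ) (T S : flowFn →ₗ[ℝ] flowFn) : Prop :=
  ∀ f g : flowFn, innerProd h (T f) g = innerProd h f (S g)

/-- `θ = θ(u)` is an implectic operator: it acts on `𝓕`, is skew-symmetric and satisfies the
Jacobi identity `(f, θ'[θ g] k) + (k, θ'[θ f] g) + (g, θ'[θ k] f) = 0`. -/
def IsImplectic (h : ℝ) (θ : phase → phase →ₗ[ℝ] phase) : Prop :=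
  ∃ (Θ : flowFn → flowFn) (Θ' : flowFn → flowFn → flowFn),
    (∀ f u, value (Θ f) u = θ u (value f u)) ∧
    (∀ w f u n x, (Θ' w f).1 u n x =
      deriv (fun ε : ℝ => (θ (u + ε • value w u) (value f u)).1 n x) 0) ∧
    (∀ f g, innerProd h (Θ f) g = -innerProd h f (Θ g)) ∧
    ∀ f g k, innerProd h f (Θ' (Θ g) k) + innerProd h k (Θ' (Θ f) g) + innerProd h g (Θ' (Θ k) f) = 0

/-- Pseudo-difference operators `∑ₖ aₖ Δ^k`, given by their coefficients `k ↦ aₖ`. All operators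
below have order bounded above. -/
abbrev PsiDO : Type := ℤ → Fn

/-- Composition, from the discrete Leibniz rule
`Δ^s b = ∑ᵢ C(s, i) (Δ^i E^(s-i) b) Δ^(s-i)` for `s ∈ ℤ`; the sum is over the pairs `(s, t)` of
orders of the two factors, with `i = s + t - k`. -/
noncomputable def comp (A B : PsiDO) : PsiDO := fun k =>
  ∑ᶠ p : ℤ × ℤ, if k ≤ p.1 + p.2 then
    Ring.choose p.1 (p.1 + p.2 - k).toNat •
      (A p.1 * (lift delta)^[(p.1 + p.2 - k).toNat] (lift (shift (k - p.2)) (B p.2)))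
  else 0

/-- The operator of multiplication by a function. -/
noncomputable def mulOp (f : Fn) : PsiDO := fun k => if k = 0 then f else 0

/-- Powers of an operator. -/
noncomputable def opPow (A : PsiDO) : ℕ → PsiDO
  | 0 => mulOp 1
  | m + 1 => comp A (opPow A m)

/-- The part without negative powers of `Δ`. -/
noncomputable def posPart (A : PsiDO) : PsiDO := fun k => if 0 ≤ k then A k else 0

/-- The coefficientwise `x`-derivative of an operator. -/
noncomputable def dxOp (A : PsiDO) : PsiDO := fun k => lift dx (A k)

/-- `[A, B] = A B - B A`. -/
noncomputable def commutator (A B : PsiDO) : PsiDO := comp A B - comp B A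

/-- `A₁ = h⁻¹ Δ + u`. -/
noncomputable def opA₁ (h : ℝ) : PsiDO := fun k =>
  if k = 1 then fun _ _ _ => h⁻¹ else if k = 0 then field else 0

/-- `L = h⁻¹ Δ + u + h u₁ Δ⁻¹ + h² u₂ Δ⁻² + ⋯` with `uⱼ ∈ 𝓕` determined by `L_x = [A₁, L]`. -/
structure IsLaxOperator (h : ℝ) (L : PsiDO) : Prop where
  order : ∀ k : ℤ, 1 < k → L k = 0
  lead : L 1 = fun _ _ _ => h⁻¹
  zero : L 0 = field
  coeff : ∀ j : ℕ, ∃ v ∈ flowFn, L (-(j : ℤ)) = h ^ j • v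
  lax : dxOp L = commutator (opA₁ h) L

/-- `A_m = (L ^ m)₊`. -/
noncomputable def opA (L : PsiDO) (m : ℕ) : PsiDO := posPart (opPow L m)

/-- `B₂ = h x A₂ + (x + h n) A₁ + h Δ⁻¹ u`. -/
noncomputable def opB₂ (h : ℝ) (L : PsiDO) : PsiDO := fun k =>
  (fun _ _ x => h * x : Fn) * opA L 2 k + (fun _ n x => x + h * n : Fn) * opA L 1 k +
    mulOp (h • lift deltaInv field) k

/-- `f = A_x - [A₁, A]`: the flow `f` has the zero curvature representation with operator `A`. -/
def ZeroCurvature (h : ℝ) (A : PsiDO) (f : flowFn) : Prop :=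
  mulOp f.1 = dxOp A - commutator (opA₁ h) A

end DKP

open DKP

namespace DKP

/-! Since `Δ = E - 1`, a pseudo-difference operator is a Laurent series in `E⁻¹`. Such series are
placed in the larger ring `Op`, whose coefficients are linear endomorphisms of the algebra of
coefficients. There `∂ₓ` and the directional derivatives `f ↦ f'[g]` are elements of the same
associative ring, so the whole Lax formalism consists of commutator identities. With `C = ∂ₓ - A₁`
(`connection`) the Lax operator satisfies `[C, L] = 0`, and a zero curvature representation of a
flow `g` reads `[C, B] = g`. `Represents` translates between expansions in `Δ` and in `E`.

Everything about `L` rests on one rigidity statement, `eq_zero_of_lie_connection_eq_zero`: a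
difference operator with coefficients in `𝓕` that commutes with `C` is zero. Its leading coefficient
would be invariant under `E`, and a nonzero field that decays as `n → -∞` is not. This gives
uniqueness of `L`. It also gives the evolution of `L` along a flow (`lie_gateauxDer_eq`), because by
the Jacobi identity `L'[g] - [B, L]` commutes with `C`. The outcome is `L'[K_s] = [A_s, L]` and
`L'[σ₂] = [B₂, L] + h L² + L`, where `h L² + L` compensates the value of `[B₂, L]` at `u = 0`.

Let `γ_s` be the coefficient of `E⁰` in `L^s` minus its value at `u = 0`. The order zero part of the
zero curvature equations says `K_s = ∂ₓ γ_s` and `σ₂ = ∂ₓ ω` with `ω = h x γ₂ + (x + h n) u + h Δ⁻¹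
u`. The coefficient of `E⁰` in `(L^s)'[σ₂] = [B₂, L^s] + s (h L^(s+1) + L^s)` yields `γ_s'[σ₂] -
ω'[K_s] = s (h γ_{s+1} + γ_s)` (`flowGateaux_gradient_flowσ₂`).

The operator `ω'` is self-adjoint (`isAdjoint_linearization_potential`). Hence `σ₂' = ∂ₓ ω'` has
adjoint `-ω' ∂ₓ`, which is the Noether identity. If `γ_s` is a gradient, then `γ_s'` is symmetric
and `(γ_s, σ₂)'[g] = (γ_s'[σ₂] - ω'[K_s], g)`. By the recursion, `(γ_s, σ₂)` has gradient `s (h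
γ_{s+1} + γ_s)`, so `γ_{s+1}` is a gradient too. The induction starts at `γ₁ = u`. -/

/-! ### Curves that are polynomial in a parameter. -/

/-- Functions of `(n, x)` that are smooth in `x`. -/
def smoothLat : Submodule ℝ Lat where
  carrier := {φ | ∀ n, ContDiff ℝ ∞ (φ n)}
  add_mem' h₁ h₂ := fun n => (h₁ n).add (h₂ n)
  zero_mem' := fun _ => contDiff_const
  smul_mem' c _ h := fun n => (h n).const_smul c

theorem phase_le_smoothLat : phase ≤ smoothLat := fun _ h => h.1

/-- Curves `ε ↦ ∑ᵢ ε ^ i cᵢ` that are polynomial in `ε`, with coefficients in `P`. -/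
def curves (P : Submodule ℝ Lat) : Submodule ℝ (ℝ → Lat) :=
  Submodule.span ℝ {φ | ∃ i : ℕ, ∃ c ∈ P, φ = fun ε => ε ^ i • c}

/-- The velocity of a curve at `ε = 0`. -/
noncomputable def velocity (φ : ℝ → Lat) : Lat := fun n x => deriv (fun ε => φ ε n x) 0

variable {P Q R : Submodule ℝ Lat} {φ ψ : ℝ → Lat}

theorem mem_curves_monomial (i : ℕ) {c : Lat} (hc : c ∈ P) : (fun ε : ℝ => ε ^ i • c) ∈ curves P :=
  Submodule.subset_span ⟨i, c, hc, rfl⟩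

theorem mem_curves_const {c : Lat} (hc : c ∈ P) : (fun _ : ℝ => c) ∈ curves P := by
  simpa using mem_curves_monomial 0 hc

theorem curves_mono (h : P ≤ Q) : curves P ≤ curves Q :=
  Submodule.span_mono fun _ ⟨i, c, hc, e⟩ => ⟨i, c, h hc, e⟩

theorem differentiableAt_of_mem_curves (hφ : φ ∈ curves P) (n : ℤ) (x : ℝ) :
    DifferentiableAt ℝ (fun ε => φ ε n x) 0 := by
  induction hφ using Submodule.span_induction with
  | mem φ h =>
    obtain ⟨i, c, -, rfl⟩ := h
    exact (differentiableAt_pow i).mul_const (c n x)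
  | zero => exact differentiableAt_const 0
  | add φ ψ _ _ h₁ h₂ => exact h₁.add h₂
  | smul r φ _ h => exact h.const_smul r

theorem apply_mem_of_mem_curves (hφ : φ ∈ curves P) (ε : ℝ) : φ ε ∈ P := by
  induction hφ using Submodule.span_induction with
  | mem φ h =>
    obtain ⟨i, c, hc, rfl⟩ := h
    exact P.smul_mem _ hc
  | zero => exact P.zero_mem
  | add φ ψ _ _ h₁ h₂ => exact P.add_mem h₁ h₂
  | smul r φ _ h => exact P.smul_mem r h

theorem velocity_add (hφ : φ ∈ curves P) (hψ : ψ ∈ curves P) :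
    velocity (φ + ψ) = velocity φ + velocity ψ := by
  funext n x
  exact deriv_add (differentiableAt_of_mem_curves hφ n x) (differentiableAt_of_mem_curves hψ n x)

theorem velocity_smul (r : ℝ) (hφ : φ ∈ curves P) : velocity (r • φ) = r • velocity φ := by
  funext n x
  exact deriv_const_smul r (differentiableAt_of_mem_curves hφ n x)

theorem velocity_mul (hφ : φ ∈ curves P) (hψ : ψ ∈ curves Q) :
    velocity (φ * ψ) = velocity φ * ψ 0 + φ 0 * velocity ψ := by
  funext n x
  exact deriv_mul (differentiableAt_of_mem_curves hφ n x) (differentiableAt_of_mem_curves hψ n x)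

theorem velocity_const (c : Lat) : velocity (fun _ => c) = 0 := by
  funext n x
  exact deriv_const _ _

theorem velocity_monomial (i : ℕ) (c : Lat) :
    velocity (fun ε => ε ^ i • c) = if i = 1 then c else 0 := by
  funext n x
  have : velocity (fun ε => ε ^ i • c) n x = (i * (0 : ℝ) ^ (i - 1)) * c n x := by
    have := ((hasDerivAt_pow i (0 : ℝ)).mul_const (c n x)).deriv
    exact this
  rw [this]
  rcases i with _ | _ | i <;> simp

theorem velocity_mem (hφ : φ ∈ curves P) : velocity φ ∈ P := by
  induction hφ using Submodule.span_induction with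
  | mem φ h =>
    obtain ⟨i, c, hc, rfl⟩ := h
    rw [velocity_monomial]
    split_ifs
    exacts [hc, P.zero_mem]
  | zero => exact (velocity_const 0).symm ▸ P.zero_mem
  | add φ ψ h₁ h₂ e₁ e₂ => rw [velocity_add h₁ h₂]; exact P.add_mem e₁ e₂
  | smul r φ h e => rw [velocity_smul r h]; exact P.smul_mem r e

theorem mul_mem_curves (hPQ : ∀ c ∈ P, ∀ d ∈ Q, c * d ∈ R) (hφ : φ ∈ curves P)
    (hψ : ψ ∈ curves Q) : φ * ψ ∈ curves R := by
  induction hφ, hψ using Submodule.span_induction₂ with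
  | mem_mem φ ψ h₁ h₂ =>
    obtain ⟨i, c, hc, rfl⟩ := h₁
    obtain ⟨j, d, hd, rfl⟩ := h₂
    refine Submodule.subset_span ⟨i + j, c * d, hPQ c hc d hd, ?_⟩
    funext ε
    exact (smul_mul_smul_comm _ _ _ _).trans (by rw [pow_add])
  | zero_left => rw [zero_mul]; exact Submodule.zero_mem _
  | zero_right => rw [mul_zero]; exact Submodule.zero_mem _
  | add_left _ _ _ _ _ _ e₁ e₂ => rw [add_mul]; exact Submodule.add_mem _ e₁ e₂
  | add_right _ _ _ _ _ _ e₁ e₂ => rw [mul_add]; exact Submodule.add_mem _ e₁ e₂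
  | smul_left r _ _ _ _ e => rw [smul_mul_assoc]; exact Submodule.smul_mem _ r e
  | smul_right r _ _ _ _ e => rw [mul_smul_comm]; exact Submodule.smul_mem _ r e

/-- An operation that is linear on `P`, with values in `Q`. -/
structure LinearOn (P Q : Submodule ℝ Lat) (T : Lat → Lat) : Prop where
  map_add : ∀ c ∈ P, ∀ d ∈ P, T (c + d) = T c + T d
  map_smul : ∀ (r : ℝ), ∀ c ∈ P, T (r • c) = r • T c
  mem : ∀ c ∈ P, T c ∈ Q

theorem LinearOn.map_zero {T : Lat → Lat} (hT : LinearOn P Q T) : T 0 = 0 := by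
  simpa using hT.map_smul 0 0 P.zero_mem

/-- A polynomial curve is a finite sum of `ε ^ i • c`, so linearity of `T` on `P` alone lets it pass
through `d/dε`. No continuity of `T` is required, and therefore the infinite sum `Δ⁻¹` and `∂ₓ` need
no limit interchange. -/
theorem LinearOn.map_curves {T : Lat → Lat} (hT : LinearOn P Q T) (hφ : φ ∈ curves P) :
    (fun ε => T (φ ε)) ∈ curves Q ∧ velocity (fun ε => T (φ ε)) = T (velocity φ) := by
  induction hφ using Submodule.span_induction with
  | mem φ h =>
    obtain ⟨i, c, hc, rfl⟩ := h
    simp only [hT.map_smul _ c hc]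
    refine ⟨mem_curves_monomial i (hT.mem c hc), ?_⟩
    rw [velocity_monomial, velocity_monomial]
    split_ifs
    exacts [rfl, hT.map_zero.symm]
  | zero =>
    have : (fun ε : ℝ => T ((0 : ℝ → Lat) ε)) = fun _ => 0 := by
      funext ε
      exact hT.map_zero
    rw [this, velocity_const]
    refine ⟨mem_curves_const Q.zero_mem, ?_⟩
    exact (congrArg T (velocity_const 0)).trans hT.map_zero |>.symm
  | add φ ψ h₁ h₂ e₁ e₂ =>
    have : (fun ε : ℝ => T ((φ + ψ) ε)) = (fun ε => T (φ ε)) + fun ε => T (ψ ε) := by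
      funext ε
      exact hT.map_add _ (apply_mem_of_mem_curves h₁ ε) _ (apply_mem_of_mem_curves h₂ ε)
    rw [this, velocity_add e₁.1 e₂.1, velocity_add h₁ h₂,
      hT.map_add _ (velocity_mem h₁) _ (velocity_mem h₂), e₁.2, e₂.2]
    exact ⟨Submodule.add_mem _ e₁.1 e₂.1, rfl⟩
  | smul r φ h e =>
    have : (fun ε : ℝ => T ((r • φ) ε)) = r • fun ε => T (φ ε) := by
      funext ε
      exact hT.map_smul r _ (apply_mem_of_mem_curves h ε)
    rw [this, velocity_smul r e.1, velocity_smul r h, hT.map_smul r _ (velocity_mem h), e.2]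
    exact ⟨Submodule.smul_mem _ r e.1, rfl⟩

theorem linearOn_shift (m : ℤ) : LinearOn smoothLat smoothLat (shift m) :=
  ⟨fun _ _ _ _ => rfl, fun _ _ _ => rfl, fun _ h n => h (n + m)⟩

theorem linearOn_phase_shift (m : ℤ) : LinearOn phase phase (shift m) :=
  ⟨fun _ _ _ _ => rfl, fun _ _ _ => rfl, fun _ h => IsRapid.shift m h⟩

theorem linearOn_dx : LinearOn smoothLat smoothLat dx where
  map_add c hc d hd := by
    funext n x
    exact deriv_add ((hc n).differentiable (by simp) x) ((hd n).differentiable (by simp) x)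
  map_smul r c hc := by
    funext n x
    exact deriv_const_smul r ((hc n).differentiable (by simp) x)
  mem _ h n := (h n).deriv'

theorem linearOn_phase_dx : LinearOn phase phase dx :=
  ⟨fun c hc d hd => linearOn_dx.map_add c hc.1 d hd.1, fun r c hc => linearOn_dx.map_smul r c hc.1,
    fun _ h => IsRapid.dx h⟩

theorem linearOn_deltaInv : LinearOn phase phase deltaInv where
  map_add c hc d hd := by
    funext n x
    exact (IsRapid.summable hc n x).tsum_add (IsRapid.summable hd n x)
  map_smul r c hc := by
    funext n x
    exact tsum_mul_left
  mem _ h := IsRapid.deltaInv h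

theorem linearOn_mul {a : Lat} (ha : IsModerate a) : LinearOn phase phase (a * ·) :=
  ⟨fun _ _ _ _ => mul_add _ _ _, fun _ _ _ => mul_smul_comm _ _ _, fun _ h => ha.mul h⟩

/-! ### Directional derivatives on `𝓕`. -/

/-- The curve `ε ↦ f(u + ε v)`. -/
def along (f : Fn) (u v : phase) : ℝ → Lat := fun ε => f (u + ε • v)

theorem along_zero (f : Fn) (u v : phase) : along f u v 0 = f u := by
  simp [along]

/-- Maps that are polynomial along lines, with coefficients in `P`. -/
def IsPoly (P : Submodule ℝ Lat) (f : Fn) : Prop := ∀ u v, along f u v ∈ curves P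

theorem IsPoly.mono {f : Fn} (h : P ≤ Q) (hf : IsPoly P f) : IsPoly Q f :=
  fun u v => curves_mono h (hf u v)

theorem IsPoly.lift {T : Lat → Lat} {f : Fn} (hf : IsPoly P f) (hT : LinearOn P Q T) :
    IsPoly Q (lift T f) :=
  fun u v => (hT.map_curves (hf u v)).1

theorem IsPoly.apply_mem {f : Fn} (hf : IsPoly P f) (u : phase) : f u ∈ P := by
  have := apply_mem_of_mem_curves (hf u 0) 0
  rwa [along_zero] at this

theorem gateaux_lift {T : Lat → Lat} {f : Fn} (hf : IsPoly P f) (hT : LinearOn P Q T)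
    (g : flowFn) : gateaux (lift T f) g = lift T (gateaux f g) := by
  funext u
  exact (hT.map_curves (hf u (value g u))).2

theorem gateaux_add {f₁ f₂ : Fn} (h₁ : IsPoly P f₁) (h₂ : IsPoly P f₂) (g : flowFn) :
    gateaux (f₁ + f₂) g = gateaux f₁ g + gateaux f₂ g := by
  funext u
  exact velocity_add (h₁ u _) (h₂ u _)

theorem gateaux_smul (c : ℝ) {f : Fn} (hf : IsPoly P f) (g : flowFn) :
    gateaux (c • f) g = c • gateaux f g := by
  funext u
  exact velocity_smul c (hf u _)

theorem gateaux_mul {f₁ f₂ : Fn} (h₁ : IsPoly P f₁) (h₂ : IsPoly Q f₂) (g : flowFn) :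
    gateaux (f₁ * f₂) g = gateaux f₁ g * f₂ + f₁ * gateaux f₂ g := by
  funext u
  have := velocity_mul (h₁ u (value g u)) (h₂ u (value g u))
  rw [along_zero, along_zero] at this
  exact this

theorem gateaux_const (c : Lat) (g : flowFn) : gateaux (fun _ => c) g = 0 := by
  funext u
  exact velocity_const c

theorem gateaux_field (g : flowFn) : gateaux field g = g := by
  funext u n x
  change deriv (fun ε : ℝ => u.1 n x + ε * g.1 u n x) 0 = g.1 u n x
  simp

theorem isPoly_const {c : Lat} (hc : c ∈ P) : IsPoly P (fun _ => c) :=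
  fun _ _ => mem_curves_const hc

theorem isPoly_field : IsPoly phase field := by
  intro u v
  have : along field u v = (fun _ => u.1) + fun ε => ε ^ 1 • v.1 := by
    funext ε
    simp [along, field]
  rw [this]
  exact Submodule.add_mem _ (mem_curves_const u.2) (mem_curves_monomial 1 v.2)

/-- All generating operations of `𝓕` are linear or bilinear on rapidly decreasing functions, so they
preserve polynomial dependence on `ε`. This supplies the differentiability behind every rule for the
Gateaux derivative. -/
theorem IsFlowFn.isPoly {f : Fn} (hf : IsFlowFn f) : IsPoly phase f := by
  induction hf with
  | field => exact isPoly_field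
  | add _ _ h₁ h₂ => exact fun u v => Submodule.add_mem _ (h₁ u v) (h₂ u v)
  | smul c _ h => exact fun u v => Submodule.smul_mem _ c (h u v)
  | mul _ _ h₁ h₂ =>
    exact fun u v => mul_mem_curves (fun c hc d hd => (IsRapid.moderate hc).mul hd) (h₁ u v) (h₂ u v)
  | mul_n _ h => exact h.lift (linearOn_mul isModerate_coord_n)
  | mul_x _ h => exact h.lift (linearOn_mul isModerate_coord_x)
  | shift m _ h => exact h.lift (linearOn_phase_shift m)
  | dx _ h => exact h.lift linearOn_phase_dx
  | deltaInv _ h => exact h.lift linearOn_deltaInv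

theorem isFlowFn_zero : IsFlowFn 0 := flowFn.zero_mem

theorem IsFlowFn.gateaux {f : Fn} (hf : IsFlowFn f) (g : flowFn) : IsFlowFn (gateaux f g) := by
  induction hf with
  | field => rw [gateaux_field]; exact g.2
  | add h₁ h₂ e₁ e₂ => rw [gateaux_add h₁.isPoly h₂.isPoly]; exact e₁.add e₂
  | smul c h e => rw [gateaux_smul c h.isPoly]; exact e.smul c
  | mul h₁ h₂ e₁ e₂ =>
    rw [gateaux_mul h₁.isPoly h₂.isPoly]; exact (e₁.mul h₂).add (h₁.mul e₂)
  | mul_n h e =>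
    exact (gateaux_lift h.isPoly (linearOn_mul isModerate_coord_n) g) ▸ e.mul_n
  | mul_x h e =>
    exact (gateaux_lift h.isPoly (linearOn_mul isModerate_coord_x) g) ▸ e.mul_x
  | shift m h e => rw [gateaux_lift h.isPoly (linearOn_phase_shift m)]; exact e.shift m
  | dx h e => rw [gateaux_lift h.isPoly linearOn_phase_dx]; exact e.dx
  | deltaInv h e => rw [gateaux_lift h.isPoly linearOn_deltaInv]; exact e.deltaInv

theorem lift_add {T : Lat → Lat} (hT : LinearOn P Q T) {f₁ f₂ : Fn} (h₁ : IsPoly P f₁)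
    (h₂ : IsPoly P f₂) : lift T (f₁ + f₂) = lift T f₁ + lift T f₂ := by
  funext u
  exact hT.map_add _ (h₁.apply_mem u) _ (h₂.apply_mem u)

theorem lift_smul {T : Lat → Lat} (hT : LinearOn P Q T) (c : ℝ) {f : Fn} (hf : IsPoly P f) :
    lift T (c • f) = c • lift T f := by
  funext u
  exact hT.map_smul c _ (hf.apply_mem u)

/-- The directional derivative on `𝓕`. -/
noncomputable def flowGateaux (f g : flowFn) : flowFn := ⟨gateaux f g, f.2.gateaux g⟩

/-- The Gateaux derivative is linear in the direction. -/
theorem IsFlowFn.gateaux_linear {f : Fn} (hf : IsFlowFn f) (c : ℝ) (g₁ g₂ : flowFn) :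
    DKP.gateaux f (c • g₁ + g₂) = c • DKP.gateaux f g₁ + DKP.gateaux f g₂ := by
  -- One argument serves the five linear generators: multiplication by `n` and `x`, shifts, `∂ₓ` and
  -- `Δ⁻¹`.
  have key : ∀ {T : Lat → Lat} {f : Fn}, IsFlowFn f → LinearOn phase phase T →
      DKP.gateaux f (c • g₁ + g₂) = c • DKP.gateaux f g₁ + DKP.gateaux f g₂ →
      DKP.gateaux (DKP.lift T f) (c • g₁ + g₂) =
        c • DKP.gateaux (DKP.lift T f) g₁ + DKP.gateaux (DKP.lift T f) g₂ := by
    intro T f h hT e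
    rw [gateaux_lift h.isPoly hT, gateaux_lift h.isPoly hT, gateaux_lift h.isPoly hT, e,
      lift_add hT ((h.gateaux g₁).smul c).isPoly (h.gateaux g₂).isPoly,
      lift_smul hT c (h.gateaux g₁).isPoly]
  induction hf with
  | field => simp only [gateaux_field]; rfl
  | add h₁ h₂ e₁ e₂ =>
    simp only [gateaux_add h₁.isPoly h₂.isPoly, e₁, e₂, smul_add]; abel
  | smul r h e =>
    simp only [gateaux_smul r h.isPoly, e, smul_add, smul_comm c r]
  | mul h₁ h₂ e₁ e₂ =>
    simp only [gateaux_mul h₁.isPoly h₂.isPoly, e₁, e₂, smul_add, add_mul, mul_add, smul_mul_assoc,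
      mul_smul_comm]
    abel
  | mul_n h e => exact key h (linearOn_mul isModerate_coord_n) e
  | mul_x h e => exact key h (linearOn_mul isModerate_coord_x) e
  | shift m h e => exact key h (linearOn_phase_shift m) e
  | dx h e => exact key h linearOn_phase_dx e
  | deltaInv h e => exact key h linearOn_deltaInv e

/-- The directional derivative of `f`, as an operator on `𝓕`. -/
noncomputable def linearization (f : flowFn) : flowFn →ₗ[ℝ] flowFn where
  toFun g := flowGateaux f g
  map_add' g₁ g₂ := by
    have := f.2.gateaux_linear 1 g₁ g₂
    rw [one_smul, one_smul] at this
    exact Subtype.ext this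
  map_smul' c g := by
    have h0 : gateaux f.1 (0 : flowFn) = 0 := by
      have := f.2.gateaux_linear 1 0 0
      simpa using this
    have := f.2.gateaux_linear c g 0
    rw [add_zero, h0, add_zero] at this
    exact Subtype.ext this

/-- Symmetry of the second derivative. -/
theorem IsFlowFn.gateaux_symm {f : Fn} (hf : IsFlowFn f) (g₁ g₂ : flowFn) :
    DKP.gateaux (DKP.gateaux f g₁) g₂ + DKP.gateaux f (flowGateaux g₂ g₁) =
      DKP.gateaux (DKP.gateaux f g₂) g₁ + DKP.gateaux f (flowGateaux g₁ g₂) := by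
  have key : ∀ {T : Lat → Lat} {f : Fn}, IsFlowFn f → LinearOn phase phase T →
      DKP.gateaux (DKP.gateaux f g₁) g₂ + DKP.gateaux f (flowGateaux g₂ g₁) =
        DKP.gateaux (DKP.gateaux f g₂) g₁ + DKP.gateaux f (flowGateaux g₁ g₂) →
      DKP.gateaux (DKP.gateaux (DKP.lift T f) g₁) g₂ +
          DKP.gateaux (DKP.lift T f) (flowGateaux g₂ g₁) =
        DKP.gateaux (DKP.gateaux (DKP.lift T f) g₂) g₁ +
          DKP.gateaux (DKP.lift T f) (flowGateaux g₁ g₂) := by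
    intro T f h hT e
    simp only [gateaux_lift h.isPoly hT]
    rw [gateaux_lift (h.gateaux g₁).isPoly hT, gateaux_lift (h.gateaux g₂).isPoly hT,
      ← lift_add hT ((h.gateaux g₁).gateaux g₂).isPoly (h.gateaux _).isPoly, e,
      lift_add hT ((h.gateaux g₂).gateaux g₁).isPoly (h.gateaux _).isPoly]
  induction hf with
  -- The directions depend on `u`, hence the correction terms: here both sides are `g₁'[g₂] +
  -- g₂'[g₁]`.
  | field =>
    simp only [gateaux_field]
    exact add_comm _ _
  | add h₁ h₂ e₁ e₂ =>
    simp only [gateaux_add h₁.isPoly h₂.isPoly,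
      gateaux_add (h₁.gateaux _).isPoly (h₂.gateaux _).isPoly]
    linear_combination e₁ + e₂
  | smul r h e =>
    simp only [gateaux_smul r h.isPoly, gateaux_smul r (h.gateaux _).isPoly, ← smul_add, e]
  | mul h₁ h₂ e₁ e₂ =>
    simp only [gateaux_mul h₁.isPoly h₂.isPoly,
      gateaux_add ((h₁.gateaux _).mul h₂).isPoly (h₁.mul (h₂.gateaux _)).isPoly,
      gateaux_mul (h₁.gateaux _).isPoly h₂.isPoly, gateaux_mul h₁.isPoly (h₂.gateaux _).isPoly]
    rename_i f₁ f₂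
    linear_combination f₂ * e₁ + f₁ * e₂
  | mul_n h e => exact key h (linearOn_mul isModerate_coord_n) e
  | mul_x h e => exact key h (linearOn_mul isModerate_coord_x) e
  | shift m h e => exact key h (linearOn_phase_shift m) e
  | dx h e => exact key h linearOn_phase_dx e
  | deltaInv h e => exact key h linearOn_deltaInv e


/-! ### The algebra of coefficients and its ideal `𝓕`. -/

/-- The coordinate `n`. -/
def coordN : Fn := fun _ n _ => (n : ℝ)

/-- The coordinate `x`. -/
def coordX : Fn := fun _ _ x => x

/-- The algebra of coefficients: it is generated by `n`, `x` and `𝓕`. -/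
def coefAlg : Subalgebra ℝ Fn := Algebra.adjoin ℝ ({coordN, coordX} ∪ {f | IsFlowFn f})

theorem coordN_mem : coordN ∈ coefAlg := Algebra.subset_adjoin (by simp)

theorem coordX_mem : coordX ∈ coefAlg := Algebra.subset_adjoin (by simp)

theorem IsFlowFn.mem_coefAlg {f : Fn} (hf : IsFlowFn f) : f ∈ coefAlg :=
  Algebra.subset_adjoin (Or.inr hf)

theorem const_mem_coefAlg (c : ℝ) : (fun _ _ _ => c : Fn) ∈ coefAlg := coefAlg.algebraMap_mem c

theorem coefAlg_induction {p : ∀ a : Fn, a ∈ coefAlg → Prop} (hn : p coordN coordN_mem)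
    (hx : p coordX coordX_mem) (hF : ∀ f (hf : IsFlowFn f), p f hf.mem_coefAlg)
    (hc : ∀ c : ℝ, p (fun _ _ _ => c) (const_mem_coefAlg c))
    (hadd : ∀ a ha b hb, p a ha → p b hb → p (a + b) (add_mem ha hb))
    (hmul : ∀ a ha b hb, p a ha → p b hb → p (a * b) (mul_mem ha hb)) {a : Fn}
    (ha : a ∈ coefAlg) : p a ha := by
  induction ha using Algebra.adjoin_induction with
  | mem f hf =>
    rcases hf with (rfl | rfl) | hf
    exacts [hn, hx, hF f hf]
  | algebraMap r => exact hc r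
  | add a b ha hb h₁ h₂ => exact hadd a ha b hb h₁ h₂
  | mul a b ha hb h₁ h₂ => exact hmul a ha b hb h₁ h₂

/-- Constants, `n` and `x` do not decay, so only smoothness survives. That is enough for shifts and
`∂ₓ`, while `Δ⁻¹` is applied to elements of `𝓕` only. -/
theorem isPoly_of_mem_coefAlg {a : Fn} (ha : a ∈ coefAlg) : IsPoly smoothLat a := by
  induction ha using coefAlg_induction with
  | hn => exact isPoly_const fun n => contDiff_const
  | hx => exact isPoly_const fun n => contDiff_id
  | hF f hf => exact hf.isPoly.mono phase_le_smoothLat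
  | hc c => exact isPoly_const fun n => contDiff_const
  | hadd a _ b _ h₁ h₂ => exact fun u v => Submodule.add_mem _ (h₁ u v) (h₂ u v)
  | hmul a _ b _ h₁ h₂ =>
    exact fun u v => mul_mem_curves (fun c hc d hd n => (hc n).mul (hd n)) (h₁ u v) (h₂ u v)

theorem IsFlowFn.coefAlg_mul {a : Fn} (ha : a ∈ coefAlg) : ∀ {f : Fn}, IsFlowFn f →
    IsFlowFn (a * f) := by
  induction ha using coefAlg_induction with
  | hn => exact fun hf => hf.mul_n
  | hx => exact fun hf => hf.mul_x
  | hF g hg => exact fun hf => hg.mul hf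
  | hc c => exact fun hf => hf.smul c
  | hadd a _ b _ h₁ h₂ => intro f hf; rw [add_mul]; exact (h₁ hf).add (h₂ hf)
  | hmul a _ b _ h₁ h₂ => intro f hf; rw [mul_assoc]; exact h₁ (h₂ hf)

theorem shift_mem_coefAlg (m : ℤ) {a : Fn} (ha : a ∈ coefAlg) : lift (shift m) a ∈ coefAlg := by
  induction ha using coefAlg_induction with
  | hn =>
    have : lift (shift m) coordN = coordN + fun _ _ _ => (m : ℝ) := by
      funext u n x
      simp [lift, shift, coordN]
    rw [this]
    exact add_mem coordN_mem (const_mem_coefAlg m)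
  | hx => exact coordX_mem
  | hF f hf => exact (hf.shift m).mem_coefAlg
  | hc c => exact const_mem_coefAlg c
  | hadd a _ b _ h₁ h₂ => exact add_mem h₁ h₂
  | hmul a _ b _ h₁ h₂ => exact mul_mem h₁ h₂

theorem lift_dx_mul {a b : Fn} (ha : IsPoly smoothLat a) (hb : IsPoly smoothLat b) :
    lift dx (a * b) = lift dx a * b + a * lift dx b := by
  funext u n x
  exact deriv_mul ((ha.apply_mem u n).differentiable (by simp) x)
    ((hb.apply_mem u n).differentiable (by simp) x)

theorem lift_dx_const (c : ℤ → ℝ) : lift dx (fun _ n _ => c n) = 0 := by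
  funext u n x
  exact deriv_const x (c n)

theorem lift_dx_coordX : lift dx coordX = 1 := by
  funext u n x
  exact deriv_id x

theorem dx_mem_coefAlg {a : Fn} (ha : a ∈ coefAlg) : lift dx a ∈ coefAlg := by
  induction ha using coefAlg_induction with
  | hn => exact (lift_dx_const fun n => (n : ℝ)) ▸ zero_mem _
  | hx => exact lift_dx_coordX ▸ one_mem _
  | hF f hf => exact hf.dx.mem_coefAlg
  | hc c => exact (lift_dx_const fun _ => c) ▸ zero_mem _
  | hadd a ha b hb h₁ h₂ =>
    rw [lift_add linearOn_dx (isPoly_of_mem_coefAlg ha) (isPoly_of_mem_coefAlg hb)]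
    exact add_mem h₁ h₂
  | hmul a ha b hb h₁ h₂ =>
    rw [lift_dx_mul (isPoly_of_mem_coefAlg ha) (isPoly_of_mem_coefAlg hb)]
    exact add_mem (mul_mem h₁ hb) (mul_mem ha h₂)

/-- The generators outside `𝓕` do not depend on `u` and are killed; the product rule then stays in
`𝓕` because `𝓕` is an ideal. -/
theorem isFlowFn_gateaux {a : Fn} (ha : a ∈ coefAlg) (g : flowFn) : IsFlowFn (gateaux a g) := by
  induction ha using coefAlg_induction with
  | hn => exact (gateaux_const (fun n _ => (n : ℝ)) g) ▸ isFlowFn_zero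
  | hx => exact (gateaux_const (fun _ x => x) g) ▸ isFlowFn_zero
  | hF f hf => exact hf.gateaux g
  | hc c => exact (gateaux_const (fun _ _ => c) g) ▸ isFlowFn_zero
  | hadd a ha b hb h₁ h₂ =>
    rw [gateaux_add (isPoly_of_mem_coefAlg ha) (isPoly_of_mem_coefAlg hb)]
    exact h₁.add h₂
  | hmul a ha b hb h₁ h₂ =>
    rw [gateaux_mul (isPoly_of_mem_coefAlg ha) (isPoly_of_mem_coefAlg hb), mul_comm _ b]
    exact (IsFlowFn.coefAlg_mul hb h₁).add (IsFlowFn.coefAlg_mul ha h₂)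

/-- The shift `E` on coefficients. -/
def shiftEquiv : coefAlg ≃ₐ[ℝ] coefAlg where
  toFun a := ⟨lift (shift 1) a, shift_mem_coefAlg 1 a.2⟩
  invFun a := ⟨lift (shift (-1)) a, shift_mem_coefAlg (-1) a.2⟩
  left_inv a := by
    ext u n x
    simp [lift, shift]
  right_inv a := by
    ext u n x
    simp [lift, shift]
  map_mul' _ _ := rfl
  map_add' _ _ := rfl
  commutes' _ := rfl

theorem coe_shiftEquiv (a : coefAlg) : (shiftEquiv a : Fn) = lift (shift 1) a := rfl

theorem lift_shift_shift (m k : ℤ) (f : Fn) :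
    lift (shift m) (lift (shift k) f) = lift (shift (k + m)) f := by
  funext u n x
  simp only [lift, shift]
  congr 1
  ring

theorem lift_shift_zero (f : Fn) : lift (shift 0) f = f := by
  funext u n x
  simp [lift, shift]

theorem coe_shiftEquiv_zpow (m : ℤ) (a : coefAlg) :
    ((shiftEquiv ^ m) a : Fn) = lift (shift m) a := by
  induction m using Int.induction_on generalizing a with
  | zero => simp [lift_shift_zero]
  | succ i ih =>
    rw [zpow_add_one, AlgEquiv.mul_apply, ih, coe_shiftEquiv, lift_shift_shift, add_comm]
  | pred i ih =>
    have h : ((shiftEquiv⁻¹ a : coefAlg) : Fn) = lift (shift (-1)) a := rfl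
    rw [zpow_sub_one, AlgEquiv.mul_apply, ih, h, lift_shift_shift]
    congr 2
    ring

/-- `∂ₓ` on coefficients. -/
noncomputable def dxDer : Derivation ℝ coefAlg coefAlg := Derivation.mk'
  { toFun := fun a => ⟨lift dx a, dx_mem_coefAlg a.2⟩
    map_add' := fun a b => Subtype.ext (lift_add linearOn_dx (isPoly_of_mem_coefAlg a.2)
      (isPoly_of_mem_coefAlg b.2))
    map_smul' := fun c a => Subtype.ext (lift_smul linearOn_dx c (isPoly_of_mem_coefAlg a.2)) }
  fun a b => Subtype.ext (by
    have := lift_dx_mul (isPoly_of_mem_coefAlg a.2) (isPoly_of_mem_coefAlg b.2)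
    change lift dx (a.1 * b.1) = a.1 * lift dx b.1 + b.1 * lift dx a.1
    rw [this]
    ring)

/-- The derivative in the direction `g` on coefficients. -/
noncomputable def gateauxDer (g : flowFn) : Derivation ℝ coefAlg coefAlg := Derivation.mk'
  { toFun := fun a => ⟨gateaux a g, (isFlowFn_gateaux a.2 g).mem_coefAlg⟩
    map_add' := fun a b => Subtype.ext (gateaux_add (isPoly_of_mem_coefAlg a.2)
      (isPoly_of_mem_coefAlg b.2) g)
    map_smul' := fun c a => Subtype.ext (gateaux_smul c (isPoly_of_mem_coefAlg a.2) g) }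
  fun a b => Subtype.ext (by
    have := gateaux_mul (isPoly_of_mem_coefAlg a.2) (isPoly_of_mem_coefAlg b.2) g
    change gateaux (a.1 * b.1) g = a.1 * gateaux b.1 g + b.1 * gateaux a.1 g
    rw [this]
    ring)

theorem gateauxDer_shiftEquiv (g : flowFn) (a : coefAlg) :
    gateauxDer g (shiftEquiv a) = shiftEquiv (gateauxDer g a) :=
  Subtype.ext (gateaux_lift (isPoly_of_mem_coefAlg a.2) (linearOn_shift 1) g)

theorem gateauxDer_dxDer (g : flowFn) (a : coefAlg) :
    gateauxDer g (dxDer a) = dxDer (gateauxDer g a) :=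
  Subtype.ext (gateaux_lift (isPoly_of_mem_coefAlg a.2) linearOn_dx g)

theorem dxDer_shiftEquiv (a : coefAlg) : dxDer (shiftEquiv a) = shiftEquiv (dxDer a) := rfl

/-- `𝓕` as an ideal of the algebra of coefficients. -/
def flowIdeal : Ideal coefAlg where
  carrier := {a | IsFlowFn a}
  add_mem' h₁ h₂ := h₁.add h₂
  zero_mem' := isFlowFn_zero
  smul_mem' a _ h := IsFlowFn.coefAlg_mul a.2 h

theorem mem_flowIdeal {a : coefAlg} : a ∈ flowIdeal ↔ IsFlowFn a := Iff.rfl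

theorem shiftEquiv_zpow_mem_flowIdeal (m : ℤ) {a : coefAlg} (ha : a ∈ flowIdeal) :
    (shiftEquiv ^ m) a ∈ flowIdeal := by
  rw [mem_flowIdeal, coe_shiftEquiv_zpow]
  exact IsFlowFn.shift m ha

theorem dxDer_mem_flowIdeal {a : coefAlg} (ha : a ∈ flowIdeal) : dxDer a ∈ flowIdeal :=
  IsFlowFn.dx ha

theorem gateauxDer_mem_flowIdeal (g : flowFn) (a : coefAlg) : gateauxDer g a ∈ flowIdeal :=
  isFlowFn_gateaux a.2 g

/-- The inverse difference on `𝓕`. -/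
noncomputable def flowDeltaInv : flowFn →ₗ[ℝ] flowFn where
  toFun f := ⟨lift deltaInv f, f.2.deltaInv⟩
  map_add' f g := Subtype.ext (lift_add linearOn_deltaInv f.2.isPoly g.2.isPoly)
  map_smul' c f := Subtype.ext (lift_smul linearOn_deltaInv c f.2.isPoly)

/-- The elements of `𝓕`, as coefficients. -/
def toCoef (f : flowFn) : coefAlg := ⟨f, f.2.mem_coefAlg⟩

theorem toCoef_mem (f : flowFn) : toCoef f ∈ flowIdeal := f.2

theorem shiftEquiv_sub_flowDeltaInv (f : flowFn) :
    shiftEquiv (toCoef (flowDeltaInv f)) - toCoef (flowDeltaInv f) = toCoef f := by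
  apply Subtype.ext
  funext u
  exact delta_deltaInv (f.2.isRapid u)

/-- By `Δ⁻¹ Δ = 1`, an antidifference that lies in `𝓕` is the antidifference. Identities containing
`Δ⁻¹` are checked by applying `Δ`. -/
theorem flowDeltaInv_eq {f g : flowFn} (h : shiftEquiv (toCoef f) - toCoef f = toCoef g) :
    flowDeltaInv g = f := by
  apply Subtype.ext
  have h' : lift delta f.1 = g.1 := congrArg Subtype.val h
  change lift deltaInv g.1 = f.1
  rw [← h']
  funext u
  exact deltaInv_delta (f.2.isRapid u)

/-- Decay as `n → -∞` excludes nonzero invariants of the shift. This is the only property of `𝓕` on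
which the rigidity argument for Lax operators depends. -/
theorem eq_zero_of_shiftEquiv_eq {a : coefAlg} (ha : a ∈ flowIdeal) (h : shiftEquiv a = a) :
    a = 0 := by
  have h' : flowDeltaInv 0 = (⟨a.1, ha⟩ : flowFn) := by
    apply flowDeltaInv_eq
    change shiftEquiv a - a = 0
    rw [h, sub_self]
  rw [map_zero] at h'
  exact Subtype.ext (congrArg Subtype.val h').symm


/-! ### Commutator identities in an associative ring. -/

section Commutators

variable {R : Type*} [Ring R]

theorem ring_sub_lie (a b c : R) : ⁅a - b, c⁆ = ⁅a, c⁆ - ⁅b, c⁆ := by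
  simp only [Ring.lie_def]; noncomm_ring

theorem ring_add_lie (a b c : R) : ⁅a + b, c⁆ = ⁅a, c⁆ + ⁅b, c⁆ := by
  simp only [Ring.lie_def]; noncomm_ring

theorem ring_lie_add (a b c : R) : ⁅a, b + c⁆ = ⁅a, b⁆ + ⁅a, c⁆ := by
  simp only [Ring.lie_def]; noncomm_ring

theorem ring_lie_sub (a b c : R) : ⁅a, b - c⁆ = ⁅a, b⁆ - ⁅a, c⁆ := by
  simp only [Ring.lie_def]; noncomm_ring

theorem ring_lie_mul (a b c : R) : ⁅a, b * c⁆ = ⁅a, b⁆ * c + b * ⁅a, c⁆ := by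
  simp only [Ring.lie_def]; noncomm_ring

theorem ring_mul_lie (a b c : R) : ⁅a * b, c⁆ = a * ⁅b, c⁆ + ⁅a, c⁆ * b := by
  simp only [Ring.lie_def]; noncomm_ring

theorem ring_lie_skew (a b : R) : ⁅a, b⁆ = -⁅b, a⁆ := by
  simp only [Ring.lie_def]; noncomm_ring

theorem ring_lie_lie (a b c : R) : ⁅a, ⁅b, c⁆⁆ = ⁅⁅a, b⁆, c⁆ + ⁅b, ⁅a, c⁆⁆ := by
  simp only [Ring.lie_def]; noncomm_ring

end Commutators

/-! ### Series in `E⁻¹` and difference operators. -/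

section DifferenceOperators

variable {A : Type*} [CommRing A] [Algebra ℝ A]

/-- Laurent series in `E⁻¹` whose coefficients are linear operators on `A`: the series with
coefficient `T` in degree `-m` stands for an operator whose part of order `m` in `E` is `T`. -/
def Op (A : Type*) [CommRing A] [Algebra ℝ A] : Type _ := HahnSeries ℤ (Module.End ℝ A)

noncomputable instance : Ring (Op A) := inferInstanceAs (Ring (HahnSeries ℤ (Module.End ℝ A)))

noncomputable instance : Algebra ℝ (Op A) :=
  inferInstanceAs (Algebra ℝ (HahnSeries ℤ (Module.End ℝ A)))

/-- The coefficients of a series. -/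
def Op.coeff (Y : Op A) (i : ℤ) : Module.End ℝ A := HahnSeries.coeff Y i

theorem Op.ext {Y Z : Op A} (h : ∀ i, Y.coeff i = Z.coeff i) : Y = Z :=
  HahnSeries.ext (funext h)

theorem Op.coeff_zero (i : ℤ) : (0 : Op A).coeff i = 0 := rfl

theorem Op.coeff_add (Y Z : Op A) (i : ℤ) : (Y + Z).coeff i = Y.coeff i + Z.coeff i := rfl

theorem Op.coeff_sub (Y Z : Op A) (i : ℤ) : (Y - Z).coeff i = Y.coeff i - Z.coeff i := rfl

theorem Op.coeff_smul (c : ℝ) (Y : Op A) (i : ℤ) : (c • Y).coeff i = c • Y.coeff i := rfl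

/-- A linear operator on `A`, as a series of degree `0`. -/
noncomputable def endOp (T : Module.End ℝ A) : Op A :=
  (HahnSeries.C T : HahnSeries ℤ (Module.End ℝ A))

/-- Multiplication by an element of `A`. -/
noncomputable def mulBy (a : A) : Op A := endOp (LinearMap.mulLeft ℝ a)

/-- The shift `E`. -/
noncomputable def shiftOp (τ : A ≃ₐ[ℝ] A) : Op A :=
  (HahnSeries.single (-1) τ.toLinearMap : HahnSeries ℤ (Module.End ℝ A))

/-- The series has order at most `N` in `E`. -/
def OrdLE (N : ℤ) (Y : Op A) : Prop := ∀ m, N < m → Y.coeff (-m) = 0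

/-- The series has no negative powers of `E`. -/
def NonNeg (Y : Op A) : Prop := ∀ m < 0, Y.coeff (-m) = 0

/-- The coefficient of `E ^ m`. -/
def sym (Y : Op A) (m : ℤ) : A := Y.coeff (-m) 1

/-- The series is a difference operator `∑ₘ pₘ E ^ m`. -/
def IsDiff (τ : A ≃ₐ[ℝ] A) (Y : Op A) : Prop :=
  ∀ m a, Y.coeff (-m) a = sym Y m * (τ ^ m) a

/-- The part without negative powers of `E`. -/
noncomputable def pos (Y : Op A) : Op A :=
  -- Order `m` sits in degree `-m`, and `-m < 1` means `m ≥ 0`.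
  HahnSeries.truncLT 1 (show HahnSeries ℤ (Module.End ℝ A) from Y)

variable {τ : A ≃ₐ[ℝ] A} {Y Z : Op A} {M N m : ℤ} {a b : A}

theorem coeff_endOp_mul (T : Module.End ℝ A) (Y : Op A) (i : ℤ) :
    (endOp T * Y).coeff i = T * Y.coeff i := HahnSeries.coeff_single_zero_mul

theorem coeff_mul_endOp (T : Module.End ℝ A) (Y : Op A) (i : ℤ) :
    (Y * endOp T).coeff i = Y.coeff i * T := HahnSeries.coeff_mul_single_zero

theorem coeff_endOp (T : Module.End ℝ A) (i : ℤ) : (endOp T).coeff i = if i = 0 then T else 0 :=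
  HahnSeries.coeff_single.trans (by congr)

theorem coeff_shiftOp (i : ℤ) : (shiftOp τ).coeff i = if i = -1 then τ.toLinearMap else 0 :=
  HahnSeries.coeff_single.trans (by congr)

theorem coeff_pos (Y : Op A) (i : ℤ) : (pos Y).coeff i = if i < 1 then Y.coeff i else 0 := rfl

theorem coeff_shiftOp_mul (Y : Op A) (m : ℤ) :
    (shiftOp τ * Y).coeff (-m) = τ.toLinearMap * Y.coeff (-(m - 1)) := by
  have := HahnSeries.coeff_single_mul (r := (τ.toLinearMap : Module.End ℝ A)) (x := Y) (a := -m)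
    (b := -1)
  rwa [show -m - -1 = -(m - 1) by ring] at this

theorem coeff_mul_shiftOp (Y : Op A) (m : ℤ) :
    (Y * shiftOp τ).coeff (-m) = Y.coeff (-(m - 1)) * τ.toLinearMap := by
  have := HahnSeries.coeff_mul_single (r := (τ.toLinearMap : Module.End ℝ A)) (x := Y) (a := -m)
    (b := -1)
  rwa [show -m - -1 = -(m - 1) by ring] at this

theorem endOp_add (T U : Module.End ℝ A) : endOp (T + U) = endOp T + endOp U :=
  map_add HahnSeries.C T U

theorem endOp_mul (T U : Module.End ℝ A) : endOp (T * U) = endOp T * endOp U :=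
  map_mul HahnSeries.C T U

theorem endOp_sub (T U : Module.End ℝ A) : endOp (T - U) = endOp T - endOp U :=
  map_sub HahnSeries.C T U

theorem mulBy_add (a b : A) : mulBy (a + b) = mulBy a + mulBy b := by
  rw [mulBy, show LinearMap.mulLeft ℝ (a + b) = LinearMap.mulLeft ℝ a + LinearMap.mulLeft ℝ b from
    map_add (LinearMap.mul ℝ A) a b]
  exact endOp_add _ _

theorem mulBy_smul (c : ℝ) (a : A) : mulBy (c • a) = c • mulBy a := by
  refine Op.ext fun i => LinearMap.ext fun b => ?_
  rw [Op.coeff_smul, mulBy, mulBy, coeff_endOp, coeff_endOp]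
  split_ifs <;> simp

theorem mulBy_one : mulBy (1 : A) = 1 := by
  rw [mulBy, LinearMap.mulLeft_one]
  exact map_one (HahnSeries.C : Module.End ℝ A →+* HahnSeries ℤ (Module.End ℝ A))

theorem sym_mulBy (a : A) (m : ℤ) : sym (mulBy a) m = if m = 0 then a else 0 := by
  rw [sym, mulBy, coeff_endOp]
  by_cases h : m = 0 <;> simp [h]

theorem sym_shiftOp (m : ℤ) : sym (shiftOp τ) m = if m = 1 then 1 else 0 := by
  rw [sym, coeff_shiftOp]
  by_cases h : m = 1
  · simp [h]
  · rw [if_neg (by omega), if_neg h]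
    simp

theorem sym_add (Y Z : Op A) (m : ℤ) : sym (Y + Z) m = sym Y m + sym Z m := rfl

theorem sym_sub (Y Z : Op A) (m : ℤ) : sym (Y - Z) m = sym Y m - sym Z m := rfl

theorem sym_neg (Y : Op A) (m : ℤ) : sym (-Y) m = -sym Y m := rfl

theorem sym_smul (c : ℝ) (Y : Op A) (m : ℤ) : sym (c • Y) m = c • sym Y m := by
  rw [sym, Op.coeff_smul, LinearMap.smul_apply, sym]

theorem sym_mulBy_mul (a : A) (Y : Op A) (m : ℤ) : sym (mulBy a * Y) m = a * sym Y m := by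
  rw [sym, mulBy, coeff_endOp_mul]
  rfl

theorem sym_shiftOp_mul (Y : Op A) (m : ℤ) : sym (shiftOp τ * Y) m = τ (sym Y (m - 1)) := by
  rw [sym, coeff_shiftOp_mul]
  rfl

theorem sym_mul_shiftOp (Y : Op A) (m : ℤ) : sym (Y * shiftOp τ) m = sym Y (m - 1) := by
  rw [sym, coeff_mul_shiftOp, Module.End.mul_apply]
  simp [sym]

theorem IsDiff.sym_mul_mulBy (hY : IsDiff τ Y) (a : A) (m : ℤ) :
    sym (Y * mulBy a) m = sym Y m * (τ ^ m) a := by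
  rw [sym, mulBy, coeff_mul_endOp, Module.End.mul_apply, hY]
  simp

theorem IsDiff.ext (hY : IsDiff τ Y) (hZ : IsDiff τ Z) (h : ∀ m, sym Y m = sym Z m) : Y = Z := by
  refine Op.ext fun i => LinearMap.ext fun a => ?_
  have h₁ := hY (-i) a
  have h₂ := hZ (-i) a
  rw [neg_neg] at h₁ h₂
  rw [h₁, h₂, h]

theorem IsDiff.coeff_eq_zero (hY : IsDiff τ Y) (h : sym Y m = 0) : Y.coeff (-m) = 0 := by
  ext a
  rw [hY, h, zero_mul]
  rfl

theorem isDiff_mulBy (a : A) : IsDiff τ (mulBy a) := by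
  intro m b
  rw [sym_mulBy, mulBy, coeff_endOp]
  by_cases h : m = 0 <;> simp [h]

theorem isDiff_shiftOp : IsDiff τ (shiftOp τ) := by
  intro m b
  rw [sym_shiftOp, coeff_shiftOp]
  by_cases h : m = 1
  · simp [h]
  · rw [if_neg (by omega), if_neg h]
    simp

theorem isDiff_one : IsDiff τ (1 : Op A) := mulBy_one (A := A) ▸ isDiff_mulBy 1

theorem IsDiff.add (hY : IsDiff τ Y) (hZ : IsDiff τ Z) : IsDiff τ (Y + Z) := by
  intro m a
  rw [sym_add, add_mul, ← hY, ← hZ]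
  rfl

theorem IsDiff.sub (hY : IsDiff τ Y) (hZ : IsDiff τ Z) : IsDiff τ (Y - Z) := by
  intro m a
  rw [sym_sub, sub_mul, ← hY, ← hZ]
  rfl

theorem IsDiff.smul (c : ℝ) (hY : IsDiff τ Y) : IsDiff τ (c • Y) := by
  intro m a
  rw [sym_smul, smul_mul_assoc, ← hY, Op.coeff_smul]
  rfl

theorem exists_ordLE (Y : Op A) : ∃ N, OrdLE N Y :=
  ⟨-HahnSeries.order Y, fun _ hm => HahnSeries.coeff_eq_zero_of_lt_order (by omega)⟩

/-- The Hahn series product sums over pairs of degrees in the supports. With order bounds the index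
set becomes a fixed interval of orders, convenient for comparing different sums. -/
theorem coeff_mul_of_ordLE (hY : OrdLE N Y) (hZ : OrdLE M Z) (m : ℤ) :
    (Y * Z).coeff (-m) =
      ∑ i ∈ Finset.Icc (m - M) N, Y.coeff (-i) * Z.coeff (-(m - i)) := by
  refine (HahnSeries.coeff_mul (x := Y) (y := Z)).trans ?_
  refine Finset.sum_bij_ne_zero (fun p _ _ => -p.1) ?_ ?_ ?_ ?_
  · intro p hp h
    rw [Finset.mem_antidiagonal] at hp
    rw [Finset.mem_Icc]
    constructor
    · by_contra hlt
      apply h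
      have := hZ (-p.2) (by omega)
      rw [neg_neg] at this
      exact (congrArg (_ * ·) this).trans (mul_zero _)
    · by_contra hlt
      apply h
      have := hY (-p.1) (by omega)
      rw [neg_neg] at this
      exact (congrArg (· * _) this).trans (zero_mul _)
  · intro p hp _ q hq _ e
    rw [Finset.mem_antidiagonal] at hp hq
    ext <;> omega
  · intro i hi h
    have h₁ : Y.coeff (-i) ≠ 0 := left_ne_zero_of_mul h
    have h₂ : Z.coeff (-(m - i)) ≠ 0 := right_ne_zero_of_mul h
    exact ⟨(-i, -(m - i)), by
      rw [Finset.mem_antidiagonal]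
      exact ⟨h₁, h₂, by ring⟩, h, neg_neg i⟩
  · intro p hp _
    rw [Finset.mem_antidiagonal] at hp
    rw [neg_neg, show -(m - -p.1) = p.2 by linarith [hp.2.2]]
    rfl

theorem sym_mul (hY : IsDiff τ Y) (hYN : OrdLE N Y) (hZM : OrdLE M Z) (m : ℤ) :
    sym (Y * Z) m = ∑ i ∈ Finset.Icc (m - M) N, sym Y i * (τ ^ i) (sym Z (m - i)) := by
  rw [sym, coeff_mul_of_ordLE hYN hZM, LinearMap.sum_apply]
  exact Finset.sum_congr rfl fun i _ => hY i _

/-- Termwise this is `(p τ^i)(q τ^j) = p τ^i(q) τ^(i+j)`, which holds since `τ` is multiplicative.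
-/
theorem IsDiff.mul (hY : IsDiff τ Y) (hZ : IsDiff τ Z) : IsDiff τ (Y * Z) := by
  intro m a
  obtain ⟨N, hN⟩ := exists_ordLE Y
  obtain ⟨M, hM⟩ := exists_ordLE Z
  rw [sym_mul hY hN hM, coeff_mul_of_ordLE hN hM, LinearMap.sum_apply, Finset.sum_mul]
  refine Finset.sum_congr rfl fun i _ => ?_
  rw [Module.End.mul_apply, hZ, hY, map_mul, ← AlgEquiv.mul_apply, ← zpow_add,
    add_sub_cancel, mul_assoc]

theorem IsDiff.lie (hY : IsDiff τ Y) (hZ : IsDiff τ Z) : IsDiff τ ⁅Y, Z⁆ := by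
  rw [Ring.lie_def]
  exact (hY.mul hZ).sub (hZ.mul hY)

theorem IsDiff.pow (hY : IsDiff τ Y) (s : ℕ) : IsDiff τ (Y ^ s) := by
  induction s with
  | zero => rw [pow_zero]; exact isDiff_one
  | succ s ih => rw [pow_succ]; exact ih.mul hY

theorem OrdLE.mono (h : N ≤ M) (hY : OrdLE N Y) : OrdLE M Y := fun m hm => hY m (by omega)

theorem OrdLE.sub (hY : OrdLE N Y) (hZ : OrdLE N Z) : OrdLE N (Y - Z) := fun m hm => by
  rw [Op.coeff_sub, hY m hm, hZ m hm, sub_zero]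

theorem OrdLE.mul (hY : OrdLE N Y) (hZ : OrdLE M Z) : OrdLE (N + M) (Y * Z) := fun m hm => by
  rw [coeff_mul_of_ordLE hY hZ, Finset.Icc_eq_empty (by omega), Finset.sum_empty]

theorem OrdLE.lie (hY : OrdLE N Y) (hZ : OrdLE M Z) : OrdLE (N + M) ⁅Y, Z⁆ := by
  rw [Ring.lie_def]
  exact (hY.mul hZ).sub (add_comm M N ▸ hZ.mul hY)

theorem OrdLE.sym_eq_zero (hY : OrdLE N Y) (h : N < m) : sym Y m = 0 := by
  rw [sym, hY m h]
  rfl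

theorem NonNeg.sym_eq_zero (hY : NonNeg Y) (h : m < 0) : sym Y m = 0 := by
  rw [sym, hY m h]
  rfl

theorem ordLE_endOp (T : Module.End ℝ A) : OrdLE 0 (endOp T) := fun m hm => by
  rw [coeff_endOp, if_neg (by omega)]

theorem ordLE_mulBy (a : A) : OrdLE 0 (mulBy a) := ordLE_endOp _

theorem nonNeg_endOp (T : Module.End ℝ A) : NonNeg (endOp T) := fun m hm => by
  rw [coeff_endOp, if_neg (by omega)]

theorem nonNeg_mulBy (a : A) : NonNeg (mulBy a) := nonNeg_endOp _

theorem nonNeg_shiftOp : NonNeg (shiftOp τ) := fun m hm => by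
  rw [coeff_shiftOp, if_neg (by omega)]

theorem NonNeg.add (hY : NonNeg Y) (hZ : NonNeg Z) : NonNeg (Y + Z) := fun m hm => by
  rw [Op.coeff_add, hY m hm, hZ m hm, add_zero]

theorem NonNeg.sub (hY : NonNeg Y) (hZ : NonNeg Z) : NonNeg (Y - Z) := fun m hm => by
  rw [Op.coeff_sub, hY m hm, hZ m hm, sub_zero]

theorem NonNeg.smul (c : ℝ) (hY : NonNeg Y) : NonNeg (c • Y) := fun m hm => by
  rw [Op.coeff_smul, hY m hm, smul_zero]

theorem NonNeg.mul (hY : NonNeg Y) (hZ : NonNeg Z) : NonNeg (Y * Z) := fun m hm => by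
  obtain ⟨N, hN⟩ := exists_ordLE Y
  obtain ⟨M, hM⟩ := exists_ordLE Z
  rw [coeff_mul_of_ordLE hN hM]
  refine Finset.sum_eq_zero fun i _ => ?_
  rcases lt_or_ge i 0 with h | h
  · rw [hY i h, zero_mul]
  · rw [hZ (m - i) (by omega), mul_zero]

theorem NonNeg.lie (hY : NonNeg Y) (hZ : NonNeg Z) : NonNeg ⁅Y, Z⁆ := by
  rw [Ring.lie_def]
  exact (hY.mul hZ).sub (hZ.mul hY)

/-- Without negative powers, order zero can only arise from order zero times order zero. As `A` is
commutative, commutators of such operators have no term of order zero. -/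
theorem sym_zero_mul (hYd : IsDiff τ Y) (hY : NonNeg Y) (hZ : NonNeg Z) :
    sym (Y * Z) 0 = sym Y 0 * sym Z 0 := by
  obtain ⟨N, hN⟩ := exists_ordLE Y
  obtain ⟨M, hM⟩ := exists_ordLE Z
  -- The bounds are raised to be nonnegative so that `i = 0` lies in the interval of summation.
  have hN' := hN.mono (le_max_left N 0)
  have hM' := hM.mono (le_max_left M 0)
  rw [sym_mul hYd hN' hM', Finset.sum_eq_single 0]
  · simp
  · intro i _ hi
    rcases lt_or_gt_of_ne hi with h | h
    · rw [hY.sym_eq_zero h, zero_mul]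
    · rw [hZ.sym_eq_zero (by omega), map_zero, mul_zero]
  · intro h
    exact (h (by rw [Finset.mem_Icc]; omega)).elim

theorem sym_zero_lie (hYd : IsDiff τ Y) (hZd : IsDiff τ Z) (hY : NonNeg Y) (hZ : NonNeg Z) :
    sym ⁅Y, Z⁆ 0 = 0 := by
  rw [Ring.lie_def, sym_sub, sym_zero_mul hYd hY hZ, sym_zero_mul hZd hZ hY, mul_comm, sub_self]

theorem sym_pos (Y : Op A) (m : ℤ) : sym (pos Y) m = if 0 ≤ m then sym Y m else 0 := by
  rw [sym, coeff_pos]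
  by_cases h : 0 ≤ m
  · rw [if_pos (by omega), if_pos h, sym]
  · rw [if_neg (by omega), if_neg h]
    rfl

theorem nonNeg_pos (Y : Op A) : NonNeg (pos Y) := fun m hm => by
  rw [coeff_pos, if_neg (by omega)]

theorem ordLE_sub_pos (Y : Op A) : OrdLE (-1) (Y - pos Y) := fun m hm => by
  rw [Op.coeff_sub, coeff_pos, if_pos (by omega), sub_self]

theorem IsDiff.pos (hY : IsDiff τ Y) : IsDiff τ (pos Y) := by
  intro m a
  rw [sym_pos, coeff_pos]
  by_cases h : 0 ≤ m
  · rw [if_pos (by omega), if_pos h, hY]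
  · rw [if_neg (by omega), if_neg h, zero_mul]
    rfl

/-- The commutator with a derivation acts on the coefficients. -/
theorem coeff_lie_endOp {D : Derivation ℝ A A} (hD : ∀ a, D (τ a) = τ (D a)) (hY : IsDiff τ Y)
    (m : ℤ) (a : A) : ⁅endOp D.toLinearMap, Y⁆.coeff (-m) a = D (sym Y m) * (τ ^ m) a := by
  have hD' : ∀ (m : ℤ) (a : A), D ((τ ^ m) a) = (τ ^ m) (D a) := by
    intro m
    induction m using Int.induction_on with
    | zero => simp
    | succ i ih => intro a; rw [zpow_add_one, AlgEquiv.mul_apply, ih, hD]; rfl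
    | pred i ih =>
      intro a
      have h : D (τ⁻¹ a) = τ⁻¹ (D a) := by
        apply τ.injective
        rw [← hD]
        change D (τ (τ.symm a)) = τ (τ.symm (D a))
        rw [τ.apply_symm_apply, τ.apply_symm_apply]
      rw [zpow_sub_one, AlgEquiv.mul_apply, ih, h]
      rfl
  rw [Ring.lie_def, Op.coeff_sub, coeff_endOp_mul, coeff_mul_endOp, LinearMap.sub_apply,
    Module.End.mul_apply, Module.End.mul_apply, hY, hY]
  change D _ - _ * (τ ^ m) (D a) = _
  rw [D.leibniz, hD']
  simp only [smul_eq_mul]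
  ring

theorem sym_lie_endOp {D : Derivation ℝ A A} (hD : ∀ a, D (τ a) = τ (D a)) (hY : IsDiff τ Y)
    (m : ℤ) : sym ⁅endOp D.toLinearMap, Y⁆ m = D (sym Y m) := by
  rw [sym, coeff_lie_endOp hD hY, map_one, mul_one]

theorem isDiff_lie_endOp {D : Derivation ℝ A A} (hD : ∀ a, D (τ a) = τ (D a))
    (hY : IsDiff τ Y) : IsDiff τ ⁅endOp D.toLinearMap, Y⁆ := by
  intro m a
  rw [sym_lie_endOp hD hY, coeff_lie_endOp hD hY]

theorem lie_endOp_mulBy {D : Derivation ℝ A A} (a : A) :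
    ⁅endOp D.toLinearMap, mulBy a⁆ = mulBy (D a) := by
  rw [Ring.lie_def, mulBy, mulBy, ← endOp_mul, ← endOp_mul, ← endOp_sub]
  congr 1
  ext b
  simp [mul_comm]

theorem lie_endOp_shiftOp {D : Derivation ℝ A A} (hD : ∀ a, D (τ a) = τ (D a)) :
    ⁅endOp D.toLinearMap, shiftOp τ⁆ = 0 := by
  refine (isDiff_lie_endOp hD isDiff_shiftOp).ext (fun m a => by simp [sym, Op.coeff_zero]) fun m => ?_
  rw [sym_lie_endOp hD isDiff_shiftOp, sym_shiftOp]
  split_ifs <;> simp [sym, Op.coeff_zero]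

theorem lie_endOp_endOp {D D' : Derivation ℝ A A} (h : ∀ a, D (D' a) = D' (D a)) :
    ⁅endOp D.toLinearMap, endOp D'.toLinearMap⁆ = 0 := by
  rw [Ring.lie_def, ← endOp_mul, ← endOp_mul, sub_eq_zero]
  congr 1
  ext a
  exact h a

theorem shiftOp_mul_mulBy (a : A) : shiftOp τ * mulBy a = mulBy (τ a) * shiftOp τ := by
  refine (isDiff_shiftOp.mul (isDiff_mulBy a)).ext ((isDiff_mulBy _).mul isDiff_shiftOp)
    fun m => ?_
  rw [sym_mul_shiftOp, sym_shiftOp_mul, sym_mulBy, sym_mulBy]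
  split_ifs <;> simp

/-- The difference operator with coefficients `q`. -/
noncomputable def ofSym (τ : A ≃ₐ[ℝ] A) (N : ℤ) (q : ℤ → A) : Op A :=
  HahnSeries.ofSuppBddBelow (Γ := ℤ) (R := Module.End ℝ A)
    (fun i => if -i ≤ N then LinearMap.mulLeft ℝ (q (-i)) * ((τ ^ (-i)).toLinearMap) else 0)
    (show BddBelow _ from ⟨-N, fun i hi => by
      by_contra h
      exact hi (if_neg (by omega))⟩)

theorem coeff_ofSym (N : ℤ) (q : ℤ → A) (m : ℤ) (a : A) :
    (ofSym τ N q).coeff (-m) a = if m ≤ N then q m * (τ ^ m) a else 0 := by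
  have h : (ofSym τ N q).coeff (-m) =
      if - -m ≤ N then LinearMap.mulLeft ℝ (q (- -m)) * ((τ ^ (- -m)).toLinearMap) else 0 := rfl
  rw [h, neg_neg]
  split_ifs <;> rfl

theorem sym_ofSym (N : ℤ) (q : ℤ → A) (m : ℤ) :
    sym (ofSym τ N q) m = if m ≤ N then q m else 0 := by
  rw [sym, coeff_ofSym, map_one, mul_one]

theorem isDiff_ofSym (N : ℤ) (q : ℤ → A) : IsDiff τ (ofSym τ N q) := by
  intro m a
  rw [sym_ofSym, coeff_ofSym]
  split_ifs <;> simp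

theorem ordLE_ofSym (N : ℤ) (q : ℤ → A) : OrdLE N (ofSym τ N q) := fun m hm => by
  ext a
  rw [coeff_ofSym, if_neg (by omega)]
  rfl

/-- Difference operators with coefficients in an ideal. -/
def InIdeal (τ : A ≃ₐ[ℝ] A) (I : Ideal A) (Y : Op A) : Prop := IsDiff τ Y ∧ ∀ m, sym Y m ∈ I

variable {I : Ideal A}

theorem InIdeal.add (hY : InIdeal τ I Y) (hZ : InIdeal τ I Z) : InIdeal τ I (Y + Z) :=
  ⟨hY.1.add hZ.1, fun m => I.add_mem (hY.2 m) (hZ.2 m)⟩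

theorem InIdeal.sub (hY : InIdeal τ I Y) (hZ : InIdeal τ I Z) : InIdeal τ I (Y - Z) :=
  ⟨hY.1.sub hZ.1, fun m => I.sub_mem (hY.2 m) (hZ.2 m)⟩

theorem InIdeal.smul (c : ℝ) (hY : InIdeal τ I Y) : InIdeal τ I (c • Y) :=
  ⟨hY.1.smul c, fun m => by
    rw [sym_smul, Algebra.smul_def]
    exact I.mul_mem_left _ (hY.2 m)⟩

theorem InIdeal.mul_left (hI : ∀ (m : ℤ), ∀ a ∈ I, (τ ^ m) a ∈ I) (hZ : IsDiff τ Z)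
    (hY : InIdeal τ I Y) : InIdeal τ I (Z * Y) := by
  refine ⟨hZ.mul hY.1, fun m => ?_⟩
  obtain ⟨N, hN⟩ := exists_ordLE Y
  obtain ⟨M, hM⟩ := exists_ordLE Z
  rw [sym_mul hZ hM hN]
  exact I.sum_mem fun i _ => I.mul_mem_left _ (hI i _ (hY.2 _))

theorem InIdeal.mul_right (hZ : IsDiff τ Z) (hY : InIdeal τ I Y) : InIdeal τ I (Y * Z) := by
  refine ⟨hY.1.mul hZ, fun m => ?_⟩
  obtain ⟨N, hN⟩ := exists_ordLE Y
  obtain ⟨M, hM⟩ := exists_ordLE Z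
  rw [sym_mul hY.1 hN hM]
  exact I.sum_mem fun i _ => I.mul_mem_right _ (hY.2 _)

theorem inIdeal_mulBy (ha : a ∈ I) : InIdeal τ I (mulBy a) :=
  ⟨isDiff_mulBy a, fun m => by
    rw [sym_mulBy]
    split_ifs
    exacts [ha, I.zero_mem]⟩

/-- The coefficients of the commutator of `∂ - c E - w` with a difference operator. -/
theorem sym_lie_connection {D : Derivation ℝ A A} (hD : ∀ a, D (τ a) = τ (D a)) (c : ℝ) (w : A)
    (hY : IsDiff τ Y) (m : ℤ) :
    sym ⁅endOp D.toLinearMap - (c • shiftOp τ + mulBy w), Y⁆ m = D (sym Y m) -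
      (c • (τ (sym Y (m - 1)) - sym Y (m - 1)) + (w * sym Y m - sym Y m * (τ ^ m) w)) := by
  rw [ring_sub_lie, ring_add_lie, sym_sub, sym_lie_endOp hD hY, sym_add, Ring.lie_def, Ring.lie_def,
    smul_mul_assoc, mul_smul_comm, ← smul_sub, sym_smul, sym_sub, sym_shiftOp_mul, sym_mul_shiftOp,
    sym_sub, sym_mulBy_mul, hY.sym_mul_mulBy]

/-- A difference operator with coefficients in `I` that commutes with `∂ - c E - w` vanishes if
`I` contains no nonzero element that is invariant under the shift. -/
theorem eq_zero_of_lie_connection_eq_zero {D : Derivation ℝ A A} (hD : ∀ a, D (τ a) = τ (D a))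
    {c : ℝ} (hc : c ≠ 0) {w : A} (hI : ∀ a ∈ I, τ a = a → a = 0) (hY : InIdeal τ I Y)
    (h : ⁅endOp D.toLinearMap - (c • shiftOp τ + mulBy w), Y⁆ = 0) : Y = 0 := by
  by_contra hne
  set N := -HahnSeries.order Y with hN
  have h₁ : sym Y (N + 1) = 0 := by
    have : Y.coeff (-(N + 1)) = 0 := HahnSeries.coeff_eq_zero_of_lt_order (by omega)
    rw [sym, this]
    rfl
  -- With `N` the order of `Y`, the coefficient one order above it is just `-c (τ p - p)`, where `p`
  -- is the leading coefficient. So `p` is invariant, hence zero, contradicting the choice of `N`.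
  have h₂ := sym_lie_connection hD c w hY.1 (N + 1)
  rw [h, h₁, add_sub_cancel_right, map_zero, mul_zero, zero_mul, sub_zero, add_zero, zero_sub] at h₂
  have h₃ : c • (τ (sym Y N) - sym Y N) = 0 := by
    rw [← neg_eq_zero, ← h₂]
    rfl
  have h₄ := hI _ (hY.2 _) (sub_eq_zero.mp ((smul_eq_zero_iff_right hc).mp h₃))
  have h₅ := hY.1.coeff_eq_zero h₄
  rw [hN, neg_neg] at h₅
  exact hne (HahnSeries.coeff_order_eq_zero.mp h₅)

end DifferenceOperators


/-! ### The discrete Leibniz rule in powers of the shift. -/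

section LeibnizRule

/-- The shift `E ^ m` as an additive operator. -/
def shiftEnd (m : ℤ) : Module.End ℤ Fn where
  toFun := lift (shift m)
  map_add' _ _ := rfl
  map_smul' c f := by
    funext u n x
    simp [lift, shift]

theorem shiftEnd_apply (m : ℤ) (f : Fn) : shiftEnd m f = lift (shift m) f := rfl

/-- The difference as an additive operator. -/
def deltaEnd : Module.End ℤ Fn := shiftEnd 1 - 1

theorem deltaEnd_pow_apply (i : ℕ) (f : Fn) : (deltaEnd ^ i) f = (lift delta)^[i] f := by
  rw [Module.End.pow_apply]
  rfl

theorem shiftEnd_one_pow (l : ℕ) : shiftEnd 1 ^ l = shiftEnd l := by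
  induction l with
  | zero => ext f; simp [shiftEnd_apply, lift_shift_zero]
  | succ l ih =>
    ext1 f
    rw [pow_succ, Module.End.mul_apply, ih, shiftEnd_apply, shiftEnd_apply, lift_shift_shift,
      shiftEnd_apply]
    congr 2
    push_cast
    ring

/-- `∑ C(j, i) (-Δ) ^ i E ^ (j - i) = (E - Δ) ^ j = 1`. -/
theorem sum_deltaEnd_shiftEnd (j : ℕ) :
    ∑ p ∈ Finset.HasAntidiagonal.antidiagonal j, (j.choose p.1 : ℤ) •
      ((-1 : ℤ) ^ p.1 • (deltaEnd ^ p.1 * shiftEnd (p.2 : ℤ))) = 1 := by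
  have h : Commute (-deltaEnd) (shiftEnd 1) :=
    (((Commute.refl (shiftEnd 1)).sub_left (Commute.one_left _)).neg_left :
      Commute (-(shiftEnd 1 - 1)) (shiftEnd 1))
  have e : -deltaEnd + shiftEnd 1 = 1 := by
    rw [deltaEnd]
    abel
  have := h.add_pow' j
  rw [e, one_pow] at this
  rw [this]
  refine Finset.sum_congr rfl fun p _ => ?_
  rw [shiftEnd_one_pow, neg_pow deltaEnd, natCast_zsmul]
  congr 1
  rw [zsmul_eq_mul, mul_assoc]
  push_cast
  rfl

theorem sum_antidiagonal_assoc {M : Type*} [AddCommMonoid M] (r : ℕ) (f : ℕ → ℕ → ℕ → M) :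
    ∑ p ∈ Finset.HasAntidiagonal.antidiagonal r, ∑ q ∈ Finset.HasAntidiagonal.antidiagonal p.2, f p.1 q.1 q.2 =
      ∑ p ∈ Finset.HasAntidiagonal.antidiagonal r, ∑ q ∈ Finset.HasAntidiagonal.antidiagonal p.1, f q.1 q.2 p.2 := by
  rw [Finset.sum_sigma', Finset.sum_sigma']
  refine Finset.sum_nbij' (fun p => ⟨(p.1.1 + p.2.1, p.2.2), (p.1.1, p.2.1)⟩)
    (fun p => ⟨(p.2.1, p.2.2 + p.1.2), (p.2.2, p.1.2)⟩) ?_ ?_ ?_ ?_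
    (fun _ _ => rfl)
  all_goals
    rintro ⟨⟨a, b⟩, ⟨c, d⟩⟩ h
    simp only [Finset.mem_sigma, Finset.HasAntidiagonal.mem_antidiagonal] at h ⊢
    obtain ⟨h₁, h₂⟩ := h
  · exact ⟨by omega, trivial⟩
  · exact ⟨by omega, trivial⟩
  · subst h₂; rfl
  · subst h₂; rfl

/-- The rule `Δ ^ s b Δ ^ t = ∑ᵢ C(s, i) (Δ ^ i E ^ (s - i) b) Δ ^ (s + t - i)`, expanded in powers
of the shift: comparison of the parts of order `s + t - r`. -/
theorem leibniz_expansion (s t : ℤ) (r : ℕ) :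
    ∑ p ∈ Finset.HasAntidiagonal.antidiagonal r, ((-1 : ℤ) ^ p.2 * Ring.choose (s + t - p.1) p.2 *
      Ring.choose s p.1) • (deltaEnd ^ p.1 * shiftEnd (s - p.1)) =
    ∑ p ∈ Finset.HasAntidiagonal.antidiagonal r, ((-1 : ℤ) ^ p.1 * Ring.choose s p.1 *
      ((-1) ^ p.2 * Ring.choose t p.2)) • shiftEnd (s - p.1) := by
  have h₁ : ∀ p : ℕ × ℕ, ((-1 : ℤ) ^ p.2 * Ring.choose (s + t - p.1) p.2 *
      Ring.choose s p.1) • (deltaEnd ^ p.1 * shiftEnd (s - p.1)) =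
      ∑ q ∈ Finset.HasAntidiagonal.antidiagonal p.2, ((-1 : ℤ) ^ (q.1 + q.2) * (((p.1 + q.1).choose p.1 : ℤ) *
        Ring.choose s (p.1 + q.1)) * Ring.choose t q.2) •
          (deltaEnd ^ p.1 * shiftEnd (s - p.1)) := by
    intro p
    -- Chu–Vandermonde splits `C(s + t - i, j)` into products `C(s - i, l) C(t, q)`, and `C(s, i)
    -- C(s - i, l) = C(i + l, i) C(s, i + l)`.
    rw [show s + t - p.1 = (s - p.1) + t by ring,
      Ring.add_choose_eq p.2 (Commute.all (s - p.1 : ℤ) t), ← Finset.sum_smul]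
    congr 1
    rw [Finset.mul_sum, Finset.sum_mul]
    refine Finset.sum_congr rfl fun q hq => ?_
    have := Ring.choose_smul_choose s (Nat.le_add_right p.1 q.1)
    rw [nsmul_eq_mul, Nat.add_sub_cancel_left] at this
    rw [this, Finset.HasAntidiagonal.mem_antidiagonal.mp hq]
    ring
  rw [Finset.sum_congr rfl fun p _ => h₁ p, sum_antidiagonal_assoc r fun i l q =>
    ((-1 : ℤ) ^ (l + q) * (((i + l).choose i : ℤ) * Ring.choose s (i + l)) * Ring.choose t q) •
      (deltaEnd ^ i * shiftEnd (s - i))]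
  refine Finset.sum_congr rfl fun p _ => ?_
  -- After regrouping by `i + l`, the inner sum is the expansion of `(E - Δ)^(i + l) = 1`,
  -- multiplied by a power of the shift.
  have h₂ := congrArg (fun T => ((-1 : ℤ) ^ p.1 * Ring.choose s p.1 *
      ((-1) ^ p.2 * Ring.choose t p.2)) • (T * shiftEnd (s - p.1))) (sum_deltaEnd_shiftEnd p.1)
  simp only [one_mul] at h₂
  rw [← h₂, Finset.sum_mul, Finset.smul_sum]
  refine Finset.sum_congr rfl fun q hq => ?_
  have hq' := Finset.HasAntidiagonal.mem_antidiagonal.mp hq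
  have h₃ : shiftEnd (q.2 : ℤ) * shiftEnd (s - p.1) = shiftEnd (s - q.1) := by
    ext1 f
    rw [Module.End.mul_apply, shiftEnd_apply, shiftEnd_apply, shiftEnd_apply, lift_shift_shift]
    congr 2
    rw [← hq']
    push_cast
    ring
  rw [smul_mul_assoc, smul_mul_assoc, mul_assoc (deltaEnd ^ q.1), h₃, smul_smul, smul_smul, hq']
  congr 1
  have h₄ : (-1 : ℤ) ^ p.1 * (-1) ^ q.1 = (-1) ^ q.2 := by
    rw [← hq', pow_add, mul_right_comm, ← mul_pow]
    norm_num
  rw [pow_add, ← h₄]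
  ring

end LeibnizRule

/-! ### Translation between expansions in `Δ` and in `E`. -/

section Symbols

/-- The coefficient of `E ^ m` in `Δ ^ k`. -/
noncomputable def shiftCoeff (k m : ℤ) : ℤ :=
  if m ≤ k then (-1) ^ (k - m).toNat * Ring.choose k (k - m).toNat else 0

theorem shiftCoeff_of_lt {k m : ℤ} (h : k < m) : shiftCoeff k m = 0 := if_neg (by omega)

theorem shiftCoeff_self (k : ℤ) : shiftCoeff k k = 1 := by
  simp [shiftCoeff]

theorem shiftCoeff_sub (k : ℤ) (i : ℕ) : shiftCoeff k (k - i) = (-1) ^ i * Ring.choose k i := by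
  rw [shiftCoeff, if_pos (by omega), sub_sub_cancel, Int.toNat_natCast]

theorem shiftCoeff_of_nonneg_of_neg {k m : ℤ} (hk : 0 ≤ k) (hm : m < 0) : shiftCoeff k m = 0 := by
  obtain ⟨k, rfl⟩ := Int.eq_ofNat_of_zero_le hk
  rw [shiftCoeff, if_pos (by omega), show ((k : ℕ) : ℤ) = (k : ℤ) from rfl, Ring.choose_natCast,
    Nat.choose_eq_zero_of_lt (by omega)]
  simp

/-- The series `Y` represents the pseudo-difference operator `P` of order at most `N`. -/
structure Represents (N : ℤ) (Y : Op coefAlg) (P : PsiDO) : Prop where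
  bound : ∀ k, N < k → P k = 0
  isDiff : IsDiff shiftEquiv Y
  sym_eq : ∀ m, ((sym Y m : coefAlg) : Fn) = ∑ k ∈ Finset.Icc m N, shiftCoeff k m • P k

variable {N M : ℤ} {Y Z : Op coefAlg} {P Q : PsiDO}

theorem Represents.ordLE (h : Represents N Y P) : OrdLE N Y := fun m hm => by
  refine h.isDiff.coeff_eq_zero (Subtype.ext ?_)
  rw [h.sym_eq, Finset.Icc_eq_empty (by omega), Finset.sum_empty]
  rfl

theorem Represents.sym_eq_sum (h : Represents N Y P) {a b m : ℤ} (ha : a ≤ m) (hb : N ≤ b) :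
    ((sym Y m : coefAlg) : Fn) = ∑ k ∈ Finset.Icc a b, shiftCoeff k m • P k := by
  rw [h.sym_eq]
  refine Finset.sum_subset (Finset.Icc_subset_Icc ha hb) fun k _ hk => ?_
  rw [Finset.mem_Icc, not_and_or, not_le, not_le] at hk
  rcases hk with hk | hk
  · rw [shiftCoeff_of_lt hk, zero_smul]
  · rw [h.bound k hk, smul_zero]

theorem Represents.mono (h : Represents N Y P) (hNM : N ≤ M) : Represents M Y P :=
  ⟨fun k hk => h.bound k (by omega), h.isDiff, fun _ => h.sym_eq_sum le_rfl hNM⟩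

theorem Represents.add (h₁ : Represents N Y P) (h₂ : Represents N Z Q) :
    Represents N (Y + Z) (P + Q) where
  bound k hk := by rw [Pi.add_apply, h₁.bound k hk, h₂.bound k hk, add_zero]
  isDiff := h₁.isDiff.add h₂.isDiff
  sym_eq m := by
    rw [sym_add, Subalgebra.coe_add, h₁.sym_eq, h₂.sym_eq, ← Finset.sum_add_distrib]
    exact Finset.sum_congr rfl fun k _ => (smul_add _ _ _).symm

theorem Represents.sub (h₁ : Represents N Y P) (h₂ : Represents N Z Q) :
    Represents N (Y - Z) (P - Q) where
  bound k hk := by rw [Pi.sub_apply, h₁.bound k hk, h₂.bound k hk, sub_zero]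
  isDiff := h₁.isDiff.sub h₂.isDiff
  sym_eq m := by
    rw [sym_sub, Subalgebra.coe_sub, h₁.sym_eq, h₂.sym_eq, ← Finset.sum_sub_distrib]
    exact Finset.sum_congr rfl fun k _ => (smul_sub _ _ _).symm

theorem Represents.mulBy_mul (a : coefAlg) (h : Represents N Y P) :
    Represents N (mulBy a * Y) (fun k => (a : Fn) * P k) where
  bound k hk := by rw [h.bound k hk, mul_zero]
  isDiff := (isDiff_mulBy a).mul h.isDiff
  sym_eq m := by
    rw [sym_mulBy_mul, Subalgebra.coe_mul, h.sym_eq, Finset.mul_sum]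
    exact Finset.sum_congr rfl fun k _ => mul_smul_comm _ _ _

theorem represents_mulBy (a : coefAlg) : Represents 0 (mulBy a) (mulOp a) where
  bound k hk := if_neg (by omega)
  isDiff := isDiff_mulBy a
  sym_eq m := by
    rw [sym_mulBy]
    split_ifs with h
    · subst h
      simp [shiftCoeff_self, mulOp]
    · refine (Finset.sum_eq_zero fun k hk => ?_).symm
      rw [Finset.mem_Icc] at hk
      rw [mulOp]
      split_ifs with hk'
      · rw [hk', shiftCoeff_of_nonneg_of_neg le_rfl (by omega), zero_smul]
      · rw [smul_zero]

/-- Truncation in powers of `Δ` agrees with truncation in powers of `E`: for `k ≥ 0` the expansion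
of `Δ^k` has only nonnegative powers of `E`, for `k < 0` only negative ones. -/
theorem Represents.pos (h : Represents N Y P) : Represents N (pos Y) (posPart P) where
  bound k hk := by rw [posPart, h.bound k hk, ite_self]
  isDiff := h.isDiff.pos
  sym_eq m := by
    rw [sym_pos]
    split_ifs with hm
    · rw [h.sym_eq]
      refine Finset.sum_congr rfl fun k hk => ?_
      rw [Finset.mem_Icc] at hk
      rw [posPart, if_pos (by omega)]
    · refine (Finset.sum_eq_zero fun k hk => ?_).symm
      rw [posPart]
      split_ifs with hk'
      · rw [shiftCoeff_of_nonneg_of_neg hk' (by omega), zero_smul]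
      · rw [smul_zero]

theorem Represents.dxOp (h : Represents N Y P) (hP : ∀ k, P k ∈ coefAlg) :
    Represents N ⁅endOp dxDer.toLinearMap, Y⁆ (dxOp P) where
  bound k hk := by
    rw [DKP.dxOp, h.bound k hk]
    exact lift_dx_const fun _ => 0
  isDiff := isDiff_lie_endOp dxDer_shiftEquiv h.isDiff
  sym_eq m := by
    rw [sym_lie_endOp dxDer_shiftEquiv h.isDiff]
    have h₁ : sym Y m = ∑ k ∈ Finset.Icc m N, shiftCoeff k m • (⟨P k, hP k⟩ : coefAlg) := by
      apply Subtype.ext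
      rw [h.sym_eq]
      simp
    rw [h₁, map_sum]
    simp only [map_zsmul]
    rw [AddSubmonoidClass.coe_finsetSum]
    rfl

/-- The order bounds confine the nonzero terms to a finite rectangle. It depends on `m` but not on
`k`, which permits exchanging it with a sum over `k ≥ m`. -/
theorem comp_eq_sum {m k : ℤ} (hP : ∀ k, N < k → P k = 0) (hQ : ∀ k, M < k → Q k = 0)
    (hm : m ≤ k) : comp P Q k = ∑ s ∈ Finset.Icc (m - M) N, ∑ t ∈ Finset.Icc (m - N) M,
      if k ≤ s + t then P s * (Ring.choose s (s + t - k).toNat •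
        (deltaEnd ^ (s + t - k).toNat * shiftEnd (k - t)) (Q t)) else 0 := by
  rw [comp, finsum_eq_sum_of_support_subset
    (s := Finset.Icc (m - M) N ×ˢ Finset.Icc (m - N) M), Finset.sum_product]
  · refine Finset.sum_congr rfl fun s _ => Finset.sum_congr rfl fun t _ => ?_
    rw [Module.End.mul_apply, deltaEnd_pow_apply, shiftEnd_apply, mul_smul_comm]
  · intro p hp
    rw [Function.mem_support] at hp
    have h₁ : k ≤ p.1 + p.2 := by
      by_contra h
      exact hp (if_neg h)
    rw [if_pos h₁] at hp
    have h₂ : p.1 ≤ N := by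
      by_contra h
      rw [hP p.1 (by omega), zero_mul, smul_zero] at hp
      exact hp rfl
    have h₃ : p.2 ≤ M := by
      by_contra h
      rw [hQ p.2 (by omega), ← shiftEnd_apply, map_zero, ← deltaEnd_pow_apply, map_zero, mul_zero,
        smul_zero] at hp
      exact hp rfl
    rw [Finset.coe_product, Set.mem_prod, Finset.mem_coe, Finset.mem_coe, Finset.mem_Icc,
      Finset.mem_Icc]
    omega

/-- The coefficient of `E ^ m` in `Δ ^ s b Δ ^ t`, computed in two ways. -/
theorem sum_shiftCoeff_leibniz {s t m : ℤ} (hs : s ≤ N) (ht : t ≤ M) :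
    ∑ k ∈ Finset.Icc m (N + M), shiftCoeff k m • (if k ≤ s + t then
      Ring.choose s (s + t - k).toNat • (deltaEnd ^ (s + t - k).toNat * shiftEnd (k - t)) else 0) =
    ∑ i ∈ Finset.Icc (m - M) N, (shiftCoeff s i * shiftCoeff t (m - i)) • shiftEnd i := by
  rcases lt_or_ge (s + t) m with hlt | hge
  · rw [Finset.sum_eq_zero, Finset.sum_eq_zero]
    · intro i _
      rcases lt_or_ge s i with h | h
      · rw [shiftCoeff_of_lt h, zero_mul, zero_smul]
      · rw [shiftCoeff_of_lt (show t < m - i by omega), mul_zero, zero_smul]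
    · intro k hk
      rw [Finset.mem_Icc] at hk
      rw [if_neg (by omega), smul_zero]
  -- With `r = s + t - m`, both sums are reindexed by pairs `p` of sum `r`, through `k = s + t -
  -- p.1` and `i = s - p.1`. What remains is `leibniz_expansion`.
  · obtain ⟨r, hr⟩ := Int.eq_ofNat_of_zero_le (sub_nonneg.mpr hge)
    have hr' : s + t - m = (r : ℤ) := hr
    have key := leibniz_expansion s t r
    have e₁ : ∑ k ∈ Finset.Icc m (N + M), shiftCoeff k m • (if k ≤ s + t then
        Ring.choose s (s + t - k).toNat •
          (deltaEnd ^ (s + t - k).toNat * shiftEnd (k - t)) else 0) =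
        ∑ p ∈ Finset.HasAntidiagonal.antidiagonal r, ((-1 : ℤ) ^ p.2 * Ring.choose (s + t - p.1) p.2 *
          Ring.choose s p.1) • (deltaEnd ^ p.1 * shiftEnd (s - p.1)) := by
      symm
      refine Finset.sum_bij_ne_zero (fun p _ _ => s + t - (p.1 : ℤ)) ?_ ?_ ?_ ?_
      · intro p hp _
        rw [Finset.HasAntidiagonal.mem_antidiagonal] at hp
        rw [Finset.mem_Icc]
        omega
      · intro p hp _ q hq _ h
        rw [Finset.HasAntidiagonal.mem_antidiagonal] at hp hq
        ext <;> omega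
      · intro k hk h
        rw [Finset.mem_Icc] at hk
        have hk' : k ≤ s + t := by
          by_contra hk'
          rw [if_neg hk', smul_zero] at h
          exact h rfl
        have hp : ((s + t - k).toNat, (k - m).toNat) ∈ Finset.HasAntidiagonal.antidiagonal r := by
          rw [Finset.HasAntidiagonal.mem_antidiagonal]
          omega
        have e : s + t - ((s + t - k).toNat : ℤ) = k := by omega
        refine ⟨_, hp, ?_, e⟩
        rw [if_pos hk', shiftCoeff, if_pos hk.1, smul_smul] at h
        rwa [e, show s - ((s + t - k).toNat : ℤ) = k - t by omega]
      · intro p hp _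
        rw [Finset.HasAntidiagonal.mem_antidiagonal] at hp
        have e : s + t - (s + t - (p.1 : ℤ)) = p.1 := by ring
        rw [if_pos (by omega), shiftCoeff, if_pos (by omega), smul_smul, e, Int.toNat_natCast,
          show (s + t - (p.1 : ℤ) - m).toNat = p.2 by omega,
          show s + t - (p.1 : ℤ) - t = s - p.1 by ring]
    have e₂ : ∑ i ∈ Finset.Icc (m - M) N, (shiftCoeff s i * shiftCoeff t (m - i)) • shiftEnd i =
        ∑ p ∈ Finset.HasAntidiagonal.antidiagonal r, ((-1 : ℤ) ^ p.1 * Ring.choose s p.1 *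
          ((-1) ^ p.2 * Ring.choose t p.2)) • shiftEnd (s - p.1) := by
      symm
      refine Finset.sum_bij_ne_zero (fun p _ _ => s - (p.1 : ℤ)) ?_ ?_ ?_ ?_
      · intro p hp _
        rw [Finset.HasAntidiagonal.mem_antidiagonal] at hp
        rw [Finset.mem_Icc]
        omega
      · intro p hp _ q hq _ h
        rw [Finset.HasAntidiagonal.mem_antidiagonal] at hp hq
        ext <;> omega
      · intro i hi h
        rw [Finset.mem_Icc] at hi
        have hi₁ : i ≤ s := by
          by_contra hi'
          rw [shiftCoeff_of_lt (by omega), zero_mul, zero_smul] at h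
          exact h rfl
        have hi₂ : m - i ≤ t := by
          by_contra hi'
          rw [shiftCoeff_of_lt (show t < m - i by omega), mul_zero, zero_smul] at h
          exact h rfl
        have hp : ((s - i).toNat, (t - (m - i)).toNat) ∈ Finset.HasAntidiagonal.antidiagonal r := by
          rw [Finset.HasAntidiagonal.mem_antidiagonal]
          omega
        have e : s - ((s - i).toNat : ℤ) = i := by omega
        refine ⟨_, hp, ?_, e⟩
        rw [shiftCoeff, shiftCoeff, if_pos hi₁, if_pos hi₂] at h
        rwa [e]
      · intro p hp _
        rw [Finset.HasAntidiagonal.mem_antidiagonal] at hp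
        rw [shiftCoeff_sub, show m - (s - (p.1 : ℤ)) = t - (p.2 : ℤ) by omega, shiftCoeff_sub]
    rw [e₁, e₂, key]

/-- Composition by the Leibniz rule corresponds to multiplication of series. By bilinearity this
reduces to `Δ^s b Δ^t`, treated in `sum_shiftCoeff_leibniz`; from here on associativity comes from
the ring of series. -/
theorem Represents.mul (h₁ : Represents N Y P) (h₂ : Represents M Z Q) :
    Represents (N + M) (Y * Z) (comp P Q) where
  bound k hk := by
    rw [comp_eq_sum h₁.bound h₂.bound le_rfl, Finset.Icc_eq_empty (by omega), Finset.sum_empty]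
  isDiff := h₁.isDiff.mul h₂.isDiff
  sym_eq m := by
    have e₁ : ((sym (Y * Z) m : coefAlg) : Fn) = ∑ s ∈ Finset.Icc (m - M) N, ∑ t ∈ Finset.Icc (m - N) M,
        P s * (∑ i ∈ Finset.Icc (m - M) N,
          (shiftCoeff s i * shiftCoeff t (m - i)) • shiftEnd i) (Q t) := by
      rw [sym_mul h₁.isDiff h₁.ordLE h₂.ordLE, AddSubmonoidClass.coe_finsetSum]
      have : ∀ i ∈ Finset.Icc (m - M) N,
          ((sym Y i * (shiftEquiv ^ i) (sym Z (m - i)) : coefAlg) : Fn) =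
          ∑ s ∈ Finset.Icc (m - M) N, ∑ t ∈ Finset.Icc (m - N) M,
            P s * (((shiftCoeff s i * shiftCoeff t (m - i)) • shiftEnd i) (Q t)) := by
        intro i hi
        rw [Finset.mem_Icc] at hi
        rw [Subalgebra.coe_mul, coe_shiftEquiv_zpow, ← shiftEnd_apply,
          h₁.sym_eq_sum hi.1 le_rfl, h₂.sym_eq_sum (a := m - N) (by omega) le_rfl, map_sum,
          Finset.sum_mul_sum]
        refine Finset.sum_congr rfl fun s _ => Finset.sum_congr rfl fun t _ => ?_
        rw [map_zsmul, smul_mul_smul_comm, LinearMap.smul_apply, mul_smul_comm]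
      rw [Finset.sum_congr rfl this, Finset.sum_comm]
      refine Finset.sum_congr rfl fun s _ => ?_
      rw [Finset.sum_comm]
      refine Finset.sum_congr rfl fun t _ => ?_
      rw [LinearMap.sum_apply, Finset.mul_sum]
    have e₂ : ∀ k ∈ Finset.Icc m (N + M), shiftCoeff k m • comp P Q k =
        ∑ s ∈ Finset.Icc (m - M) N, ∑ t ∈ Finset.Icc (m - N) M,
          P s * (shiftCoeff k m • (if k ≤ s + t then Ring.choose s (s + t - k).toNat •
            (deltaEnd ^ (s + t - k).toNat * shiftEnd (k - t)) else 0)) (Q t) := by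
      intro k hk
      rw [Finset.mem_Icc] at hk
      rw [comp_eq_sum h₁.bound h₂.bound hk.1, Finset.smul_sum]
      refine Finset.sum_congr rfl fun s _ => ?_
      rw [Finset.smul_sum]
      refine Finset.sum_congr rfl fun t _ => ?_
      split_ifs
      · rw [LinearMap.smul_apply, LinearMap.smul_apply, mul_smul_comm, mul_smul_comm, mul_smul_comm]
      · simp
    refine e₁.trans (Eq.symm ?_)
    rw [Finset.sum_congr rfl e₂, Finset.sum_comm]
    refine Finset.sum_congr rfl fun s hs => ?_
    rw [Finset.sum_comm]
    refine Finset.sum_congr rfl fun t ht => ?_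
    rw [Finset.mem_Icc] at hs ht
    rw [← Finset.mul_sum, ← LinearMap.sum_apply, sum_shiftCoeff_leibniz hs.2 ht.2]

theorem Represents.commutator (h₁ : Represents N Y P) (h₂ : Represents M Z Q) :
    Represents (N + M) ⁅Y, Z⁆ (commutator P Q) := by
  rw [Ring.lie_def]
  exact (h₁.mul h₂).sub (add_comm M N ▸ h₂.mul h₁)

theorem Represents.pow (h : Represents 1 Y P) (s : ℕ) : Represents s (Y ^ s) (opPow P s) := by
  induction s with
  | zero =>
    rw [pow_zero, ← mulBy_one]
    exact represents_mulBy 1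
  | succ s ih =>
    rw [pow_succ', Nat.cast_succ, add_comm]
    exact h.mul ih

/-- A pseudo-difference operator is determined by the series that represents it. -/
theorem Represents.unique (h₁ : Represents N Y P) (h₂ : Represents N Y Q) : P = Q := by
  -- Descending induction on the order: the passage from `Δ` to `E` is triangular with ones on the
  -- diagonal.
  have key : ∀ r : ℕ, ∀ k : ℤ, N - r < k → P k = Q k := by
    intro r
    induction r with
    | zero => intro k hk; rw [h₁.bound k (by simpa using hk), h₂.bound k (by simpa using hk)]
    | succ r ih =>
      intro k hk
      rcases lt_or_ge (N - r) k with h | h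
      · exact ih k h
      · have e := (h₁.sym_eq k).symm.trans (h₂.sym_eq k)
        have hmem : k ∈ Finset.Icc k N := by
          rw [Finset.mem_Icc]
          omega
        rw [← Finset.add_sum_erase _ _ hmem, ← Finset.add_sum_erase _ _ hmem, shiftCoeff_self,
          one_smul, one_smul] at e
        have e' : ∑ j ∈ (Finset.Icc k N).erase k, shiftCoeff j k • P j =
            ∑ j ∈ (Finset.Icc k N).erase k, shiftCoeff j k • Q j := by
          refine Finset.sum_congr rfl fun j hj => ?_
          rw [Finset.mem_erase, Finset.mem_Icc] at hj
          rw [ih j (by push_cast at hk; omega)]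
        rw [e'] at e
        exact add_right_cancel e
  funext k
  exact key (N - k + 1).toNat k (by omega)

/-- Every pseudo-difference operator with coefficients in the coefficient algebra is represented
by a series. -/
theorem exists_represents (hP : ∀ k, N < k → P k = 0) (hP' : ∀ k, P k ∈ coefAlg) :
    ∃ Y, Represents N Y P := by
  refine ⟨ofSym shiftEquiv N fun m =>
    ∑ k ∈ Finset.Icc m N, shiftCoeff k m • (⟨P k, hP' k⟩ : coefAlg), hP, isDiff_ofSym _ _,
    fun m => ?_⟩
  rw [sym_ofSym]
  split_ifs with h
  · rw [AddSubmonoidClass.coe_finsetSum]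
    rfl
  · rw [Finset.Icc_eq_empty (by omega), Finset.sum_empty]
    rfl

/-- The coefficients with respect to powers of `Δ` of a difference operator. -/
noncomputable def deltaCoeff (Y : Op coefAlg) (N k : ℤ) : coefAlg :=
  ∑ m ∈ Finset.Icc k N, Ring.choose m (m - k).toNat • sym Y m

/-- The coefficients come from `E^m = (1 + Δ)^m`; the claim is that this binomial matrix inverts the
one expanding `Δ^k = (E - 1)^k`. -/
theorem represents_deltaCoeff (hY : IsDiff shiftEquiv Y) (hN : OrdLE N Y) :
    Represents N Y fun k => deltaCoeff Y N k where
  bound k hk := by rw [deltaCoeff, Finset.Icc_eq_empty (by omega), Finset.sum_empty]; rfl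
  isDiff := hY
  sym_eq m := by
    have : sym Y m = ∑ k ∈ Finset.Icc m N, shiftCoeff k m • deltaCoeff Y N k := by
      rcases lt_or_ge N m with h | h
      · rw [hN.sym_eq_zero h, Finset.Icc_eq_empty (by omega), Finset.sum_empty]
      have e : ∀ k ∈ Finset.Icc m N, shiftCoeff k m • deltaCoeff Y N k =
          ∑ j ∈ Finset.Icc m N, (if k ≤ j then shiftCoeff k m * Ring.choose j (j - k).toNat
            else 0) • sym Y j := by
        intro k hk
        rw [Finset.mem_Icc] at hk
        rw [deltaCoeff, Finset.smul_sum]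
        rw [← Finset.sum_subset (Finset.Icc_subset_Icc hk.1 le_rfl)]
        · refine Finset.sum_congr rfl fun j hj => ?_
          rw [Finset.mem_Icc] at hj
          rw [if_pos hj.1, smul_smul]
        · intro j _ hj
          rw [Finset.mem_Icc] at *
          rw [if_neg (by omega), zero_smul]
      rw [Finset.sum_congr rfl e, Finset.sum_comm]
      simp only [← Finset.sum_smul]
      have hmem : m ∈ Finset.Icc m N := by rw [Finset.mem_Icc]; omega
      refine Eq.symm ((Finset.sum_eq_single m ?_ fun h => (h hmem).elim).trans ?_)
      rotate_left
      · have : ∑ k ∈ Finset.Icc m N, (if k ≤ m then shiftCoeff k m *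
            Ring.choose m (m - k).toNat else 0) = 1 := by
          rw [Finset.sum_eq_single m]
          · simp [shiftCoeff_self]
          · intro k hk hkm
            rw [Finset.mem_Icc] at hk
            rw [if_neg (by omega)]
          · exact fun h => (h hmem).elim
        rw [this, one_smul]
      · intro j hj hjm
        rw [Finset.mem_Icc] at hj
        obtain ⟨r, hr⟩ := Int.eq_ofNat_of_zero_le (show 0 ≤ j - m by omega)
        have hr' : j - m = (r : ℤ) := hr
        have h₁ : ∑ k ∈ Finset.Icc m N, (if k ≤ j then shiftCoeff k m *
            Ring.choose j (j - k).toNat else 0) =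
            ∑ p ∈ Finset.HasAntidiagonal.antidiagonal r, (-1) ^ p.2 * Ring.choose (j - p.1) p.2 *
              Ring.choose j p.1 := by
          rw [← Finset.sum_filter]
          refine Finset.sum_nbij' (fun k => ((j - k).toNat, (k - m).toNat)) (fun p => j - p.1)
            ?_ ?_ ?_ ?_ ?_
          · intro k hk
            rw [Finset.mem_filter, Finset.mem_Icc] at hk
            rw [Finset.HasAntidiagonal.mem_antidiagonal]
            omega
          · intro p hp
            rw [Finset.HasAntidiagonal.mem_antidiagonal] at hp
            rw [Finset.mem_filter, Finset.mem_Icc]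
            omega
          · intro k hk
            rw [Finset.mem_filter, Finset.mem_Icc] at hk
            dsimp only
            omega
          · intro p hp
            rw [Finset.HasAntidiagonal.mem_antidiagonal] at hp
            ext <;> dsimp only <;> omega
          · intro k hk
            rw [Finset.mem_filter, Finset.mem_Icc] at hk
            dsimp only
            rw [shiftCoeff, if_pos hk.1.1, show j - ((j - k).toNat : ℤ) = k by omega]
        have h₂ : ∀ p ∈ Finset.HasAntidiagonal.antidiagonal r, (-1) ^ p.2 * Ring.choose (j - p.1) p.2 *
            Ring.choose j p.1 = Ring.choose j r * ((-1) ^ p.2 * (r.choose p.1 : ℤ)) := by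
          intro p hp
          rw [Finset.HasAntidiagonal.mem_antidiagonal] at hp
          have := Ring.choose_smul_choose j (show p.1 ≤ r by omega)
          rw [nsmul_eq_mul, show r - p.1 = p.2 by omega] at this
          linear_combination -(-1 : ℤ) ^ p.2 * this
        rw [h₁, Finset.sum_congr rfl h₂, ← Finset.mul_sum]
        -- Off the diagonal `r > 0`, and the entry is a multiple of `(1 - 1)^r = 0`.
        have h₃ := (Commute.all (1 : ℤ) (-1)).add_pow' r
        rw [add_neg_cancel, zero_pow (by omega)] at h₃
        have h₄ : ∑ p ∈ Finset.HasAntidiagonal.antidiagonal r, (-1 : ℤ) ^ p.2 * (r.choose p.1 : ℤ) = 0 := by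
          rw [h₃]
          refine Finset.sum_congr rfl fun p _ => ?_
          simp [mul_comm]
        rw [h₄, mul_zero, zero_smul]
    have h := congrArg (Subtype.val : coefAlg → Fn) this
    rw [h, AddSubmonoidClass.coe_finsetSum]
    rfl

end Symbols


/-! ### Existence and uniqueness of the Lax operator. -/

theorem Represents.series_unique {N : ℤ} {Y Z : Op coefAlg} {P : PsiDO} (h₁ : Represents N Y P)
    (h₂ : Represents N Z P) : Y = Z :=
  h₁.isDiff.ext h₂.isDiff fun m => Subtype.ext ((h₁.sym_eq m).trans (h₂.sym_eq m).symm)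

/-- The field `u` as an element of `𝓕`. -/
def flowField : flowFn := ⟨field, IsFlowFn.field⟩

/-- A constant coefficient. -/
noncomputable def constCoef (c : ℝ) : coefAlg := algebraMap ℝ coefAlg c

theorem coe_constCoef (c : ℝ) : (constCoef c : Fn) = fun _ _ _ => c := rfl

theorem dxDer_constCoef (c : ℝ) : dxDer (constCoef c) = 0 := dxDer.map_algebraMap c

theorem gateauxDer_constCoef (g : flowFn) (c : ℝ) : gateauxDer g (constCoef c) = 0 :=
  (gateauxDer g).map_algebraMap c

theorem shiftEquiv_zpow_constCoef (m : ℤ) (c : ℝ) :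
    (shiftEquiv ^ m) (constCoef c) = constCoef c := (shiftEquiv ^ m).commutes c

theorem shiftEquiv_constCoef (c : ℝ) : shiftEquiv (constCoef c) = constCoef c :=
  shiftEquiv.commutes c

theorem smul_eq_constCoef_mul (c : ℝ) (a : coefAlg) : c • a = constCoef c * a :=
  Algebra.smul_def c a

/-- The coefficient of `E ^ 0` in `A₁`. -/
noncomputable def zeroCoef (h : ℝ) : coefAlg := toCoef flowField - constCoef h⁻¹

theorem dxDer_zeroCoef (h : ℝ) : dxDer (zeroCoef h) = dxDer (toCoef flowField) := by
  rw [zeroCoef, map_sub, dxDer_constCoef, sub_zero]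

theorem gateauxDer_toCoef (g f : flowFn) : gateauxDer g (toCoef f) = toCoef (flowGateaux f g) := rfl

theorem flowGateaux_flowField (g : flowFn) : flowGateaux flowField g = g :=
  Subtype.ext (gateaux_field g)

theorem gateauxDer_zeroCoef (h : ℝ) (g : flowFn) : gateauxDer g (zeroCoef h) = toCoef g := by
  rw [zeroCoef, map_sub, gateauxDer_constCoef, sub_zero, gateauxDer_toCoef, flowGateaux_flowField]

/-- The operator `A₁` as a series. -/
noncomputable def seriesA₁ (h : ℝ) : Op coefAlg :=
  h⁻¹ • shiftOp shiftEquiv + mulBy (zeroCoef h)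

/-- The operator `∂ₓ - A₁`. -/
noncomputable def connection (h : ℝ) : Op coefAlg := endOp dxDer.toLinearMap - seriesA₁ h

theorem represents_shiftOp_sub_one :
    Represents 1 (shiftOp shiftEquiv - 1) (fun k => if k = 1 then 1 else 0) where
  bound k hk := if_neg (by omega)
  isDiff := isDiff_shiftOp.sub isDiff_one
  sym_eq m := by
    have e : ∑ k ∈ Finset.Icc m 1, shiftCoeff k m • (if k = 1 then 1 else 0 : Fn) =
        shiftCoeff 1 m • 1 := by
      rcases lt_or_ge 1 m with h | h
      · rw [Finset.Icc_eq_empty (by omega), Finset.sum_empty, shiftCoeff_of_lt h, zero_smul]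
      · rw [Finset.sum_eq_single 1]
        · rw [if_pos rfl]
        · intro k _ hk
          rw [if_neg hk, smul_zero]
        · exact fun hn => (hn (by rw [Finset.mem_Icc]; omega)).elim
    rw [e, sym_sub, sym_shiftOp, ← mulBy_one, sym_mulBy]
    rcases lt_trichotomy m 0 with hm | rfl | hm
    · rw [if_neg (by omega), if_neg (by omega), shiftCoeff_of_nonneg_of_neg (by omega) hm, zero_smul,
        sub_zero]
      rfl
    · simp [shiftCoeff]
    · rcases eq_or_ne m 1 with rfl | hm'
      · simp [shiftCoeff_self]
      · rw [if_neg hm', if_neg (by omega), shiftCoeff_of_lt (by omega), zero_smul, sub_zero]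
        rfl

theorem represents_seriesA₁ (h : ℝ) : Represents 1 (seriesA₁ h) (opA₁ h) := by
  have h₁ := (represents_shiftOp_sub_one.mulBy_mul (constCoef h⁻¹)).add
    ((represents_mulBy (toCoef flowField)).mono zero_le_one)
  have e₁ : mulBy (constCoef h⁻¹) * (shiftOp shiftEquiv - 1) + mulBy (toCoef flowField) =
      seriesA₁ h := by
    have e : mulBy (zeroCoef h) = mulBy (toCoef flowField) - mulBy (constCoef h⁻¹) := by
      rw [eq_sub_iff_add_eq, ← mulBy_add, zeroCoef, sub_add_cancel]
    have e' : mulBy (constCoef h⁻¹) = h⁻¹ • (1 : Op coefAlg) := by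
      rw [constCoef, Algebra.algebraMap_eq_smul_one, mulBy_smul, mulBy_one]
    rw [seriesA₁, e, e', mul_sub, mul_one, smul_mul_assoc, one_mul]
    abel
  rw [e₁] at h₁
  convert h₁ using 1
  funext k
  rw [Pi.add_apply, opA₁, mulOp, coe_constCoef]
  split_ifs with h₂ h₃ h₃
  · omega
  · rw [mul_one, add_zero]
  · rw [mul_zero, zero_add]
    rfl
  · rw [mul_zero, zero_add]

/-- The series with respect to `E` of a Lax operator. -/
structure IsLaxSeries (h : ℝ) (Y : Op coefAlg) : Prop where
  isDiff : IsDiff shiftEquiv Y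
  ordLE : OrdLE 1 Y
  sym_one : sym Y 1 = constCoef h⁻¹
  sym_zero : sym Y 0 = zeroCoef h
  sym_neg : ∀ m < 0, sym Y m ∈ flowIdeal
  lie : ⁅connection h, Y⁆ = 0

/-- The prescribed coefficients of order `1` and `0` cancel in the difference, leaving coefficients
in `𝓕`, to which the rigidity statement applies. -/
theorem IsLaxSeries.unique {h : ℝ} (hh : h ≠ 0) {Y Z : Op coefAlg} (hY : IsLaxSeries h Y)
    (hZ : IsLaxSeries h Z) : Y = Z := by
  rw [← sub_eq_zero]
  refine eq_zero_of_lie_connection_eq_zero dxDer_shiftEquiv (inv_ne_zero hh) (w := zeroCoef h)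
    (I := flowIdeal) (fun a ha e => eq_zero_of_shiftEquiv_eq ha e)
    ⟨hY.isDiff.sub hZ.isDiff, fun m => ?_⟩ ?_
  · rw [sym_sub]
    rcases lt_trichotomy m 0 with hm | rfl | hm
    · exact sub_mem (hY.sym_neg m hm) (hZ.sym_neg m hm)
    · rw [hY.sym_zero, hZ.sym_zero, sub_self]
      exact zero_mem _
    · rcases eq_or_ne m 1 with rfl | hm'
      · rw [hY.sym_one, hZ.sym_one, sub_self]
        exact zero_mem _
      · rw [hY.ordLE.sym_eq_zero (by omega), hZ.ordLE.sym_eq_zero (by omega), sub_self]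
        exact zero_mem _
  · have := ring_lie_sub (connection h) Y Z
    rw [hY.lie, hZ.lie, sub_self] at this
    exact this

theorem IsLaxOperator.flow {h : ℝ} {L : PsiDO} (hL : IsLaxOperator h L) {k : ℤ} (hk : k ≤ 0) :
    IsFlowFn (L k) := by
  obtain ⟨v, hv, e⟩ := hL.coeff (-k).toNat
  rw [show -((-k).toNat : ℤ) = k by omega] at e
  exact e ▸ IsFlowFn.smul _ hv

theorem IsLaxOperator.mem_coefAlg {h : ℝ} {L : PsiDO} (hL : IsLaxOperator h L) (k : ℤ) :
    L k ∈ coefAlg := by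
  rcases le_or_gt k 0 with hk | hk
  · exact (hL.flow hk).mem_coefAlg
  · rcases eq_or_ne k 1 with rfl | hk'
    · exact hL.lead ▸ const_mem_coefAlg _
    · exact hL.order k (by omega) ▸ zero_mem _

/-- A Lax operator is represented by a Lax series. -/
theorem IsLaxOperator.exists_series {h : ℝ} {L : PsiDO} (hL : IsLaxOperator h L) :
    ∃ Y, Represents 1 Y L ∧ IsLaxSeries h Y := by
  obtain ⟨Y, hY⟩ := exists_represents hL.order hL.mem_coefAlg
  refine ⟨Y, hY, hY.isDiff, hY.ordLE, Subtype.ext ?_, Subtype.ext ?_, fun m hm => ?_, ?_⟩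
  · rw [hY.sym_eq, Finset.Icc_self, Finset.sum_singleton, shiftCoeff_self, one_smul, hL.lead,
      coe_constCoef]
  · rw [hY.sym_eq, show Finset.Icc (0 : ℤ) 1 = {0, 1} from rfl, Finset.sum_pair zero_ne_one,
      shiftCoeff_self, one_smul, hL.lead, hL.zero, zeroCoef, Subalgebra.coe_sub, coe_constCoef,
      show shiftCoeff 1 0 = -1 by simp [shiftCoeff], neg_smul, one_smul, ← sub_eq_add_neg]
    rfl
  · rw [mem_flowIdeal, hY.sym_eq]
    refine flowFn.sum_mem fun k _ => ?_
    rcases lt_or_ge k 0 with hk | hk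
    · exact zsmul_mem (show L k ∈ flowFn from hL.flow hk.le) _
    · rw [shiftCoeff_of_nonneg_of_neg hk hm, zero_smul]
      exact zero_mem _
  · rw [connection, ring_sub_lie, sub_eq_zero]
    have h₁ := (hY.dxOp hL.mem_coefAlg).mono (M := 1 + 1) (by norm_num)
    rw [hL.lax] at h₁
    exact h₁.series_unique ((represents_seriesA₁ h).commutator hY)

/-- The operator with the coefficients of a Lax series is a Lax operator. -/
theorem IsLaxSeries.isLaxOperator {h : ℝ} (hh : h ≠ 0) {Y : Op coefAlg} (hY : IsLaxSeries h Y) :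
    IsLaxOperator h fun k => deltaCoeff Y 1 k := by
  have hR := represents_deltaCoeff hY.isDiff hY.ordLE
  have h₀ : (deltaCoeff Y 1 0 : Fn) = field := by
    rw [deltaCoeff, show Finset.Icc (0 : ℤ) 1 = {0, 1} from rfl, Finset.sum_pair zero_ne_one,
      hY.sym_zero, hY.sym_one, zeroCoef]
    simp only [sub_self, sub_zero, Int.toNat_zero, Int.toNat_one, Ring.choose_zero_right,
      Ring.choose_one_right, one_smul, sub_add_cancel]
    rfl
  refine ⟨fun k hk => hR.bound k hk, ?_, h₀, fun j => ?_, ?_⟩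
  · rw [deltaCoeff, Finset.Icc_self, Finset.sum_singleton, hY.sym_one]
    simp only [sub_self, Int.toNat_zero, Ring.choose_zero_right, one_smul]
    rfl
  · suffices H : IsFlowFn (deltaCoeff Y 1 (-(j : ℤ)) : coefAlg) by
      refine ⟨(h ^ j)⁻¹ • (deltaCoeff Y 1 (-(j : ℤ)) : Fn), H.smul _, ?_⟩
      rw [smul_inv_smul₀ (pow_ne_zero j hh)]
    rcases Nat.eq_zero_or_pos j with rfl | hj
    · rw [Nat.cast_zero, neg_zero, h₀]
      exact IsFlowFn.field
    · rw [← mem_flowIdeal, deltaCoeff]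
      refine flowIdeal.sum_mem fun m hm => ?_
      rw [Finset.mem_Icc] at hm
      rcases lt_or_ge m 0 with hm' | hm'
      · exact zsmul_mem (hY.sym_neg m hm') _
      -- Nonnegative powers of `E` contribute nothing to negative powers of `Δ`, so the constants in
      -- the leading terms do not spoil membership in `𝓕`.
      · obtain ⟨i, rfl⟩ := Int.eq_ofNat_of_zero_le hm'
        rw [show ((i : ℕ) : ℤ) = (i : ℤ) from rfl, Ring.choose_natCast,
          Nat.choose_eq_zero_of_lt (by omega), Nat.cast_zero, zero_smul]
        exact zero_mem _
  · have h₁ := (hR.dxOp fun k => (deltaCoeff Y 1 k).2).mono (M := 1 + 1) (by norm_num)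
    have h₂ := (represents_seriesA₁ h).commutator hR
    have h₃ : ⁅endOp dxDer.toLinearMap, Y⁆ = ⁅seriesA₁ h, Y⁆ := by
      rw [← sub_eq_zero, ← ring_sub_lie]
      exact hY.lie
    rw [h₃] at h₁
    exact h₁.unique h₂

/-- An element of the ideal, as an element of `𝓕`. -/
def ofIdeal (a : coefAlg) (ha : a ∈ flowIdeal) : flowFn := ⟨a, ha⟩

theorem toCoef_ofIdeal (a : coefAlg) (ha : a ∈ flowIdeal) : toCoef (ofIdeal a ha) = a := rfl

/-- The recursion for the coefficients of a Lax series: `h (∂ y - w y + y E ^ m w)`. -/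
noncomputable def laxStep (h : ℝ) (m : ℤ) (f : flowFn) : flowFn :=
  flowDeltaInv (ofIdeal (constCoef h * (dxDer (toCoef f) -
    (zeroCoef h * toCoef f - toCoef f * (shiftEquiv ^ m) (zeroCoef h))))
    (flowIdeal.mul_mem_left _ (sub_mem (dxDer_mem_flowIdeal (toCoef_mem f))
      (sub_mem (flowIdeal.mul_mem_left _ (toCoef_mem f))
        (flowIdeal.mul_mem_right _ (toCoef_mem f))))))

/-- The coefficients of negative order of a Lax series. -/
noncomputable def laxTail (h : ℝ) : ℕ → flowFn
  | 0 => flowDeltaInv (ofIdeal (constCoef h * dxDer (toCoef flowField))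
      (flowIdeal.mul_mem_left _ (dxDer_mem_flowIdeal (toCoef_mem flowField))))
  | j + 1 => laxStep h (-(j : ℤ) - 1) (laxTail h j)

/-- The coefficients of a Lax series. -/
noncomputable def laxSym (h : ℝ) : ℤ → coefAlg
  | Int.negSucc j => toCoef (laxTail h j)
  | Int.ofNat 0 => zeroCoef h
  | Int.ofNat (_ + 1) => constCoef h⁻¹

theorem laxSym_negSucc (h : ℝ) (j : ℕ) : laxSym h (-(j : ℤ) - 1) = toCoef (laxTail h j) := by
  rw [show -(j : ℤ) - 1 = Int.negSucc j by rw [Int.negSucc_eq]; ring]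
  rfl

theorem constCoef_inv_mul {h : ℝ} (hh : h ≠ 0) (a : coefAlg) :
    constCoef h⁻¹ * (constCoef h * a) = a := by
  rw [← mul_assoc, constCoef, constCoef, ← map_mul, inv_mul_cancel₀ hh, map_one, one_mul]

/-- The part of order `m` of `[∂ₓ - A₁, Y] = 0` prescribes `Δ` of the coefficient of order `m - 1`
in terms of the coefficient of order `m`. For `m ≤ 0` the right side is in `𝓕` and `Δ⁻¹` solves the
equation; orders `1` and `2` hold identically for the given leading terms. -/
theorem exists_isLaxSeries {h : ℝ} (hh : h ≠ 0) : ∃ Y, IsLaxSeries h Y := by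
  have hs : ∀ m ≤ 1, sym (ofSym shiftEquiv 1 (laxSym h)) m = laxSym h m := fun m hm => by
    rw [sym_ofSym, if_pos hm]
  have hs' : ∀ m > 1, sym (ofSym shiftEquiv 1 (laxSym h)) m = 0 := fun m hm => by
    rw [sym_ofSym, if_neg (by omega)]
  refine ⟨ofSym shiftEquiv 1 (laxSym h), isDiff_ofSym _ _, ordLE_ofSym _ _, hs 1 le_rfl,
    hs 0 zero_le_one, fun m hm => ?_, ?_⟩
  · rw [hs m (by omega), show m = -((-m - 1).toNat : ℤ) - 1 by omega, laxSym_negSucc]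
    exact toCoef_mem _
  · have hd : IsDiff shiftEquiv ⁅connection h, ofSym shiftEquiv 1 (laxSym h)⁆ := by
      rw [connection, ring_sub_lie]
      exact (isDiff_lie_endOp dxDer_shiftEquiv (isDiff_ofSym _ _)).sub
        ((represents_seriesA₁ h).isDiff.lie (isDiff_ofSym _ _))
    refine hd.ext (Z := 0) (fun m a => by simp [sym, Op.coeff_zero]) fun m => ?_
    refine (sym_lie_connection dxDer_shiftEquiv h⁻¹ (zeroCoef h) (isDiff_ofSym _ _) m).trans ?_
    change _ = 0
    rw [smul_eq_constCoef_mul]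
    rcases lt_or_ge 2 m with hm | hm
    · rw [hs' m (by omega), hs' (m - 1) (by omega)]
      simp
    rcases eq_or_ne m 2 with rfl | hm₂
    · rw [hs' 2 (by norm_num), hs (2 - 1) (by norm_num), show laxSym h (2 - 1) = constCoef h⁻¹ from rfl,
        shiftEquiv_constCoef]
      simp
    rcases eq_or_ne m 1 with rfl | hm₁
    · rw [hs 1 le_rfl, hs (1 - 1) (by norm_num), show laxSym h 1 = constCoef h⁻¹ from rfl,
        show laxSym h (1 - 1) = zeroCoef h from rfl, dxDer_constCoef, zpow_one]
      ring
    rcases eq_or_ne m 0 with rfl | hm₀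
    · rw [hs 0 zero_le_one, hs (0 - 1) (by norm_num), show laxSym h 0 = zeroCoef h from rfl,
        show laxSym h (0 - 1) = toCoef (laxTail h 0) from rfl, laxTail, shiftEquiv_sub_flowDeltaInv,
        toCoef_ofIdeal, constCoef_inv_mul hh, dxDer_zeroCoef, zpow_zero, AlgEquiv.one_apply]
      ring
    · obtain ⟨j, rfl⟩ : ∃ j : ℕ, m = -(j : ℤ) - 1 := ⟨(-m - 1).toNat, by omega⟩
      rw [hs _ (by omega), hs _ (by omega), laxSym_negSucc,
        show -(j : ℤ) - 1 - 1 = -((j + 1 : ℕ) : ℤ) - 1 by push_cast; ring, laxSym_negSucc, laxTail,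
        laxStep, shiftEquiv_sub_flowDeltaInv, toCoef_ofIdeal, constCoef_inv_mul hh]
      ring

theorem existsUnique_isLaxOperator {h : ℝ} (hh : h ≠ 0) : ∃! L : PsiDO, IsLaxOperator h L := by
  obtain ⟨Y, hY⟩ := exists_isLaxSeries hh
  refine ⟨_, hY.isLaxOperator hh, fun L hL => ?_⟩
  obtain ⟨Z, hZL, hZ⟩ := hL.exists_series
  have hR := represents_deltaCoeff hY.isDiff hY.ordLE
  rw [hY.unique hh hZ] at hR ⊢
  exact hZL.unique hR


/-! ### Powers of the Lax operator and the isospectral flows. -/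

theorem Represents.mem_coefAlg {N : ℤ} {Y : Op coefAlg} {P : PsiDO} (h : Represents N Y P) (k : ℤ) :
    P k ∈ coefAlg := by
  rw [h.unique (represents_deltaCoeff h.isDiff h.ordLE)]
  exact (deltaCoeff Y N k).2

theorem Represents.zeroCurvature {h : ℝ} {N : ℤ} {B : Op coefAlg} {P : PsiDO} {f : flowFn}
    (hB : Represents N B P) (hN : 0 ≤ N) (hf : ⁅connection h, B⁆ = mulBy (toCoef f)) :
    ZeroCurvature h P f := by
  have h₁ := ((hB.dxOp hB.mem_coefAlg).mono (M := 1 + N) (by omega)).sub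
    ((represents_seriesA₁ h).commutator hB)
  rw [← ring_sub_lie] at h₁
  change Represents _ ⁅connection h, B⁆ _ at h₁
  rw [hf] at h₁
  exact ((represents_mulBy (toCoef f)).mono (by omega)).unique h₁

/-- The coordinate `x` as a coefficient. -/
def coefX : coefAlg := ⟨coordX, coordX_mem⟩

/-- The coordinate `n` as a coefficient. -/
def coefN : coefAlg := ⟨coordN, coordN_mem⟩

theorem dxDer_coefX : dxDer coefX = 1 := Subtype.ext lift_dx_coordX

theorem dxDer_coefN : dxDer coefN = 0 := Subtype.ext (lift_dx_const fun n => (n : ℝ))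

theorem gateauxDer_coefX (g : flowFn) : gateauxDer g coefX = 0 :=
  Subtype.ext (gateaux_const (fun _ x => x) g)

theorem gateauxDer_coefN (g : flowFn) : gateauxDer g coefN = 0 :=
  Subtype.ext (gateaux_const (fun n _ => (n : ℝ)) g)

theorem shiftEquiv_zpow_coefX (m : ℤ) : (shiftEquiv ^ m) coefX = coefX :=
  Subtype.ext (coe_shiftEquiv_zpow m coefX)

theorem shiftEquiv_zpow_coefN (m : ℤ) : (shiftEquiv ^ m) coefN = coefN + constCoef m := by
  apply Subtype.ext
  rw [coe_shiftEquiv_zpow]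
  funext u n x
  change ((n + m : ℤ) : ℝ) = n + m
  push_cast
  rfl

theorem shiftEquiv_coefX : shiftEquiv coefX = coefX := shiftEquiv_zpow_coefX 1

theorem shiftEquiv_coefN : shiftEquiv coefN = coefN + 1 := by
  have := shiftEquiv_zpow_coefN 1
  rw [zpow_one, Int.cast_one] at this
  exact this.trans (by rw [constCoef, map_one])

theorem constCoef_mul_inv {h : ℝ} (hh : h ≠ 0) : constCoef h * constCoef h⁻¹ = 1 := by
  rw [constCoef, constCoef, ← map_mul, mul_inv_cancel₀ hh, map_one]

/-- The value of the Lax operator at `u = 0`. -/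
noncomputable def vacuum (h : ℝ) : Op coefAlg := h⁻¹ • (shiftOp shiftEquiv - 1)

theorem isDiff_vacuum (h : ℝ) : IsDiff shiftEquiv (vacuum h) :=
  (isDiff_shiftOp.sub isDiff_one).smul _

theorem nonNeg_vacuum (h : ℝ) : NonNeg (vacuum h) :=
  (nonNeg_shiftOp.sub (mulBy_one (A := coefAlg) ▸ nonNeg_mulBy 1)).smul _

theorem NonNeg.pow {Y : Op coefAlg} (hY : NonNeg Y) (s : ℕ) : NonNeg (Y ^ s) := by
  induction s with
  | zero => rw [pow_zero, ← mulBy_one]; exact nonNeg_mulBy 1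
  | succ s ih => rw [pow_succ]; exact ih.mul hY

theorem sym_vacuum (h : ℝ) (m : ℤ) : sym (vacuum h) m =
    constCoef h⁻¹ * ((if m = 1 then 1 else 0) - if m = 0 then 1 else 0) := by
  rw [vacuum, sym_smul, sym_sub, sym_shiftOp, ← mulBy_one, sym_mulBy, smul_eq_constCoef_mul]

/-- This is the value at `u = 0` of the coefficient of `E⁰` in `L^s`; removing it puts the gradient
`γ_s` in `𝓕`. -/
theorem sym_zero_vacuum_pow (h : ℝ) (s : ℕ) :
    sym (vacuum h ^ s) 0 = constCoef ((-h⁻¹) ^ s) := by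
  induction s with
  | zero => rw [pow_zero, pow_zero, ← mulBy_one, sym_mulBy, if_pos rfl, constCoef, map_one]
  | succ s ih =>
    rw [pow_succ, pow_succ, sym_zero_mul ((isDiff_vacuum h).pow s) ((nonNeg_vacuum h).pow s)
      (nonNeg_vacuum h), ih, sym_vacuum, constCoef, constCoef, constCoef, map_mul, map_neg]
    simp only [zero_ne_one, if_false, if_true]
    ring

theorem InIdeal.lie {I : Ideal coefAlg} {Y Z : Op coefAlg}
    (hI : ∀ (m : ℤ), ∀ a ∈ I, (shiftEquiv ^ m) a ∈ I) (hY : InIdeal shiftEquiv I Y)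
    (hZ : IsDiff shiftEquiv Z) : InIdeal shiftEquiv I ⁅Y, Z⁆ := by
  rw [Ring.lie_def]
  exact (hY.mul_right hZ).sub (hY.mul_left hI hZ)

theorem InIdeal.neg {I : Ideal coefAlg} {Y : Op coefAlg} (hY : InIdeal shiftEquiv I Y) :
    InIdeal shiftEquiv I (-Y) := by
  have := hY.smul (-1)
  rwa [neg_one_smul] at this

/-- Multiplication by a function that is invariant under the shift is central. -/
theorem lie_mulBy_eq_zero {a : coefAlg} (ha : ∀ m : ℤ, (shiftEquiv ^ m) a = a) {Y : Op coefAlg}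
    (hY : IsDiff shiftEquiv Y) : ⁅mulBy a, Y⁆ = 0 := by
  refine ((isDiff_mulBy a).lie hY).ext (Z := 0) (fun m a => by simp [sym, Op.coeff_zero])
    fun m => ?_
  rw [Ring.lie_def, sym_sub, sym_mulBy_mul, hY.sym_mul_mulBy, ha, mul_comm, sub_self]
  rfl

namespace IsLaxSeries

variable {h : ℝ} {Y : Op coefAlg}

/-- All of `L` except `h⁻¹ Δ` lies in `𝓕`. Comparison with this vacuum part is how expressions in
`L` are later shown to have coefficients in `𝓕`. -/
theorem inIdeal_sub_vacuum (hY : IsLaxSeries h Y) :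
    InIdeal shiftEquiv flowIdeal (Y - vacuum h) := by
  refine ⟨hY.isDiff.sub (isDiff_vacuum h), fun m => ?_⟩
  rw [sym_sub, sym_vacuum]
  rcases lt_trichotomy m 0 with hm | rfl | hm
  · rw [if_neg (by omega), if_neg (by omega), sub_zero, mul_zero, sub_zero]
    exact hY.sym_neg m hm
  · rw [hY.sym_zero, zeroCoef, if_neg (by omega), if_pos rfl,
      show toCoef flowField - constCoef h⁻¹ - constCoef h⁻¹ * (0 - 1) = toCoef flowField by ring]
    exact toCoef_mem _
  · rcases eq_or_ne m 1 with rfl | hm'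
    · rw [hY.sym_one, if_pos rfl, if_neg (by omega), sub_zero, mul_one, sub_self]
      exact zero_mem _
    · rw [hY.ordLE.sym_eq_zero (by omega), if_neg hm', if_neg (by omega), sub_zero, mul_zero,
        sub_zero]
      exact zero_mem _

theorem inIdeal_pow_sub_vacuum (hY : IsLaxSeries h Y) (s : ℕ) :
    InIdeal shiftEquiv flowIdeal (Y ^ s - vacuum h ^ s) := by
  induction s with
  | zero =>
    rw [pow_zero, pow_zero, sub_self]
    exact ⟨fun m a => by simp [sym, Op.coeff_zero], fun m => zero_mem _⟩
  | succ s ih =>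
    have : Y ^ (s + 1) - vacuum h ^ (s + 1) =
        Y ^ s * (Y - vacuum h) + (Y ^ s - vacuum h ^ s) * vacuum h := by
      rw [pow_succ, pow_succ]
      noncomm_ring
    rw [this]
    exact (hY.inIdeal_sub_vacuum.mul_left (fun m a ha => shiftEquiv_zpow_mem_flowIdeal m ha)
      (hY.isDiff.pow s)).add (ih.mul_right (isDiff_vacuum h))

theorem inIdeal_pos_pow_sub_vacuum (hY : IsLaxSeries h Y) (s : ℕ) :
    InIdeal shiftEquiv flowIdeal (pos (Y ^ s) - vacuum h ^ s) := by
  have h₁ := hY.inIdeal_pow_sub_vacuum s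
  refine ⟨(hY.isDiff.pow s).pos.sub ((isDiff_vacuum h).pow s), fun m => ?_⟩
  rw [sym_sub, sym_pos]
  split_ifs with hm
  · exact h₁.2 m
  · rw [((nonNeg_vacuum h).pow s).sym_eq_zero (by omega), sub_zero]
    exact zero_mem _

theorem sym_zero_pow_mem (hY : IsLaxSeries h Y) (s : ℕ) :
    sym (Y ^ s) 0 - constCoef ((-h⁻¹) ^ s) ∈ flowIdeal := by
  rw [← sym_zero_vacuum_pow]
  exact (hY.inIdeal_pow_sub_vacuum s).2 0

/-- The functions `γ_s = ∂ₓ⁻¹ K_s`. -/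
noncomputable def gradient (hY : IsLaxSeries h Y) (s : ℕ) : flowFn :=
  ofIdeal _ (hY.sym_zero_pow_mem s)

theorem toCoef_gradient (hY : IsLaxSeries h Y) (s : ℕ) :
    toCoef (hY.gradient s) = sym (Y ^ s) 0 - constCoef ((-h⁻¹) ^ s) := rfl

theorem residue_mem (hY : IsLaxSeries h Y) (s : ℕ) : sym (Y ^ s) (-1) ∈ flowIdeal := by
  have := (hY.inIdeal_pow_sub_vacuum s).2 (-1)
  rwa [sym_sub, ((nonNeg_vacuum h).pow s).sym_eq_zero (by norm_num), sub_zero] at this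

theorem lie_pow (hY : IsLaxSeries h Y) (s : ℕ) : ⁅connection h, Y ^ s⁆ = 0 := by
  induction s with
  | zero => simp [Ring.lie_def]
  | succ s ih =>
    have := ring_lie_mul (connection h) (Y ^ s) Y
    rwa [ih, hY.lie, mul_zero, zero_mul, add_zero, ← pow_succ] at this

/-- The isospectral flows `K_s`. -/
noncomputable def flow (hY : IsLaxSeries h Y) (s : ℕ) : flowFn := flowDx (hY.gradient s)

theorem toCoef_flowDx (f : flowFn) : toCoef (flowDx f) = dxDer (toCoef f) := rfl

theorem toCoef_flow (hY : IsLaxSeries h Y) (s : ℕ) :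
    toCoef (hY.flow s) = dxDer (sym (Y ^ s) 0) := by
  rw [flow, toCoef_flowDx, toCoef_gradient, map_sub, dxDer_constCoef, sub_zero]

/-- This is the order zero part of `[∂ₓ - A₁, L^s] = 0`; the terms with `u` cancel because
coefficients commute. -/
theorem toCoef_flow_eq_residue (hY : IsLaxSeries h Y) (s : ℕ) :
    toCoef (hY.flow s) =
      constCoef h⁻¹ * (shiftEquiv (sym (Y ^ s) (-1)) - sym (Y ^ s) (-1)) := by
  have h₁ : sym ⁅connection h, Y ^ s⁆ 0 = _ := sym_lie_connection dxDer_shiftEquiv h⁻¹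
    (zeroCoef h) (hY.isDiff.pow s) 0
  rw [hY.lie_pow, zpow_zero, AlgEquiv.one_apply, mul_comm (zeroCoef h), sub_self, add_zero,
    smul_eq_constCoef_mul] at h₁
  rw [toCoef_flow, ← sub_eq_zero]
  exact h₁.symm

/-- The coefficient of `E⁻¹` lies in `𝓕`, so the preceding difference equation can be inverted. This
identifies the summand `h Δ⁻¹ K_s` of `ω'[K_s]` inside the commutator with `B₂`. -/
theorem constCoef_mul_flowDeltaInv_flow (hh : h ≠ 0) (hY : IsLaxSeries h Y) (s : ℕ) :
    constCoef h * toCoef (flowDeltaInv (hY.flow s)) = sym (Y ^ s) (-1) := by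
  have h₁ : flowDeltaInv (hY.flow s) = ofIdeal (constCoef h⁻¹ * sym (Y ^ s) (-1))
      (flowIdeal.mul_mem_left _ (hY.residue_mem s)) := by
    apply flowDeltaInv_eq
    rw [toCoef_flow_eq_residue, toCoef_ofIdeal, map_mul, shiftEquiv_constCoef, mul_sub]
  rw [h₁, toCoef_ofIdeal, ← mul_assoc, constCoef_mul_inv hh, one_mul]

theorem nonNeg_seriesA₁ (h : ℝ) : NonNeg (seriesA₁ h) :=
  (nonNeg_shiftOp.smul _).add (nonNeg_mulBy _)

theorem ordLE_connection (h : ℝ) : OrdLE 1 (connection h) :=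
  ((ordLE_endOp _).mono zero_le_one).sub (represents_seriesA₁ h).ordLE

/-- The commutator of the connection with a nonnegative operator, in order zero. -/
theorem sym_zero_lie_connection {B : Op coefAlg} (hB : IsDiff shiftEquiv B) (hB' : NonNeg B) :
    sym ⁅connection h, B⁆ 0 = dxDer (sym B 0) := by
  have h₁ : sym ⁅connection h, B⁆ 0 = _ :=
    sym_lie_connection dxDer_shiftEquiv h⁻¹ (zeroCoef h) hB 0
  rw [h₁, hB'.sym_eq_zero (show (0 : ℤ) - 1 < 0 by norm_num), map_zero, sub_zero, smul_zero, zpow_zero,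
    AlgEquiv.one_apply, mul_comm, sub_self, add_zero, sub_zero]

theorem isDiff_lie_connection {B : Op coefAlg} (hB : IsDiff shiftEquiv B) :
    IsDiff shiftEquiv ⁅connection h, B⁆ := by
  rw [connection, ring_sub_lie]
  exact (isDiff_lie_endOp dxDer_shiftEquiv hB).sub ((represents_seriesA₁ h).isDiff.lie hB)

theorem nonNeg_connection (h : ℝ) : NonNeg (connection h) :=
  (nonNeg_endOp _).sub (nonNeg_seriesA₁ h)

/-- The zero curvature representation of the isospectral flows. -/
theorem lie_connection_pos_pow (hY : IsLaxSeries h Y) (s : ℕ) :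
    ⁅connection h, pos (Y ^ s)⁆ = mulBy (toCoef (hY.flow s)) := by
  have hd : IsDiff shiftEquiv (pos (Y ^ s)) := (hY.isDiff.pow s).pos
  -- The left side has no negative orders and the right side no positive ones, so only order zero
  -- survives.
  have h₁ : ⁅connection h, pos (Y ^ s)⁆ = -⁅connection h, Y ^ s - pos (Y ^ s)⁆ := by
    rw [ring_lie_sub, hY.lie_pow, zero_sub, neg_neg]
  refine (isDiff_lie_connection hd).ext (isDiff_mulBy _) fun m => ?_
  rw [sym_mulBy]
  rcases lt_trichotomy m 0 with hm | rfl | hm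
  · rw [if_neg (by omega), ((nonNeg_connection h).lie (nonNeg_pos _)).sym_eq_zero hm]
  · rw [if_pos rfl, sym_zero_lie_connection hd (nonNeg_pos _), sym_pos, if_pos le_rfl, toCoef_flow]
  · rw [if_neg (by omega), h₁, DKP.sym_neg,
      ((ordLE_connection h).lie (ordLE_sub_pos (Y ^ s))).sym_eq_zero (by omega), neg_zero]

/-- In `∂ₓ - A₁` only the term `u` varies with the field, and its derivative is the direction
itself. -/
theorem lie_gateauxDer_connection (h : ℝ) (g : flowFn) :
    ⁅endOp (gateauxDer g).toLinearMap, connection h⁆ = -mulBy (toCoef g) := by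
  have h₁ : ⁅endOp (gateauxDer g).toLinearMap, h⁻¹ • shiftOp shiftEquiv⁆ = 0 := by
    have := lie_endOp_shiftOp (gateauxDer_shiftEquiv g)
    rw [Ring.lie_def] at this ⊢
    rw [mul_smul_comm, smul_mul_assoc, ← smul_sub, this, smul_zero]
  rw [connection, seriesA₁, ring_lie_sub, ring_lie_add, lie_endOp_endOp (gateauxDer_dxDer g), h₁,
    lie_endOp_mulBy, gateauxDer_zeroCoef, zero_add, zero_sub]

/-- The derivative of the Lax operator along a flow with a zero curvature representation. -/
theorem lie_gateauxDer_eq (hh : h ≠ 0) (hY : IsLaxSeries h Y) {B T : Op coefAlg} {g : flowFn}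
    (hB : ⁅connection h, B⁆ = mulBy (toCoef g)) (hT : ⁅connection h, T⁆ = 0)
    (hI : InIdeal shiftEquiv flowIdeal (⁅B, Y⁆ + T)) :
    ⁅endOp (gateauxDer g).toLinearMap, Y⁆ = ⁅B, Y⁆ + T := by
  rw [← sub_eq_zero]
  refine eq_zero_of_lie_connection_eq_zero dxDer_shiftEquiv (inv_ne_zero hh) (w := zeroCoef h)
    (I := flowIdeal) (fun a ha e => eq_zero_of_shiftEquiv_eq ha e) (InIdeal.sub ⟨?_, ?_⟩ hI) ?_
  · exact isDiff_lie_endOp (gateauxDer_shiftEquiv g) hY.isDiff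
  · intro m
    rw [sym_lie_endOp (gateauxDer_shiftEquiv g) hY.isDiff]
    exact gateauxDer_mem_flowIdeal g _
  -- By the Jacobi identity, bracketing the connection with `L'[g]` and with `[B, L]` gives `[g, L]`
  -- in both cases, and `T` commutes with the connection by assumption.
  · change ⁅connection h, _⁆ = 0
    rw [ring_lie_sub, ring_lie_add, ring_lie_lie (connection h) (endOp _),
      ring_lie_lie (connection h) B, hB, hT, hY.lie,
      ring_lie_skew (connection h), lie_gateauxDer_connection, neg_neg]
    simp [Ring.lie_def]

/-- At `u = 0` the commutator is one of powers of the vacuum operator, which vanishes; the rest is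
built from differences with coefficients in `𝓕`. -/
theorem lie_pos_pow_inIdeal (hY : IsLaxSeries h Y) (s : ℕ) :
    InIdeal shiftEquiv flowIdeal ⁅pos (Y ^ s), Y⁆ := by
  have hI : ∀ (m : ℤ), ∀ a ∈ flowIdeal, (shiftEquiv ^ m) a ∈ flowIdeal :=
    fun m a ha => shiftEquiv_zpow_mem_flowIdeal m ha
  have : ⁅pos (Y ^ s), Y⁆ = ⁅pos (Y ^ s) - vacuum h ^ s, Y⁆ + -⁅Y - vacuum h, vacuum h ^ s⁆ := by
    have : Commute (vacuum h) (vacuum h ^ s) := (Commute.refl _).pow_right s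
    rw [ring_sub_lie, ring_sub_lie, Ring.lie_def (vacuum h), this.eq, ring_lie_skew Y]
    abel
  rw [this]
  exact ((hY.inIdeal_pos_pow_sub_vacuum s).lie hI hY.isDiff).add
    (hY.inIdeal_sub_vacuum.lie hI ((isDiff_vacuum h).pow s)).neg

theorem lie_gateauxDer_flow (hh : h ≠ 0) (hY : IsLaxSeries h Y) (s : ℕ) :
    ⁅endOp (gateauxDer (hY.flow s)).toLinearMap, Y⁆ = ⁅pos (Y ^ s), Y⁆ := by
  have := hY.lie_gateauxDer_eq hh (T := 0) (hY.lie_connection_pos_pow s) (by simp [Ring.lie_def])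
    (by rw [add_zero]; exact hY.lie_pos_pow_inIdeal s)
  rwa [add_zero] at this

/-- The bracket with `X` is a derivation and its value on `Y` commutes with `Y`, so it acts on
powers like the vector field `(c y² + y) d/dy`. -/
theorem lie_pow_of_lie_eq {c : ℝ} {X : Op coefAlg} (hX : ⁅X, Y⁆ = c • Y ^ 2 + Y) (s : ℕ) :
    ⁅X, Y ^ s⁆ = (s : ℝ) • (c • Y ^ (s + 1) + Y ^ s) := by
  induction s with
  | zero => simp [Ring.lie_def]
  | succ s ih =>
    have e : ⁅X, Y ^ (s + 1)⁆ = ⁅X, Y ^ s⁆ * Y + Y ^ s * ⁅X, Y⁆ := by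
      rw [pow_succ, ring_lie_mul]
    rw [e, ih, hX, smul_mul_assoc, add_mul, smul_mul_assoc, ← pow_succ, ← pow_succ, mul_add,
      mul_smul_comm, ← pow_add, ← pow_succ]
    push_cast
    module

theorem lie_pow_of_lie_eq_zero {X : Op coefAlg} (hX : ⁅X, Y⁆ = 0) (s : ℕ) : ⁅X, Y ^ s⁆ = 0 := by
  have : Commute X Y := sub_eq_zero.mp hX
  exact sub_eq_zero.mpr (this.pow_right s)

/-- The derivative of the coefficient of order zero along an isospectral flow. -/
theorem gateauxDer_flow_sym_sq (hh : h ≠ 0) (hY : IsLaxSeries h Y) (s : ℕ) :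
    gateauxDer (hY.flow s) (sym (Y ^ 2) 0) =
      sym ⁅pos (Y ^ 2), Y ^ s - pos (Y ^ s)⁆ 0 := by
  have h₁ : ⁅endOp (gateauxDer (hY.flow s)).toLinearMap - pos (Y ^ s), Y ^ 2⁆ = 0 := by
    apply lie_pow_of_lie_eq_zero
    rw [ring_sub_lie, hY.lie_gateauxDer_flow hh, sub_self]
  -- Since `L²` and `L^s` commute, the positive part of `L^s` may be traded for minus its negative
  -- part. The bracket of the two negative parts has order at most `-2` and is invisible in order
  -- zero.
  have h₂ : ⁅pos (Y ^ s), Y ^ 2⁆ = ⁅pos (Y ^ 2), Y ^ s - pos (Y ^ s)⁆ +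
      ⁅Y ^ 2 - pos (Y ^ 2), Y ^ s - pos (Y ^ s)⁆ := by
    have : Commute (Y ^ 2) (Y ^ s) := ((Commute.refl Y).pow_right s).pow_left 2
    rw [← ring_add_lie, add_sub_cancel, ring_lie_sub, Ring.lie_def (Y ^ 2) (Y ^ s), this.eq, sub_self,
      zero_sub, ring_lie_skew]
  rw [ring_sub_lie, sub_eq_zero, h₂] at h₁
  rw [← sym_lie_endOp (gateauxDer_shiftEquiv _) (hY.isDiff.pow 2), h₁, sym_add,
    ((ordLE_sub_pos (Y ^ 2)).lie (ordLE_sub_pos (Y ^ s))).sym_eq_zero (by norm_num), add_zero]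

end IsLaxSeries


/-! ### The non-isospectral flow and the recursion for the gradients. -/

namespace IsLaxSeries

variable {h : ℝ} {Y : Op coefAlg}

theorem sym_seriesA₁ (h : ℝ) (m : ℤ) : sym (seriesA₁ h) m =
    (if m = 1 then constCoef h⁻¹ else 0) + if m = 0 then zeroCoef h else 0 := by
  rw [seriesA₁, sym_add, sym_smul, sym_shiftOp, sym_mulBy, smul_eq_constCoef_mul]
  congr 1
  split_ifs
  · rw [mul_one]
  · rw [mul_zero]

theorem pos_self (hY : IsLaxSeries h Y) : pos Y = seriesA₁ h := by
  refine hY.isDiff.pos.ext (represents_seriesA₁ h).isDiff fun m => ?_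
  rw [sym_pos, sym_seriesA₁]
  rcases lt_trichotomy m 0 with hm | rfl | hm
  · rw [if_neg (by omega), if_neg (by omega), if_neg (by omega), add_zero]
  · rw [if_pos le_rfl, if_neg (by omega), if_pos rfl, zero_add, hY.sym_zero]
  · rcases eq_or_ne m 1 with rfl | hm'
    · rw [if_pos zero_le_one, if_pos rfl, if_neg (by omega), add_zero, hY.sym_one]
    · rw [if_pos (by omega), if_neg hm', if_neg (by omega), add_zero,
        hY.ordLE.sym_eq_zero (by omega)]

theorem sym_sq (hY : IsLaxSeries h Y) (m : ℤ) : sym (Y ^ 2) m =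
    ∑ i ∈ Finset.Icc (m - 1) 1, sym Y i * (shiftEquiv ^ i) (sym Y (m - i)) := by
  rw [sq, sym_mul hY.isDiff hY.ordLE hY.ordLE]

theorem sym_sq_two (hY : IsLaxSeries h Y) :
    sym (Y ^ 2) 2 = constCoef h⁻¹ * constCoef h⁻¹ := by
  rw [hY.sym_sq, show Finset.Icc ((2 : ℤ) - 1) 1 = {1} from rfl, Finset.sum_singleton,
    show (2 : ℤ) - 1 = 1 by norm_num, hY.sym_one, shiftEquiv_zpow_constCoef]

theorem sym_sq_one (hY : IsLaxSeries h Y) : sym (Y ^ 2) 1 =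
    constCoef h⁻¹ * (shiftEquiv (zeroCoef h) + zeroCoef h) := by
  rw [hY.sym_sq, show Finset.Icc ((1 : ℤ) - 1) 1 = {0, 1} from rfl, Finset.sum_pair zero_ne_one,
    sub_zero, sub_self, hY.sym_one, hY.sym_zero, shiftEquiv_zpow_constCoef, zpow_one]
  ring

theorem sym_sq_zero (hY : IsLaxSeries h Y) : sym (Y ^ 2) 0 =
    constCoef h⁻¹ * (shiftEquiv (sym Y (-1)) + sym Y (-1)) + zeroCoef h * zeroCoef h := by
  rw [hY.sym_sq, show Finset.Icc ((0 : ℤ) - 1) 1 = {-1, 0, 1} from rfl,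
    Finset.sum_insert (by simp), Finset.sum_pair zero_ne_one, sub_neg_eq_add, zero_add, sub_zero,
    zero_sub,
    hY.sym_one, hY.sym_zero, shiftEquiv_zpow_constCoef, zpow_one, zpow_zero, AlgEquiv.one_apply]
  ring

theorem toCoef_injective {f g : flowFn} (e : toCoef f = toCoef g) : f = g :=
  Subtype.ext (congrArg (fun a : coefAlg => (a : Fn)) e)

theorem gradient_one (hY : IsLaxSeries h Y) : hY.gradient 1 = flowField := by
  apply toCoef_injective
  rw [toCoef_gradient, pow_one, pow_one, hY.sym_zero, zeroCoef, constCoef, constCoef, map_neg]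
  ring

theorem residue_one (hh : h ≠ 0) (hY : IsLaxSeries h Y) :
    sym Y (-1) = constCoef h * toCoef (flowDeltaInv (flowDx flowField)) := by
  have := hY.constCoef_mul_flowDeltaInv_flow hh 1
  rw [pow_one, flow, gradient_one] at this
  exact this.symm

/-- `γ₂ = u² + u_x + 2 Δ⁻¹ u_x - 2 h⁻¹ u`. -/
theorem toCoef_gradient_two (hh : h ≠ 0) (hY : IsLaxSeries h Y) : toCoef (hY.gradient 2) =
    toCoef flowField * toCoef flowField + toCoef (flowDx flowField) +
      2 * toCoef (flowDeltaInv (flowDx flowField)) - 2 * (constCoef h⁻¹ * toCoef flowField) := by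
  have h₁ := shiftEquiv_sub_flowDeltaInv (flowDx flowField)
  have h₂ := constCoef_mul_inv hh
  rw [toCoef_gradient, hY.sym_sq_zero, hY.residue_one hh, map_mul, shiftEquiv_constCoef, zeroCoef,
    show constCoef ((-h⁻¹) ^ 2) = constCoef h⁻¹ * constCoef h⁻¹ by
      rw [neg_sq, sq, constCoef, map_mul]; rfl]
  linear_combination h₁ + (shiftEquiv (toCoef (flowDeltaInv (flowDx flowField))) +
    toCoef (flowDeltaInv (flowDx flowField))) * h₂

/-- The operator `B₂` as a series. -/
noncomputable def seriesB₂ (h : ℝ) (Y : Op coefAlg) : Op coefAlg :=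
  mulBy (constCoef h * coefX) * pos (Y ^ 2) + mulBy (coefX + constCoef h * coefN) * pos (Y ^ 1) +
    mulBy (toCoef (h • flowDeltaInv flowField))

theorem represents_seriesB₂ {L : PsiDO} (hYL : Represents 1 Y L) :
    Represents 2 (seriesB₂ h Y) (opB₂ h L) := by
  have h₁ := (hYL.pow 2).pos.mulBy_mul (constCoef h * coefX)
  have h₂ := ((hYL.pow 1).pos.mono (M := 2) (by norm_num)).mulBy_mul
    (coefX + constCoef h * coefN)
  exact (h₁.add h₂).add ((represents_mulBy (toCoef (h • flowDeltaInv flowField))).mono (by norm_num))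

theorem isDiff_seriesB₂ (hY : IsLaxSeries h Y) : IsDiff shiftEquiv (seriesB₂ h Y) :=
  (((isDiff_mulBy _).mul (hY.isDiff.pow 2).pos).add
    ((isDiff_mulBy _).mul (hY.isDiff.pow 1).pos)).add (isDiff_mulBy _)

theorem nonNeg_seriesB₂ (h : ℝ) (Y : Op coefAlg) : NonNeg (seriesB₂ h Y) :=
  (((nonNeg_mulBy _).mul (nonNeg_pos _)).add ((nonNeg_mulBy _).mul (nonNeg_pos _))).add
    (nonNeg_mulBy _)

/-- `ω = ∂ₓ⁻¹ σ₂ = h x γ₂ + (x + h n) u + h Δ⁻¹ u`. -/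
noncomputable def potential (hY : IsLaxSeries h Y) : flowFn :=
  ofIdeal (constCoef h * coefX * toCoef (hY.gradient 2) +
    (coefX + constCoef h * coefN) * toCoef flowField + toCoef (h • flowDeltaInv flowField))
    (add_mem (add_mem (flowIdeal.mul_mem_left _ (toCoef_mem _))
      (flowIdeal.mul_mem_left _ (toCoef_mem _))) (toCoef_mem _))

theorem toCoef_potential (hY : IsLaxSeries h Y) : toCoef hY.potential =
    constCoef h * coefX * toCoef (hY.gradient 2) +
      (coefX + constCoef h * coefN) * toCoef flowField + toCoef (h • flowDeltaInv flowField) := rfl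

theorem sym_seriesB₂ (hY : IsLaxSeries h Y) (m : ℤ) : sym (seriesB₂ h Y) m =
    constCoef h * coefX * (if 0 ≤ m then sym (Y ^ 2) m else 0) + (coefX + constCoef h * coefN) *
      ((if m = 1 then constCoef h⁻¹ else 0) + if m = 0 then zeroCoef h else 0) +
      if m = 0 then toCoef (h • flowDeltaInv flowField) else 0 := by
  rw [seriesB₂, pow_one, hY.pos_self, sym_add, sym_add, sym_mulBy_mul, sym_mulBy_mul, sym_mulBy,
    sym_pos, sym_seriesA₁]

/-- The non-isospectral flow `σ₂`. -/
noncomputable def flowσ₂ (hY : IsLaxSeries h Y) : flowFn := flowDx hY.potential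

theorem toCoef_smul (c : ℝ) (f : flowFn) : toCoef (c • f) = constCoef c * toCoef f :=
  smul_eq_constCoef_mul c (toCoef f)

/-- At `u = 0` the coefficient is `h x h⁻² - (x + h n) h⁻¹ = -n`: the terms in `x` cancel and `∂ₓ`
kills what remains, so `σ₂ = ∂ₓ ω`. -/
theorem sym_zero_seriesB₂ (hh : h ≠ 0) (hY : IsLaxSeries h Y) :
    sym (seriesB₂ h Y) 0 = toCoef hY.potential - coefN := by
  rw [hY.sym_seriesB₂, if_pos le_rfl, if_neg (by omega), if_pos rfl, if_pos rfl, toCoef_potential,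
    toCoef_gradient, zeroCoef, show constCoef ((-h⁻¹) ^ 2) = constCoef h⁻¹ * constCoef h⁻¹ by
      rw [neg_sq, sq, constCoef, map_mul]; rfl]
  linear_combination (coefX * constCoef h⁻¹ - coefN) * constCoef_mul_inv hh

theorem sym_sq_eq_zero (hY : IsLaxSeries h Y) {m : ℤ} (hm : 2 < m) : sym (Y ^ 2) m = 0 := by
  have : OrdLE 2 (Y ^ 2) := by
    rw [sq]
    exact hY.ordLE.mul hY.ordLE
  exact this.sym_eq_zero hm

/-- This is what the term `h Δ⁻¹ u` of `B₂` is for. With `w = u - h⁻¹`, the `x`-derivatives of `h x`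
and `x` leave `(E w + w) + h⁻¹`, the shift of `h n` removes `E w`, and the remaining `u` is
cancelled by `h⁻¹ Δ (h Δ⁻¹ u)`. -/
theorem sym_one_lie_connection_seriesB₂ (hh : h ≠ 0) (hY : IsLaxSeries h Y) :
    sym ⁅connection h, seriesB₂ h Y⁆ 1 = 0 := by
  have e₁ : sym ⁅connection h, Y ^ 2⁆ 1 = _ :=
    sym_lie_connection dxDer_shiftEquiv h⁻¹ (zeroCoef h) (hY.isDiff.pow 2) 1
  have e₂ : sym ⁅connection h, seriesB₂ h Y⁆ 1 = _ :=
    sym_lie_connection dxDer_shiftEquiv h⁻¹ (zeroCoef h) hY.isDiff_seriesB₂ 1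
  have e₃ : sym (seriesB₂ h Y) 1 = constCoef h * coefX * sym (Y ^ 2) 1 +
      (coefX + constCoef h * coefN) * constCoef h⁻¹ := by
    rw [hY.sym_seriesB₂, if_pos zero_le_one, if_pos rfl, if_neg one_ne_zero, if_neg one_ne_zero,
      add_zero, add_zero]
  have e₄ : sym (seriesB₂ h Y) 0 = constCoef h * coefX * sym (Y ^ 2) 0 +
      (coefX + constCoef h * coefN) * zeroCoef h + constCoef h * toCoef (flowDeltaInv flowField) := by
    rw [hY.sym_seriesB₂, if_pos le_rfl, if_neg zero_ne_one, if_pos rfl, if_pos rfl, zero_add,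
      toCoef_smul]
  have e₅ := shiftEquiv_sub_flowDeltaInv flowField
  have e₆ : toCoef flowField = zeroCoef h + constCoef h⁻¹ := by rw [zeroCoef, sub_add_cancel]
  have e₇ : dxDer (sym (seriesB₂ h Y) 1) = constCoef h * sym (Y ^ 2) 1 +
      constCoef h * coefX * dxDer (sym (Y ^ 2) 1) + constCoef h⁻¹ := by
    rw [e₃, map_add, dxDer.leibniz, dxDer.leibniz, dxDer.leibniz, map_add, dxDer.leibniz,
      dxDer_constCoef, dxDer_constCoef, dxDer_coefX, dxDer_coefN]
    simp only [smul_eq_mul, mul_zero, add_zero, zero_add, mul_one]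
    ring
  have e₈ : shiftEquiv (sym (seriesB₂ h Y) 0) = constCoef h * coefX * shiftEquiv (sym (Y ^ 2) 0) +
      (coefX + constCoef h * (coefN + 1)) * shiftEquiv (zeroCoef h) +
        constCoef h * shiftEquiv (toCoef (flowDeltaInv flowField)) := by
    rw [e₄]
    simp only [map_add, map_mul, shiftEquiv_coefX, shiftEquiv_constCoef, shiftEquiv_coefN]
  rw [hY.lie_pow, smul_eq_constCoef_mul, zpow_one, sub_self] at e₁
  change 0 = _ at e₁
  rw [e₂, smul_eq_constCoef_mul, zpow_one, sub_self, e₈, e₇, e₄, e₃]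
  have e₉ := constCoef_mul_inv hh
  have e₀ := hY.sym_sq_one
  rw [e₆] at e₅
  clear e₂ e₃ e₄ e₆ e₇ e₈
  generalize sym (Y ^ 2) 1 = y at *
  generalize sym (Y ^ 2) 0 = z at *
  generalize toCoef (flowDeltaInv flowField) = q at *
  generalize zeroCoef h = w at *
  linear_combination (-constCoef h * coefX) * e₁ + constCoef h * e₀ -
    constCoef h⁻¹ * constCoef h * e₅ - constCoef h⁻¹ * e₉

/-- The `x`-derivative of `h x` contributes `h · h⁻²` and the shift of `h n` contributes `-h⁻¹`; the
rest is `h x` times a coefficient of `[∂ₓ - A₁, L²] = 0`. -/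
theorem sym_two_lie_connection_seriesB₂ (hY : IsLaxSeries h Y) :
    sym ⁅connection h, seriesB₂ h Y⁆ 2 = 0 := by
  have e₁ : sym ⁅connection h, Y ^ 2⁆ 2 = _ :=
    sym_lie_connection dxDer_shiftEquiv h⁻¹ (zeroCoef h) (hY.isDiff.pow 2) 2
  have e₂ : sym ⁅connection h, seriesB₂ h Y⁆ 2 = _ :=
    sym_lie_connection dxDer_shiftEquiv h⁻¹ (zeroCoef h) hY.isDiff_seriesB₂ 2
  have e₃ : sym (seriesB₂ h Y) 2 = constCoef h * coefX * sym (Y ^ 2) 2 := by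
    rw [hY.sym_seriesB₂, if_pos zero_le_two, if_neg (by norm_num), if_neg two_ne_zero,
      if_neg two_ne_zero, add_zero, add_zero, mul_zero, add_zero]
  have e₄ : sym (seriesB₂ h Y) 1 = constCoef h * coefX * sym (Y ^ 2) 1 +
      (coefX + constCoef h * coefN) * constCoef h⁻¹ := by
    rw [hY.sym_seriesB₂, if_pos zero_le_one, if_pos rfl, if_neg one_ne_zero, if_neg one_ne_zero,
      add_zero, add_zero]
  have e₅ : dxDer (sym (seriesB₂ h Y) 2) = constCoef h * sym (Y ^ 2) 2 := by
    rw [e₃, hY.sym_sq_two, dxDer.leibniz, dxDer.leibniz, dxDer.leibniz, dxDer_constCoef,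
      dxDer_constCoef, dxDer_coefX]
    simp only [smul_eq_mul, mul_zero, add_zero, zero_add, mul_one]
    ring
  have e₆ : shiftEquiv (sym (seriesB₂ h Y) 1) = constCoef h * coefX * shiftEquiv (sym (Y ^ 2) 1) +
      (coefX + constCoef h * (coefN + 1)) * constCoef h⁻¹ := by
    rw [e₄]
    simp only [map_add, map_mul, shiftEquiv_coefX, shiftEquiv_constCoef, shiftEquiv_coefN]
  have e₇ : dxDer (sym (Y ^ 2) 2) = 0 := by
    rw [hY.sym_sq_two, dxDer.leibniz, dxDer_constCoef, smul_zero, add_zero]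
  have e₈ := hY.sym_sq_two
  rw [hY.lie_pow, smul_eq_constCoef_mul, show (2 : ℤ) - 1 = 1 by norm_num, e₇] at e₁
  change 0 = _ at e₁
  rw [e₂, smul_eq_constCoef_mul, show (2 : ℤ) - 1 = 1 by norm_num, e₆, e₅, e₄, e₃]
  clear e₂ e₃ e₄ e₅ e₆ e₇
  generalize sym (Y ^ 2) 2 = y at *
  generalize sym (Y ^ 2) 1 = z at *
  generalize zeroCoef h = w at *
  generalize (shiftEquiv ^ (2 : ℤ)) w = v at *
  linear_combination (-constCoef h * coefX) * e₁ + constCoef h * e₈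

/-- The zero curvature representation of the non-isospectral flow. -/
theorem lie_connection_seriesB₂ (hh : h ≠ 0) (hY : IsLaxSeries h Y) :
    ⁅connection h, seriesB₂ h Y⁆ = mulBy (toCoef hY.flowσ₂) := by
  have hd := hY.isDiff_seriesB₂
  have hnn := nonNeg_seriesB₂ h Y
  refine (isDiff_lie_connection hd).ext (isDiff_mulBy _) fun m => ?_
  rw [sym_mulBy]
  rcases lt_trichotomy m 0 with hm | rfl | hm
  · rw [if_neg (by omega), ((nonNeg_connection h).lie hnn).sym_eq_zero hm]
  · rw [if_pos rfl, sym_zero_lie_connection hd hnn, hY.sym_zero_seriesB₂ hh, map_sub, dxDer_coefN,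
      sub_zero]
    rfl
  rw [if_neg (by omega)]
  obtain rfl | rfl | hm₃ : m = 1 ∨ m = 2 ∨ 3 ≤ m := by omega
  · exact hY.sym_one_lie_connection_seriesB₂ hh
  · exact hY.sym_two_lie_connection_seriesB₂
  refine (sym_lie_connection dxDer_shiftEquiv h⁻¹ (zeroCoef h) hd m).trans ?_
  rw [smul_eq_constCoef_mul, hY.sym_seriesB₂, hY.sym_seriesB₂, if_pos hm.le, if_neg hm.ne',
    if_neg hm.ne', if_pos (by omega : 0 ≤ m - 1), hY.sym_sq_eq_zero (by omega : 2 < m),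
    if_neg (by omega), if_neg (by omega), if_neg (by omega), if_neg (by omega)]
  rcases hm₃.lt_or_eq with hm₃ | rfl
  · rw [hY.sym_sq_eq_zero (by omega)]
    simp
  · rw [show (3 : ℤ) - 1 = 2 by norm_num, hY.sym_sq_two]
    simp [shiftEquiv_coefX, shiftEquiv_constCoef]

/-- `[B₂, L] + h L² + L` has coefficients in `𝓕`. -/
theorem inIdeal_lie_seriesB₂ (hh : h ≠ 0) (hY : IsLaxSeries h Y) :
    InIdeal shiftEquiv flowIdeal (⁅seriesB₂ h Y, Y⁆ + (h • Y ^ 2 + Y)) := by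
  have hI : ∀ (m : ℤ), ∀ a ∈ flowIdeal, (shiftEquiv ^ m) a ∈ flowIdeal :=
    fun m a ha => shiftEquiv_zpow_mem_flowIdeal m ha
  -- The value of `B₂` at `u = 0`.
  set V := mulBy (constCoef h * coefX) * vacuum h ^ 2 +
    mulBy (coefX + constCoef h * coefN) * vacuum h ^ 1 with hV
  have hVd : IsDiff shiftEquiv V := ((isDiff_mulBy _).mul ((isDiff_vacuum h).pow 2)).add
    ((isDiff_mulBy _).mul ((isDiff_vacuum h).pow 1))
  have h₁ : InIdeal shiftEquiv flowIdeal (seriesB₂ h Y - V) := by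
    have : seriesB₂ h Y - V = mulBy (constCoef h * coefX) * (pos (Y ^ 2) - vacuum h ^ 2) +
        mulBy (coefX + constCoef h * coefN) * (pos (Y ^ 1) - vacuum h ^ 1) +
        mulBy (toCoef (h • flowDeltaInv flowField)) := by
      rw [seriesB₂, hV]
      noncomm_ring
    rw [this]
    exact (((hY.inIdeal_pos_pow_sub_vacuum 2).mul_left hI (isDiff_mulBy _)).add
      ((hY.inIdeal_pos_pow_sub_vacuum 1).mul_left hI (isDiff_mulBy _))).add
      (inIdeal_mulBy (toCoef_mem _))
  -- Write `L₀` for the vacuum operator. Only `n` fails to commute with it, `[x + h n, L₀] = -E =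
  -- -(h L₀ + 1)`, whence `[V, L₀] = -(h L₀² + L₀)`. This is the origin of the extra term `h L² +
  -- L`.
  have h₂ : ⁅V, vacuum h⁆ + (h • vacuum h ^ 2 + vacuum h) = 0 := by
    have e₁ : ⁅mulBy (constCoef h * coefX), vacuum h⁆ = 0 := by
      refine lie_mulBy_eq_zero (fun m => ?_) (isDiff_vacuum h)
      rw [map_mul, shiftEquiv_zpow_coefX, shiftEquiv_zpow_constCoef]
    have e₂ : ⁅mulBy (coefX + constCoef h * coefN), vacuum h⁆ = -shiftOp shiftEquiv := by
      have e₃ : mulBy (shiftEquiv (coefX + constCoef h * coefN)) =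
          mulBy (coefX + constCoef h * coefN) + h • (1 : Op coefAlg) := by
        rw [← mulBy_one, ← mulBy_smul, ← mulBy_add, smul_eq_constCoef_mul, map_add, map_mul,
          shiftEquiv_coefX, shiftEquiv_constCoef, shiftEquiv_coefN]
        congr 1
        ring
      rw [vacuum, Ring.lie_def, mul_smul_comm, smul_mul_assoc, sub_mul, shiftOp_mul_mulBy, e₃,
        mul_sub, mul_one, one_mul, add_mul, smul_mul_assoc, one_mul, ← smul_sub,
        sub_sub_sub_cancel_right, sub_add_cancel_left, smul_neg, smul_smul, inv_mul_cancel₀ hh,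
        one_smul]
    have e₄ : shiftOp shiftEquiv = h • vacuum h + 1 := by
      rw [vacuum, smul_smul, mul_inv_cancel₀ hh, one_smul, sub_add_cancel]
    have e₅ : ∀ k : ℕ, ⁅vacuum h ^ k, vacuum h⁆ = 0 := fun k =>
      sub_eq_zero.mpr ((Commute.refl (vacuum h)).pow_left k)
    rw [hV, ring_add_lie, ring_mul_lie, ring_mul_lie, e₁, e₂, e₅, e₅, e₄, mul_zero, mul_zero,
      zero_mul, zero_add, zero_add, pow_one, neg_mul, add_mul, one_mul, smul_mul_assoc, ← sq,
      zero_add, neg_add_cancel]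
  have h₃ : ⁅seriesB₂ h Y, Y⁆ + (h • Y ^ 2 + Y) = ⁅seriesB₂ h Y - V, Y⁆ + -⁅Y - vacuum h, V⁆ +
      (h • (Y ^ 2 - vacuum h ^ 2) + (Y - vacuum h)) := by
    have e : ⁅seriesB₂ h Y, Y⁆ + (h • Y ^ 2 + Y) = ⁅seriesB₂ h Y, Y⁆ + (h • Y ^ 2 + Y) -
        (⁅V, vacuum h⁆ + (h • vacuum h ^ 2 + vacuum h)) := by
      rw [h₂, sub_zero]
    rw [e, ring_sub_lie, ring_sub_lie, ring_lie_skew Y, ring_lie_skew (vacuum h), smul_sub]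
    abel
  rw [h₃]
  exact ((h₁.lie hI hY.isDiff).add (hY.inIdeal_sub_vacuum.lie hI hVd).neg).add
    (((hY.inIdeal_pow_sub_vacuum 2).smul h).add hY.inIdeal_sub_vacuum)

/-- The derivative of the Lax operator along the non-isospectral flow. -/
theorem lie_gateauxDer_flowσ₂ (hh : h ≠ 0) (hY : IsLaxSeries h Y) :
    ⁅endOp (gateauxDer hY.flowσ₂).toLinearMap, Y⁆ = ⁅seriesB₂ h Y, Y⁆ + (h • Y ^ 2 + Y) := by
  refine hY.lie_gateauxDer_eq hh (hY.lie_connection_seriesB₂ hh) ?_ (hY.inIdeal_lie_seriesB₂ hh)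
  have e : ⁅connection h, h • Y ^ 2⁆ = h • ⁅connection h, Y ^ 2⁆ := by
    rw [Ring.lie_def, Ring.lie_def, mul_smul_comm, smul_mul_assoc, smul_sub]
  rw [ring_lie_add, e, hY.lie_pow, hY.lie, smul_zero, add_zero]

/-- The commutator of `B₂` with the powers of the Lax operator, in order zero. -/
theorem sym_zero_lie_seriesB₂ (hh : h ≠ 0) (hY : IsLaxSeries h Y) (s : ℕ) :
    sym ⁅seriesB₂ h Y, Y ^ s⁆ 0 = constCoef h * coefX *
      sym ⁅pos (Y ^ 2), Y ^ s - pos (Y ^ s)⁆ 0 +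
      (coefX + constCoef h * coefN) * toCoef (hY.flow s) + sym (Y ^ s) (-1) := by
  set N := Y ^ s - pos (Y ^ s) with hN
  have hNd : IsDiff shiftEquiv N := (hY.isDiff.pow s).sub (hY.isDiff.pow s).pos
  have hNo : OrdLE (-1) N := ordLE_sub_pos _
  have hN₁ : sym N (-1) = sym (Y ^ s) (-1) := by
    rw [hN, sym_sub, sym_pos, if_neg (by norm_num), sub_zero]
  -- Both `B₂` and the positive part of `L^s` are nonnegative, so their commutator has no term of
  -- order zero.
  have h₁ : sym ⁅seriesB₂ h Y, Y ^ s⁆ 0 = sym ⁅seriesB₂ h Y, N⁆ 0 := by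
    rw [hN, ring_lie_sub, sym_sub, sym_zero_lie hY.isDiff_seriesB₂ (hY.isDiff.pow s).pos
      (nonNeg_seriesB₂ h Y) (nonNeg_pos _), sub_zero]
  have h₂ : ⁅mulBy (constCoef h * coefX), N⁆ = 0 := by
    refine lie_mulBy_eq_zero (fun m => ?_) hNd
    rw [map_mul, shiftEquiv_zpow_coefX, shiftEquiv_zpow_constCoef]
  have h₃ : sym ⁅mulBy (toCoef (h • flowDeltaInv flowField)), N⁆ 0 = 0 :=
    ((ordLE_mulBy _).lie hNo).sym_eq_zero (by norm_num)
  have h₄ : sym ⁅seriesA₁ h, N⁆ 0 = toCoef (hY.flow s) := by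
    have e : sym ⁅connection h, N⁆ 0 = _ :=
      sym_lie_connection dxDer_shiftEquiv h⁻¹ (zeroCoef h) hNd 0
    rw [connection, ring_sub_lie, sym_sub, sym_lie_endOp dxDer_shiftEquiv hNd,
      hNo.sym_eq_zero (show (-1 : ℤ) < 0 by norm_num), map_zero, mul_zero, zero_mul, sub_zero,
      add_zero, zero_sub, zero_sub, neg_inj, zero_sub, hN₁, smul_eq_constCoef_mul] at e
    rw [e, toCoef_flow_eq_residue]
  have hZ : OrdLE (0 + -1) ⁅mulBy (coefX + constCoef h * coefN), N⁆ := (ordLE_mulBy _).lie hNo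
  have hZd : IsDiff shiftEquiv ⁅mulBy (coefX + constCoef h * coefN), N⁆ :=
    (isDiff_mulBy _).lie hNd
  -- Commuting `h n` past `p E⁻¹` gives `h p E⁻¹`, and the leading term `h⁻¹ E` of `A₁` brings this
  -- to order zero as `p`.
  have h₅ : sym (⁅mulBy (coefX + constCoef h * coefN), N⁆ * seriesA₁ h) 0 =
      sym (Y ^ s) (-1) := by
    rw [seriesA₁, mul_add, mul_smul_comm, sym_add, sym_smul, sym_mul_shiftOp, hZd.sym_mul_mulBy,
      hZ.sym_eq_zero (show (0 : ℤ) + -1 < 0 by norm_num), zero_mul, add_zero, zero_sub, Ring.lie_def,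
      sym_sub, sym_mulBy_mul, hNd.sym_mul_mulBy, hN₁, smul_eq_constCoef_mul, map_add, map_mul,
      shiftEquiv_zpow_coefX, shiftEquiv_zpow_constCoef, shiftEquiv_zpow_coefN]
    have : constCoef ((-1 : ℤ) : ℝ) = -1 := by
      rw [Int.cast_neg, Int.cast_one, constCoef, map_neg, map_one]
    rw [this]
    linear_combination sym (Y ^ s) (-1) * constCoef_mul_inv hh
  rw [h₁, seriesB₂, pow_one, hY.pos_self, ring_add_lie, ring_add_lie, ring_mul_lie, ring_mul_lie, h₂,
    zero_mul, add_zero, sym_add, sym_add, sym_add, sym_mulBy_mul, sym_mulBy_mul, h₃, h₄, h₅, add_zero,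
    add_assoc]

theorem flowGateaux_smul (c : ℝ) (f g : flowFn) :
    flowGateaux (c • f) g = c • flowGateaux f g :=
  Subtype.ext (gateaux_smul c f.2.isPoly g)

theorem flowGateaux_flowDeltaInv (f g : flowFn) :
    flowGateaux (flowDeltaInv f) g = flowDeltaInv (flowGateaux f g) :=
  Subtype.ext (gateaux_lift f.2.isPoly linearOn_deltaInv g)

theorem flowGateaux_flowDx (f g : flowFn) :
    flowGateaux (flowDx f) g = flowDx (flowGateaux f g) :=
  Subtype.ext (gateaux_lift f.2.isPoly linearOn_phase_dx g)

/-- The derivative of `ω` is the operator `h x γ₂' + (x + h n) + h Δ⁻¹`. -/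
theorem toCoef_flowGateaux_potential (hY : IsLaxSeries h Y) (g : flowFn) :
    toCoef (flowGateaux hY.potential g) =
      constCoef h * coefX * toCoef (flowGateaux (hY.gradient 2) g) +
        (coefX + constCoef h * coefN) * toCoef g + constCoef h * toCoef (flowDeltaInv g) := by
  rw [← gateauxDer_toCoef, toCoef_potential, map_add, map_add, (gateauxDer g).leibniz,
    (gateauxDer g).leibniz, (gateauxDer g).leibniz, map_add, (gateauxDer g).leibniz,
    gateauxDer_constCoef, gateauxDer_coefX, gateauxDer_coefN, gateauxDer_toCoef, gateauxDer_toCoef,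
    gateauxDer_toCoef, flowGateaux_flowField, flowGateaux_smul, flowGateaux_flowDeltaInv,
    flowGateaux_flowField, toCoef_smul]
  simp only [smul_eq_mul]
  ring

/-- The recursion `γ_s'[σ₂] - ω'[K_s] = s (h γ_{s+1} + γ_s)`. -/
theorem flowGateaux_gradient_flowσ₂ (hh : h ≠ 0) (hY : IsLaxSeries h Y) (s : ℕ) :
    flowGateaux (hY.gradient s) hY.flowσ₂ = flowGateaux hY.potential (hY.flow s) +
      (s : ℝ) • (h • hY.gradient (s + 1) + hY.gradient s) := by
  apply toCoef_injective
  -- Bracketing with the derivative along `σ₂` minus `B₂` sends `L` to `h L² + L`, which fixes its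
  -- effect on all powers.
  have h₁ : ⁅endOp (gateauxDer hY.flowσ₂).toLinearMap - seriesB₂ h Y, Y ^ s⁆ =
      (s : ℝ) • (h • Y ^ (s + 1) + Y ^ s) := by
    apply lie_pow_of_lie_eq
    rw [ring_sub_lie, hY.lie_gateauxDer_flowσ₂ hh, add_sub_cancel_left]
  have h₂ := congrArg (fun Z => sym Z 0) h₁
  simp only [ring_sub_lie, sym_sub, sym_smul, sym_add] at h₂
  rw [sym_lie_endOp (gateauxDer_shiftEquiv _) (hY.isDiff.pow s), hY.sym_zero_lie_seriesB₂ hh] at h₂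
  have h₃ : toCoef (flowGateaux (hY.gradient s) hY.flowσ₂) =
      gateauxDer hY.flowσ₂ (sym (Y ^ s) 0) := by
    rw [← gateauxDer_toCoef, toCoef_gradient, map_sub, gateauxDer_constCoef, sub_zero]
  have h₄ : toCoef (flowGateaux (hY.gradient 2) (hY.flow s)) =
      sym ⁅pos (Y ^ 2), Y ^ s - pos (Y ^ s)⁆ 0 := by
    rw [← gateauxDer_toCoef, toCoef_gradient, map_sub, gateauxDer_constCoef, sub_zero,
      hY.gateauxDer_flow_sym_sq hh]
  have h₅ : toCoef (flowGateaux hY.potential (hY.flow s) +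
      (s : ℝ) • (h • hY.gradient (s + 1) + hY.gradient s)) =
      toCoef (flowGateaux hY.potential (hY.flow s)) +
      (s : ℝ) • (h • toCoef (hY.gradient (s + 1)) + toCoef (hY.gradient s)) := rfl
  -- The constants removed in the definition of the gradients cancel in `h γ_{s+1} + γ_s`.
  have h₆ : h • constCoef ((-h⁻¹) ^ (s + 1)) + constCoef ((-h⁻¹) ^ s) = 0 := by
    rw [smul_eq_constCoef_mul, constCoef, constCoef, constCoef, ← map_mul, ← map_add, pow_succ,
      mul_neg, mul_neg, mul_comm _ h⁻¹, ← mul_assoc, mul_inv_cancel₀ hh, one_mul, neg_add_cancel,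
      map_zero]
  have h₇ : h • toCoef (hY.gradient (s + 1)) + toCoef (hY.gradient s) =
      h • sym (Y ^ (s + 1)) 0 + sym (Y ^ s) 0 := by
    rw [toCoef_gradient, toCoef_gradient, smul_sub]
    linear_combination -h₆
  rw [h₅, h₇, h₃, hY.toCoef_flowGateaux_potential, h₄, hY.constCoef_mul_flowDeltaInv_flow hh, ← h₂]
  ring

end IsLaxSeries


/-! ### Functionals, adjoints and gradients. -/

theorem mul_mem_density {f g : Fn} (hf : IsFlowFn f) (hg : IsFlowFn g) : f * g ∈ density :=
  Submodule.subset_span ⟨f, hf, g, hg, rfl⟩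

theorem density_le_flowFn : density ≤ flowFn :=
  Submodule.span_le.mpr fun _ ⟨_, hf, _, hg, e⟩ => e ▸ IsFlowFn.mul hf hg

theorem isFlowFn_of_density (k : density) : IsFlowFn k := density_le_flowFn k.2

/-- The class of `f g`. -/
def pairing (f g : flowFn) : Functional :=
  Submodule.Quotient.mk ⟨f.1 * g.1, mul_mem_density f.2 g.2⟩

theorem innerProd_eq_smul (h : ℝ) (f g : flowFn) : innerProd h f g = (h ^ 2 / 2) • pairing f g :=
  rfl

theorem mk_eq_zero_of_eq_dx {k : density} (j : density) (e : (k : Fn) = lift dx j) :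
    (Submodule.Quotient.mk k : Functional) = 0 :=
  (Submodule.Quotient.mk_eq_zero _).mpr (Submodule.subset_span ⟨j, Or.inl e⟩)

theorem mk_eq_zero_of_eq_delta {k : density} (j : density) (e : (k : Fn) = lift delta j) :
    (Submodule.Quotient.mk k : Functional) = 0 :=
  (Submodule.Quotient.mk_eq_zero _).mpr (Submodule.subset_span ⟨j, Or.inr e⟩)

theorem pairing_congr {f g f' g' : flowFn} (e : (f : Fn) * g = f' * g') :
    pairing f g = pairing f' g' :=
  congrArg Submodule.Quotient.mk (Subtype.ext e)

theorem pairing_comm (f g : flowFn) : pairing f g = pairing g f := pairing_congr (mul_comm _ _)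

theorem pairing_flowDx (f g : flowFn) : pairing (flowDx f) g + pairing f (flowDx g) = 0 :=
  mk_eq_zero_of_eq_dx (k := ⟨(flowDx f).1 * g.1, _⟩ + ⟨f.1 * (flowDx g).1, _⟩)
    ⟨f.1 * g.1, mul_mem_density f.2 g.2⟩
    (lift_dx_mul (isPoly_of_mem_coefAlg f.2.mem_coefAlg)
      (isPoly_of_mem_coefAlg g.2.mem_coefAlg)).symm

/-- Summation by parts: for `F = Δ⁻¹ f` and `G = Δ⁻¹ g` one has `Δ(F G) = F g + f G + f g`. Hence
the adjoint of `Δ⁻¹` is `-(Δ⁻¹ + 1)`. -/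
theorem pairing_flowDeltaInv (f g : flowFn) :
    pairing (flowDeltaInv f) g + pairing f (flowDeltaInv g) + pairing f g = 0 := by
  refine mk_eq_zero_of_eq_delta (k := ⟨(flowDeltaInv f).1 * g.1, _⟩ +
    ⟨f.1 * (flowDeltaInv g).1, _⟩ + ⟨f.1 * g.1, _⟩)
    ⟨(flowDeltaInv f).1 * (flowDeltaInv g).1, mul_mem_density (flowDeltaInv f).2 (flowDeltaInv g).2⟩ ?_
  have h₁ : lift (shift 1) (flowDeltaInv f).1 - (flowDeltaInv f).1 = f.1 :=
    congrArg Subtype.val (shiftEquiv_sub_flowDeltaInv f)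
  have h₂ : lift (shift 1) (flowDeltaInv g).1 - (flowDeltaInv g).1 = g.1 :=
    congrArg Subtype.val (shiftEquiv_sub_flowDeltaInv g)
  have h₃ : lift delta ((flowDeltaInv f).1 * (flowDeltaInv g).1) =
      lift (shift 1) (flowDeltaInv f).1 * lift (shift 1) (flowDeltaInv g).1 -
        (flowDeltaInv f).1 * (flowDeltaInv g).1 := rfl
  change (flowDeltaInv f).1 * g.1 + f.1 * (flowDeltaInv g).1 + f.1 * g.1 = _
  rw [h₃]
  generalize (flowDeltaInv f).1 = F at *
  generalize (flowDeltaInv g).1 = G at *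
  rw [← h₁, ← h₂]
  ring

theorem pairing_add_left (f₁ f₂ g : flowFn) :
    pairing (f₁ + f₂) g = pairing f₁ g + pairing f₂ g :=
  congrArg Submodule.Quotient.mk (Subtype.ext (add_mul f₁.1 f₂.1 g.1))

theorem pairing_smul_left (c : ℝ) (f g : flowFn) : pairing (c • f) g = c • pairing f g :=
  congrArg Submodule.Quotient.mk (Subtype.ext (smul_mul_assoc c f.1 g.1))

theorem innerProd_comm (h : ℝ) (f g : flowFn) : innerProd h f g = innerProd h g f := by
  rw [innerProd_eq_smul, innerProd_eq_smul, pairing_comm]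

/-- The inner product as a bilinear map. -/
noncomputable def innerBilin (h : ℝ) : flowFn →ₗ[ℝ] flowFn →ₗ[ℝ] Functional :=
  LinearMap.mk₂ ℝ (innerProd h)
    (fun f₁ f₂ g => by simp only [innerProd_eq_smul, pairing_add_left, smul_add])
    (fun c f g => by simp only [innerProd_eq_smul, pairing_smul_left, smul_comm c])
    (fun f g₁ g₂ => by
      simp only [innerProd_eq_smul, pairing_comm f, pairing_add_left, smul_add])
    (fun c f g => by simp only [innerProd_eq_smul, pairing_comm f, pairing_smul_left, smul_comm c])

theorem innerBilin_apply (h : ℝ) (f g : flowFn) : innerBilin h f g = innerProd h f g := rfl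

variable {h : ℝ}

namespace IsAdjoint

variable {T S T' S' : flowFn →ₗ[ℝ] flowFn}

theorem add (h₁ : IsAdjoint h T S) (h₂ : IsAdjoint h T' S') : IsAdjoint h (T + T') (S + S') := by
  intro f g
  have e₁ := h₁ f g
  have e₂ := h₂ f g
  simp only [← innerBilin_apply] at e₁ e₂ ⊢
  rw [LinearMap.add_apply, LinearMap.add_apply, map_add, map_add, LinearMap.add_apply, e₁, e₂]

theorem smul (c : ℝ) (h₁ : IsAdjoint h T S) : IsAdjoint h (c • T) (c • S) := by
  intro f g
  have e₁ := h₁ f g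
  simp only [← innerBilin_apply] at e₁ ⊢
  rw [LinearMap.smul_apply, LinearMap.smul_apply, map_smul, map_smul, LinearMap.smul_apply, e₁]

theorem comp (h₁ : IsAdjoint h T S) (h₂ : IsAdjoint h T' S') : IsAdjoint h (T ∘ₗ T') (S' ∘ₗ S) :=
  fun f g => (h₁ (T' f) g).trans (h₂ f (S g))

end IsAdjoint

theorem isAdjoint_id : IsAdjoint h LinearMap.id LinearMap.id := fun _ _ => rfl

theorem isAdjoint_flowDx : IsAdjoint h flowDx (-flowDx) := by
  intro f g
  have e := pairing_flowDx f g
  rw [← innerBilin_apply, LinearMap.neg_apply, ← innerBilin_apply, map_neg, innerBilin_apply,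
    innerBilin_apply, innerProd_eq_smul, innerProd_eq_smul, ← smul_neg, eq_neg_of_add_eq_zero_left e]

theorem isAdjoint_flowDeltaInv : IsAdjoint h flowDeltaInv (-(flowDeltaInv + LinearMap.id)) := by
  intro f g
  have e := pairing_flowDeltaInv f g
  rw [add_assoc] at e
  rw [← innerBilin_apply, LinearMap.neg_apply, ← innerBilin_apply, map_neg, LinearMap.add_apply,
    map_add, LinearMap.id_apply, innerBilin_apply, innerBilin_apply, innerBilin_apply,
    innerProd_eq_smul, innerProd_eq_smul, innerProd_eq_smul, ← smul_add, ← smul_neg,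
    eq_neg_of_add_eq_zero_left e]

/-- Multiplication by a coefficient on `𝓕`. -/
def mulCoef (a : coefAlg) : flowFn →ₗ[ℝ] flowFn where
  toFun f := ⟨a * f, f.2.coefAlg_mul a.2⟩
  map_add' f g := Subtype.ext (mul_add a.1 f.1 g.1)
  map_smul' c f := Subtype.ext (mul_smul_comm c a.1 f.1)

theorem toCoef_mulCoef (a : coefAlg) (f : flowFn) : toCoef (mulCoef a f) = a * toCoef f := rfl

theorem isAdjoint_mulCoef (a : coefAlg) : IsAdjoint h (mulCoef a) (mulCoef a) := by
  intro f g
  have e : pairing (mulCoef a f) g = pairing f (mulCoef a g) :=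
    pairing_congr (by
    change a.1 * f.1 * g.1 = f.1 * (a.1 * g.1)
    ring)
  rw [innerProd_eq_smul, innerProd_eq_smul, e]

/-- The derivative of densities in the direction `g`. -/
noncomputable def densityGateaux (g : flowFn) : density →ₗ[ℝ] density where
  toFun k := ⟨gateaux k g, by
    obtain ⟨k, hk⟩ := k
    induction hk using Submodule.span_induction with
    | mem k hk =>
      obtain ⟨f₁, h₁, f₂, h₂, rfl⟩ := hk
      change gateaux (f₁ * f₂) g ∈ density
      rw [gateaux_mul (IsFlowFn.isPoly h₁) (IsFlowFn.isPoly h₂)]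
      exact add_mem (mul_mem_density (IsFlowFn.gateaux h₁ g) h₂)
        (mul_mem_density h₁ (IsFlowFn.gateaux h₂ g))
    | zero => exact (gateaux_const 0 g).symm ▸ zero_mem density
    | add k₁ k₂ m₁ m₂ e₁ e₂ =>
      change gateaux (k₁ + k₂) g ∈ density
      rw [gateaux_add (density_le_flowFn m₁ : IsFlowFn k₁).isPoly
        (density_le_flowFn m₂ : IsFlowFn k₂).isPoly]
      exact add_mem e₁ e₂
    | smul c k m e =>
      change gateaux (c • k) g ∈ density
      rw [gateaux_smul c (density_le_flowFn m : IsFlowFn k).isPoly]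
      exact density.smul_mem c e⟩
  map_add' k₁ k₂ := Subtype.ext
    (gateaux_add (isFlowFn_of_density k₁).isPoly (isFlowFn_of_density k₂).isPoly g)
  map_smul' c k := Subtype.ext (gateaux_smul c (isFlowFn_of_density k).isPoly g)

theorem linearOn_phase_delta : LinearOn phase phase delta where
  mem _ hc := sub_mem ((linearOn_phase_shift 1).mem _ hc) hc
  map_add c _ d _ := by
    funext n x
    simp only [delta, Pi.add_apply]
    ring
  map_smul r c _ := by
    funext n x
    simp only [delta, Pi.smul_apply, smul_eq_mul]
    ring

/-- Directional derivatives commute with `∂ₓ` and `Δ`, so they descend from densities to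
functionals. -/
theorem totalDer_le_comap (g : flowFn) : totalDer ≤ totalDer.comap (densityGateaux g) := by
  refine Submodule.span_le.mpr fun k hk => Submodule.subset_span ?_
  obtain ⟨j, e⟩ := hk
  refine ⟨densityGateaux g j, ?_⟩
  change gateaux k g = _ ∨ gateaux k g = _
  refine e.imp (fun e => ?_) fun e => ?_
  · rw [e]
    exact gateaux_lift (isFlowFn_of_density j).isPoly linearOn_phase_dx g
  · rw [e]
    exact gateaux_lift (isFlowFn_of_density j).isPoly linearOn_phase_delta g

/-- The derivative of functionals in the direction `g`. -/
noncomputable def functionalGateaux (g : flowFn) : Functional →ₗ[ℝ] Functional :=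
  totalDer.mapQ totalDer (densityGateaux g) (totalDer_le_comap g)

theorem functionalGateaux_mk (g : flowFn) (k : density) :
    functionalGateaux g (Submodule.Quotient.mk k) = Submodule.Quotient.mk (densityGateaux g k) := rfl

theorem functionalGateaux_innerProd (f₁ f₂ g : flowFn) : functionalGateaux g (innerProd h f₁ f₂) =
    innerProd h (flowGateaux f₁ g) f₂ + innerProd h f₁ (flowGateaux f₂ g) := by
  rw [innerProd_eq_smul, innerProd_eq_smul, innerProd_eq_smul, map_smul, ← smul_add]
  congr 1
  exact congrArg Submodule.Quotient.mk (Subtype.ext (gateaux_mul f₁.2.isPoly f₂.2.isPoly g))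

theorem functionalGateaux_symm (H : Functional) (g₁ g₂ : flowFn) :
    functionalGateaux g₂ (functionalGateaux g₁ H) + functionalGateaux (flowGateaux g₂ g₁) H =
      functionalGateaux g₁ (functionalGateaux g₂ H) + functionalGateaux (flowGateaux g₁ g₂) H := by
  induction H using Submodule.Quotient.induction_on with
  | H k =>
    exact congrArg Submodule.Quotient.mk
      (Subtype.ext ((isFlowFn_of_density k).gateaux_symm g₁ g₂))

/-- Once the derivative is defined on the quotient, the condition on all densities of `H` becomes
one equation between functionals for each direction. -/
theorem hasGradient_iff {H : Functional} {γ : flowFn} :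
    HasGradient h H γ ↔ ∀ g, functionalGateaux g H = innerProd h γ g := by
  constructor
  · intro hH g
    induction H using Submodule.Quotient.induction_on with
    | H k =>
      obtain ⟨k', e₁, e₂⟩ := hH k rfl g
      rw [← e₂, functionalGateaux_mk]
      exact congrArg Submodule.Quotient.mk (Subtype.ext e₁.symm)
  · rintro hH k rfl g
    exact ⟨densityGateaux g k, rfl, hH g⟩

namespace HasGradient

variable {H H' : Functional} {γ γ' : flowFn}

theorem sub (h₁ : HasGradient h H γ) (h₂ : HasGradient h H' γ') :
    HasGradient h (H - H') (γ - γ') := by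
  rw [hasGradient_iff] at *
  intro g
  rw [map_sub, h₁, h₂, ← innerBilin_apply, ← innerBilin_apply, ← innerBilin_apply, map_sub,
    LinearMap.sub_apply]

theorem smul (c : ℝ) (h₁ : HasGradient h H γ) : HasGradient h (c • H) (c • γ) := by
  rw [hasGradient_iff] at *
  intro g
  rw [map_smul, h₁, ← innerBilin_apply, ← innerBilin_apply, map_smul, LinearMap.smul_apply]

/-- The derivative of a gradient is symmetric. -/
theorem innerProd_flowGateaux (h₁ : HasGradient h H γ) (f g : flowFn) :
    innerProd h (flowGateaux γ f) g = innerProd h (flowGateaux γ g) f := by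
  rw [hasGradient_iff] at h₁
  have e := functionalGateaux_symm H f g
  -- Both sides contain `(γ, f'[g]) + (γ, g'[f])`, which cancels and leaves the symmetry of `γ'`.
  rw [h₁, h₁, h₁, h₁, functionalGateaux_innerProd, functionalGateaux_innerProd, add_assoc, add_assoc,
    add_comm (innerProd h γ (flowGateaux f g))] at e
  exact (add_right_cancel e).symm

end HasGradient

theorem hasGradient_innerProd_field :
    HasGradient h ((1 / 2 : ℝ) • innerProd h flowField flowField) flowField := by
  rw [hasGradient_iff]
  intro g
  rw [map_smul, functionalGateaux_innerProd, flowGateaux_flowField, innerProd_comm h g, ← two_smul ℝ,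
    smul_smul, one_div, inv_mul_cancel₀ two_ne_zero, one_smul]

/-- The operator does not depend on `u`, so its derivative is zero and the Jacobi identity is
trivial; skew-symmetry is integration by parts. -/
theorem isImplectic_phaseDx : IsImplectic h fun _ => phaseDx := by
  refine ⟨flowDx, fun _ _ => 0, fun _ _ => rfl, fun _ f u n x => ?_, fun f g => ?_, fun f g k => ?_⟩
  · exact (deriv_const (0 : ℝ) ((phaseDx (value f u)).1 n x)).symm
  · rw [isAdjoint_flowDx f g, LinearMap.neg_apply, ← innerBilin_apply, map_neg, innerBilin_apply]
  · simp only [← innerBilin_apply, map_zero, add_zero]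

/-- The kernel consists of functions constant in `x`, and decay in `x` leaves only zero. This makes
`∂ₓ⁻¹ K_s` unique. -/
theorem phaseDx_injective : Function.Injective phaseDx := by
  refine (injective_iff_map_eq_zero _).mpr fun φ hφ => ?_
  ext n x
  have hc : ∀ y z, φ.1 n y = φ.1 n z := by
    refine is_const_of_deriv_eq_zero ((φ.2.1 n).differentiable (by simp)) fun y => ?_
    exact congrFun (congrFun (congrArg Subtype.val hφ) n) y
  obtain ⟨C, hC⟩ := φ.2.2 n 0 1 0
  by_contra hne
  have hpos : 0 < |φ.1 n x| := abs_pos.mpr hne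
  -- At this point `(1 + |x|) |φ|` equals `|φ| + |C|`, which exceeds the bound `C`.
  have hb := hC n le_rfl (|C| / |φ.1 n x|)
  rw [iteratedDeriv_zero, pow_zero, one_mul, pow_one, hc (|C| / |φ.1 n x|) x, abs_of_nonneg (by positivity), add_mul,
    div_mul_cancel₀ _ hpos.ne', one_mul] at hb
  linarith [le_abs_self C]

theorem flowDx_injective : Function.Injective flowDx := by
  intro f g e
  apply Subtype.ext
  funext u
  have e' : phaseDx (value f u) = phaseDx (value g u) :=
    Subtype.ext (congrFun (congrArg Subtype.val e) u)
  exact congrArg Subtype.val (phaseDx_injective e')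


/-! ### Self-adjointness of `ω'`, the Noether identity and the Hamiltonians. -/

namespace IsLaxSeries

variable {h : ℝ} {Y : Op coefAlg}

theorem flowDeltaInv_mulCoef_coefX (f : flowFn) :
    flowDeltaInv (mulCoef coefX f) = mulCoef coefX (flowDeltaInv f) := by
  apply flowDeltaInv_eq
  rw [toCoef_mulCoef, toCoef_mulCoef, map_mul, shiftEquiv_coefX, ← mul_sub,
    shiftEquiv_sub_flowDeltaInv]

theorem flowDeltaInv_flowDx (f : flowFn) : flowDeltaInv (flowDx f) = flowDx (flowDeltaInv f) := by
  apply flowDeltaInv_eq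
  rw [toCoef_flowDx, toCoef_flowDx, ← dxDer_shiftEquiv, ← map_sub, shiftEquiv_sub_flowDeltaInv]

theorem toCoef_flowGateaux_gradient_two (hh : h ≠ 0) (hY : IsLaxSeries h Y) (g : flowFn) :
    toCoef (flowGateaux (hY.gradient 2) g) = 2 * toCoef flowField * toCoef g + dxDer (toCoef g) +
      2 * dxDer (toCoef (flowDeltaInv g)) - 2 * (constCoef h⁻¹ * toCoef g) := by
  have e₂ : gateauxDer g 2 = 0 := (gateauxDer g).map_natCast 2
  have e₁ := congrArg (gateauxDer g) (hY.toCoef_gradient_two hh)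
  rw [map_sub, map_add, map_add, (gateauxDer g).leibniz, (gateauxDer g).leibniz,
    (gateauxDer g).leibniz, (gateauxDer g).leibniz, gateauxDer_constCoef, e₂] at e₁
  simp only [gateauxDer_toCoef, flowGateaux_flowDeltaInv, flowGateaux_flowField,
    flowDeltaInv_flowDx, toCoef_flowDx, gateauxDer_dxDer, smul_eq_mul, mul_zero, add_zero] at e₁
  rw [e₁]
  ring

/-- The derivative `γ₂'` as an operator. -/
noncomputable def gradientTwoOp (h : ℝ) : flowFn →ₗ[ℝ] flowFn :=
  mulCoef (2 * toCoef flowField) + flowDx + (2 : ℝ) • flowDeltaInv ∘ₗ flowDx +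
    (-(2 * h⁻¹)) • LinearMap.id

/-- Explicitly `ω' = h x γ₂' + (x + h n) + h Δ⁻¹` with `γ₂' = 2u + ∂ₓ + 2 ∂ₓ Δ⁻¹ - 2 h⁻¹`. The
adjoint of `Δ⁻¹` being `-(Δ⁻¹ + 1)`, `γ₂'` is self-adjoint. In the adjoint of `ω'`, moving `x` back
across `∂ₓ` in `h γ₂' x` produces `h (1 + 2 Δ⁻¹)`, and adding `-h (Δ⁻¹ + 1)` restores `h Δ⁻¹`. -/
theorem isAdjoint_linearization_potential (hh : h ≠ 0) (hY : IsLaxSeries h Y) :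
    IsAdjoint h (linearization hY.potential) (linearization hY.potential) := by
  have key : IsAdjoint h
      (mulCoef (constCoef h * coefX) ∘ₗ gradientTwoOp h + mulCoef (coefX + constCoef h * coefN) +
        h • flowDeltaInv) _ :=
    (((isAdjoint_mulCoef (constCoef h * coefX)).comp
      ((((isAdjoint_mulCoef (2 * toCoef flowField)).add isAdjoint_flowDx).add
        ((isAdjoint_flowDeltaInv.comp isAdjoint_flowDx).smul 2)).add
        (isAdjoint_id.smul (-(2 * h⁻¹))))).add
      (isAdjoint_mulCoef (coefX + constCoef h * coefN))).add (isAdjoint_flowDeltaInv.smul h)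
  have c₂ : constCoef (2 : ℝ) = 2 := map_ofNat (algebraMap ℝ coefAlg) 2
  have c₃ : constCoef (-(2 * h⁻¹)) = -(2 * constCoef h⁻¹) := by
    rw [← c₂]
    simp only [constCoef, map_neg, map_mul]
  have add_coef : ∀ f g : flowFn, toCoef (f + g) = toCoef f + toCoef g := fun _ _ => rfl
  have neg_coef : ∀ f : flowFn, toCoef (-f) = -toCoef f := fun _ => rfl
  convert key using 1
  · refine LinearMap.ext fun g => toCoef_injective ?_
    change toCoef (flowGateaux hY.potential g) = _
    rw [hY.toCoef_flowGateaux_potential, hY.toCoef_flowGateaux_gradient_two hh]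
    simp only [gradientTwoOp, LinearMap.add_apply, LinearMap.comp_apply, LinearMap.smul_apply,
      LinearMap.id_apply, add_coef, toCoef_smul, toCoef_mulCoef, toCoef_flowDx, flowDeltaInv_flowDx,
      c₂, c₃]
    ring
  · refine LinearMap.ext fun g => toCoef_injective ?_
    change toCoef (flowGateaux hY.potential g) = _
    have e : mulCoef (constCoef h * coefX) g = mulCoef coefX (h • g) := toCoef_injective (by
      rw [toCoef_mulCoef, toCoef_mulCoef, toCoef_smul]
      ring)
    rw [hY.toCoef_flowGateaux_potential, hY.toCoef_flowGateaux_gradient_two hh]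
    simp only [LinearMap.add_apply, LinearMap.comp_apply, LinearMap.smul_apply,
      LinearMap.id_apply, LinearMap.neg_apply, add_coef, neg_coef, toCoef_smul, toCoef_flowDx, c₂, c₃,
      e, flowDeltaInv_mulCoef_coefX, toCoef_mulCoef, dxDer.leibniz, dxDer_coefX, map_smul, map_neg,
      map_add, smul_eq_mul]
    ring

theorem linearization_flowσ₂ (hY : IsLaxSeries h Y) :
    linearization hY.flowσ₂ = flowDx ∘ₗ linearization hY.potential :=
  LinearMap.ext fun g => flowGateaux_flowDx hY.potential g

/-- `∂ₓ` is a Noether operator of the non-isospectral flow. -/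
theorem exists_noether (hh : h ≠ 0) (hY : IsLaxSeries h Y) :
    ∃ D Dstar : flowFn →ₗ[ℝ] flowFn, (∀ f : flowFn, (D f : Fn) = gateaux hY.flowσ₂ f) ∧
      IsAdjoint h D Dstar ∧ D ∘ₗ flowDx + flowDx ∘ₗ Dstar = 0 := by
  -- From `σ₂' = ∂ₓ ω'` with `ω'` self-adjoint the adjoint is `-ω' ∂ₓ`, and the two terms of the
  -- identity are `±∂ₓ ω' ∂ₓ`.
  refine ⟨linearization hY.flowσ₂, linearization hY.potential ∘ₗ (-flowDx), fun _ => rfl, ?_, ?_⟩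
  · rw [hY.linearization_flowσ₂]
    exact isAdjoint_flowDx.comp (hY.isAdjoint_linearization_potential hh)
  · rw [hY.linearization_flowσ₂, LinearMap.comp_neg, LinearMap.comp_neg, LinearMap.comp_assoc]
    exact LinearMap.ext fun f => add_neg_cancel (flowDx (linearization hY.potential (flowDx f)))

/-- The derivative along `g` is `(γ_s'[g], σ₂) + (γ_s, ∂ₓ ω'[g])`. Symmetry of `γ_s'`, which is
where `H` enters, and self-adjointness of `ω'` turn it into `(γ_s'[σ₂] - ω'[K_s], g)`, and the
recursion evaluates the first entry. -/
theorem hasGradient_innerProd_flowσ₂ (hh : h ≠ 0) (hY : IsLaxSeries h Y) {s : ℕ} {H : Functional}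
    (hH : HasGradient h H (hY.gradient s)) : HasGradient h (innerProd h (hY.gradient s) hY.flowσ₂)
      ((s : ℝ) • (h • hY.gradient (s + 1) + hY.gradient s)) := by
  rw [hasGradient_iff]
  intro g
  have e₁ := hY.flowGateaux_gradient_flowσ₂ hh s
  have e₂ : innerProd h (hY.gradient s) (flowGateaux hY.flowσ₂ g) =
      -innerProd h (flowGateaux hY.potential (hY.flow s)) g := by
    rw [innerProd_comm, flowσ₂, flowGateaux_flowDx, isAdjoint_flowDx, LinearMap.neg_apply,
      ← innerBilin_apply, map_neg, innerBilin_apply, innerProd_comm h _ g, innerProd_comm]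
    rw [innerProd_comm h g]
    exact congrArg Neg.neg
      (hY.isAdjoint_linearization_potential hh (hY.flow s) g).symm
  rw [functionalGateaux_innerProd, e₂, hH.innerProd_flowGateaux, e₁, ← innerBilin_apply, map_add,
    LinearMap.add_apply, innerBilin_apply, innerBilin_apply, add_neg_cancel_comm]

theorem gradient_recursion (hh : h ≠ 0) (hY : IsLaxSeries h Y) {s : ℕ} (hs : s ≠ 0) :
    hY.gradient (s + 1) = h⁻¹ • ((s : ℝ)⁻¹ • ((s : ℝ) •
      (h • hY.gradient (s + 1) + hY.gradient s)) - hY.gradient s) := by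
  rw [inv_smul_smul₀ (Nat.cast_ne_zero.mpr hs), add_sub_cancel_right, inv_smul_smul₀ hh]

/-- The Hamiltonians of the isospectral flows. -/
noncomputable def hamiltonian (hY : IsLaxSeries h Y) : ℕ → Functional
  | 0 => 0
  | 1 => (1 / 2 : ℝ) • innerProd h (hY.gradient 1) (hY.gradient 1)
  | s + 2 => h⁻¹ • (((s + 1 : ℕ) : ℝ)⁻¹ • innerProd h (hY.gradient (s + 1)) hY.flowσ₂ -
      hY.hamiltonian (s + 1))

theorem hasGradient_hamiltonian (hh : h ≠ 0) (hY : IsLaxSeries h Y) (s : ℕ) :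
    HasGradient h (hY.hamiltonian (s + 1)) (hY.gradient (s + 1)) := by
  induction s with
  | zero =>
    rw [zero_add, hamiltonian, hY.gradient_one]
    exact hasGradient_innerProd_field
  | succ s ih =>
    rw [hamiltonian, hY.gradient_recursion hh s.succ_ne_zero]
    exact (((hY.hasGradient_innerProd_flowσ₂ hh ih).smul _).sub ih).smul _

end IsLaxSeries

end DKP

/-! ### Assembly of the theorem. -/

theorem mainTheorem4 (h : ℝ) (hh : h ≠ 0) :
    (∃! L : PsiDO, IsLaxOperator h L) ∧
    ∀ L : PsiDO, IsLaxOperator h L →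
      ∃ (K : ℕ → flowFn) (σ₂ : flowFn) (γ : ℕ → flowFn) (H : ℕ → Functional),
        -- the isospectral flows and the non-isospectral flow of index two
        (∀ s, 1 ≤ s → ZeroCurvature h (opA L s) (K s)) ∧
        ZeroCurvature h (opB₂ h L) σ₂ ∧
        -- the Noether identity
        (∃ D Dstar : flowFn →ₗ[ℝ] flowFn,
          (∀ f : flowFn, (D f : Fn) = gateaux σ₂ f) ∧ IsAdjoint h D Dstar ∧
          D ∘ₗ flowDx + flowDx ∘ₗ Dstar = 0) ∧
        -- the Hamiltonian structures
        IsImplectic h (fun _ => phaseDx) ∧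
        (∀ s, 1 ≤ s → K s = flowDx (γ s) ∧ HasGradient h (H s) (γ s) ∧
          ∀ γ' : flowFn, K s = flowDx γ' → γ' = γ s) ∧
        -- the recursions for the gradients and the Hamiltonians
        (γ 1 : Fn) = field ∧
        (∀ s, 1 < s → ∃ G : flowFn, HasGradient h (innerProd h (γ (s - 1)) σ₂) G ∧
          γ s = h⁻¹ • (((s : ℝ) - 1)⁻¹ • G - γ (s - 1))) ∧
        H 1 = (1 / 2 : ℝ) • innerProd h (γ 1) (γ 1) ∧
        ∀ s, 1 < s →
          H s = h⁻¹ • (((s : ℝ) - 1)⁻¹ • innerProd h (γ (s - 1)) σ₂ - H (s - 1)) := by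
  refine ⟨existsUnique_isLaxOperator hh, fun L hL => ?_⟩
  obtain ⟨Y, hYL, hY⟩ := hL.exists_series
  refine ⟨hY.flow, hY.flowσ₂, hY.gradient, hY.hamiltonian, fun s _ => ?_, ?_, hY.exists_noether hh,
    isImplectic_phaseDx, fun s hs => ?_, congrArg Subtype.val hY.gradient_one, fun s hs => ?_, rfl,
    fun s hs => ?_⟩
  · exact (hYL.pow s).pos.zeroCurvature s.cast_nonneg (hY.lie_connection_pos_pow s)
  · exact (IsLaxSeries.represents_seriesB₂ hYL).zeroCurvature zero_le_two
      (hY.lie_connection_seriesB₂ hh)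
  · obtain ⟨s, rfl⟩ := Nat.exists_eq_add_of_le' hs
    exact ⟨rfl, hY.hasGradient_hamiltonian hh s, fun γ' e => flowDx_injective e.symm⟩
  all_goals
    obtain ⟨s, rfl⟩ := Nat.exists_eq_add_of_le' (show 2 ≤ s from hs)
    -- With the index written as `s + 2`, the real factor `(s + 2) - 1` becomes the natural number
    -- used in the definition of the Hamiltonians.
    have hc : ((s + 2 : ℕ) : ℝ) - 1 = (s + 1 : ℕ) := by
      push_cast
      ring
    rw [hc]
  · exact ⟨_, hY.hasGradient_innerProd_flowσ₂ hh (hY.hasGradient_hamiltonian hh s),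
      hY.gradient_recursion hh s.succ_ne_zero⟩
  · rfl
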